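/- **Setting.** Fix $r$. For every dimension $d>r$ consider, for $k=1,2$, the factor models $X^k_t=\Lambda_kF^k_t+\varepsilon^k_t$, $t\in\mathbb Z$, where $\Lambda_k=\Lambda_k^{(d)}\in\mathbb R^{d\times r}$, $F^k_t\in\mathbb R^r$ does not depend on $d$, and $\varepsilon^k_t=\varepsilon^{k,(d)}_t\in\mathbb R^d$. Both are observed for $t=1,\dots,T$. $\|\cdot\|$ is the spectral norm, $\|\cdot\|_F$ the Frobenius norm, a prime is the transpose, and $\Gamma_\varepsilon(h)=\mathbb E\,\varepsilon_{t+h}\varepsilon_t'$. "White noise" means: independent over time, mean zero, with a covariance matrix that does not depend on time (the coordinates may be dependent). **Assumptions.** Both models satisfy the following, written for $X_t=\Upsilon F_t+\varepsilon_t$, with constants $M,\bar\lambda$ that do not depend on $d,T$. 1. $X_t$ is (weakly) stationary, $\mathbb EX_t=0$, $\operatorname{Var}(X_{j,t})\le M$. 2. $\{F_t\}$ and $\{\varepsilon_t\}$ are independent; $F_t=\sum_{k\ge0}C_ka_{t-k}$ with $\sum_k\|C_k\|<\infty$ and $a$ an $r$-dimensional white noise with bounded fourth moments; $\mathbb EF_tF_t'$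 is positive definite; $\varepsilon_t=\sum_{k\ge0}D_kb_{t-k}$ with $\sum_k\|D_k\|\le M$ and $b$ a $d$-dimensional white noise with $\mathbb Eb_{j,t}^4\le M$. 3. For all $t_1,t_2,t\ge1$ and $i\le d$: $\frac1d\sum_{i,j=1}^d|\mathbb E(\varepsilon_{i,t_1}\varepsilon_{j,t_2})|\le M$, $\frac1{d^2}\mathbb E\|\varepsilon_t'\Upsilon\|^4\le M$, $\mathbb E\varepsilon_{i,t}^4\le M$. 4. With $\Pi_\Upsilon$ the diagonal matrix of the eigenvalues of $\Upsilon'\Upsilon$ in decreasing order: $\|\Pi_\Upsilon/d-\widetilde\Pi\|=O(1/\sqrt d)$ for a positive definite diagonal matrix $\widetilde\Pi$; the eigenvalues of $\Upsilon'\Upsilon$ are distinct; $\limsup_{d\to\infty}\sum_{h\in\mathbb Z}\|\Gamma_\varepsilon(h)\|<\infty$; and all entries of $\Upsilon$ are at most $\bar\lambda$ in absolute value. **Null hypothesis.** For every $d$, $\Lambda_1=\Lambda\Phi_1$ and $\Lambda_2=\Lambda\Phi_2$ for some $\Lambda\in\mathbb R^{d\times r}$ of full column rank and nonsingular $\Phi_1,\Phi_2\in\mathbb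 R^{r\times r}$. **Estimators.** Let $X^k$ be the $T\times d$ matrix with rows $X_t^{k\prime}$, let $\widehat Q^k_r$ have as columns orthonormal eigenvectors for the $r$ largest eigenvalues of $X^kX^{k\prime}$ (in decreasing order), and put $\widehat F^k=\sqrt T\,\widehat Q^k_r$, $\widehat\Lambda_k'=\frac1T\widehat F^{k\prime}X^k$, $\widehat P_k=\widehat\Lambda_k(\widehat\Lambda_k'\widehat\Lambda_k)^{-1}\widehat\Lambda_k'$ and $P_k=\frac12(\widehat P_k+I_d)$. Let $Y$ be the $T\times d$ matrix whose $t$-th row is $(P_1X^2_t)'$ for $t\le\lfloor T/2\rfloor$ and $(P_2X^2_t)'$ for $t>\lfloor T/2\rfloor$. Let $\widehat F=\sqrt T\,\widehat Q_r$, where the columns of $\widehat Q_r$ are orthonormal eigenvectors for the $r$ largest eigenvalues of $YY'$ (in decreasing order), and let $\widehat V_r$ be the diagonal matrix of the $r$ largest eigenvalues of $\frac1{dT}YY'$ (in decreasing order). Let $F$ be the $T\times r$ matrix with rows $F_t^{2\prime}$. The superscripts $b$ and $a$ denote the first $\lfloor T/2\rfloor$ and the remaining rows of a matrix. Put $$\widetilde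 F\widetilde H=\begin{pmatrix}F^bH_1\\F^aH_2\end{pmatrix},\qquad H_k=\frac1{dT}\Big(\Lambda_2'P_k'P_1\Lambda_2F^{b\prime}\widehat F^b+\Lambda_2'P_k'P_2\Lambda_2F^{a\prime}\widehat F^a\Big)\widehat V_r^{-1},\quad k=1,2.$$ **Proposition.** Under these assumptions and the null hypothesis, for every choice of the eigenvectors, $$\frac1{T^2}\big\|(\widehat F-\widetilde F\widetilde H)'F\big\|_F^2=O_{\mathbb P}\Big(\frac1{\delta_{dT}^4}\Big)\quad\text{as }d,T\to\infty\text{ jointly},\qquad\delta_{dT}=\min\{\sqrt d,\sqrt T\}.$$ -/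

import Mathlib

open MeasureTheory ProbabilityTheory Filter Asymptotics
open scoped Matrix ENNReal Matrix.Norms.L2Operator

/-!
In this file `‖A‖` for a real matrix `A` is the spectral norm (the operator norm for the Euclidean
norms). A time series with values in `ℝⁿ` is a map `ℤ → Ω → Fin n → ℝ`.
-/

namespace TwoSubject

noncomputable section

/-! ### Linear algebra -/

/-- The squared Frobenius norm. -/
def frobSq {m n : ℕ} (A : Matrix (Fin m) (Fin n) ℝ) : ℝ := ∑ i, ∑ j, A i j ^ 2

open Classical in
/-- The eigenvalues `eigDesc A 0 ≥ eigDesc A 1 ≥ … ≥ eigDesc A (n - 1)` of a symmetric `n × n`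
matrix, in decreasing order with multiplicities (and `0` outside of this range). -/
def eigDesc {n : ℕ} (A : Matrix (Fin n) (Fin n) ℝ) (i : ℕ) : ℝ :=
  if h : A.IsHermitian ∧ i < n then h.1.eigenvalues₀ ⟨i, by simpa using h.2⟩ else 0

/-- The columns of `Q` are orthonormal eigenvectors of `A` for its `r` largest eigenvalues, in
decreasing order of the eigenvalues. -/
structure IsLeadingEigenvectors {n r : ℕ} (A : Matrix (Fin n) (Fin n) ℝ)
    (Q : Matrix (Fin n) (Fin r) ℝ) : Prop where
  orthonormal : Qᵀ * Q = 1
  eigen : A * Q = Q * Matrix.diagonal fun i : Fin r => eigDesc A i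

/-- Leading eigenvectors exist. -/
theorem exists_isLeadingEigenvectors {n r : ℕ} (A : Matrix (Fin n) (Fin n) ℝ) (hA : A.IsHermitian) (hr : r ≤ n) :
    ∃ Q : Matrix (Fin n) (Fin r) ℝ, IsLeadingEigenvectors A Q := by
  classical
  let e : Fin (Fintype.card (Fin n)) ≃ Fin n := Fintype.equivOfCardEq (Fintype.card_fin _)
  let g : Fin r → Fin n := fun i => e ⟨i, by simp; omega⟩
  have hg : Function.Injective g := by
    intro i j h; have := e.injective h; simpa [Fin.ext_iff] using this
  refine ⟨Matrix.of fun i j => hA.eigenvectorBasis (g j) i, ?_, ?_⟩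
  · ext i j
    have := orthonormal_iff_ite.1 hA.eigenvectorBasis.orthonormal (g i) (g j)
    simp only [EuclideanSpace.inner_eq_star_dotProduct] at this
    simp only [Matrix.mul_apply, Matrix.transpose_apply, Matrix.of_apply, Matrix.one_apply]
    simp only [hg.eq_iff] at this
    rw [← this]
    simp [dotProduct, mul_comm]
  · ext i j
    have := congrFun (hA.mulVec_eigenvectorBasis (g j)) i
    rw [Matrix.mul_diagonal]
    simp only [Matrix.mul_apply, Matrix.of_apply]
    have h2 : eigDesc A j = hA.eigenvalues (g j) := by
      have hj : (j : ℕ) < n := by omega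
      simp only [eigDesc, hA, hj, and_self, dite_true]
      simp [Matrix.IsHermitian.eigenvalues, g, e]
    rw [h2]
    simpa [Matrix.mulVec, dotProduct, mul_comm] using this

/-! ### Time series -/

section Series

variable {Ω : Type*} [MeasurableSpace Ω] (μ : Measure Ω) {n : ℕ}

/-- Weak (second-order) stationarity. -/
structure IsWeaklyStationary (Z : ℤ → Ω → Fin n → ℝ) : Prop where
  memLp : ∀ t i, MemLp (fun ω => Z t ω i) 2 μ
  mean : ∀ s t i, ∫ ω, Z s ω i ∂μ = ∫ ω, Z t ω i ∂μ
  cov : ∀ s t h i j, cov[fun ω => Z (s + h) ω i, fun ω => Z s ω j; μ] =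
    cov[fun ω => Z (t + h) ω i, fun ω => Z t ω j; μ]

/-- The autocovariance matrix `Γ(h) = E Z_h Z_0'` of a weakly stationary mean-zero series. -/
def autocov (Z : ℤ → Ω → Fin n → ℝ) (h : ℤ) : Matrix (Fin n) (Fin n) ℝ :=
  Matrix.of fun i j => ∫ ω, Z h ω i * Z 0 ω j ∂μ

/-- (Strong) white noise: independent over time, mean zero, with a covariance matrix that does
not depend on time. The coordinates at one time may be dependent. -/
structure IsWhiteNoise (a : ℤ → Ω → Fin n → ℝ) : Prop where
  measurable : ∀ t, Measurable (a t)
  memLp : ∀ t i, MemLp (fun ω => a t ω i) 2 μ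
  mean : ∀ t i, ∫ ω, a t ω i ∂μ = 0
  cov : ∀ s t i j, ∫ ω, a s ω i * a s ω j ∂μ = ∫ ω, a t ω i * a t ω j ∂μ
  indep : iIndepFun a μ

/-- All fourth moments of the coordinates of the series are at most `M`. -/
def FourthMomentsLE (a : ℤ → Ω → Fin n → ℝ) (M : ℝ) : Prop :=
  ∀ t i, Integrable (fun ω => a t ω i ^ 4) μ ∧ ∫ ω, a t ω i ^ 4 ∂μ ≤ M

/-- `Z_t = ∑_{k ≥ 0} C_k a_{t-k}` almost surely, for every `t`. -/
def IsLinearProcess (C : ℕ → Matrix (Fin n) (Fin n) ℝ) (a Z : ℤ → Ω → Fin n → ℝ) : Prop :=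
  ∀ t : ℤ, ∀ᵐ ω ∂μ, HasSum (fun k : ℕ => C k *ᵥ a (t - k) ω) (Z t ω)

end Series

/-! ### The factor model and its assumptions -/

section Assumptions

variable {Ω : Type*} [MeasurableSpace Ω] (μ : Measure Ω) {r : ℕ}

/-- The observed series `X_t = Υ F_t + ε_t`. -/
def observed {d : ℕ} (Υ : Matrix (Fin d) (Fin r) ℝ) (F : ℤ → Ω → Fin r → ℝ)
    (ε : ℤ → Ω → Fin d → ℝ) : ℤ → Ω → Fin d → ℝ :=
  fun t ω => Υ *ᵥ F t ω + ε t ω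

variable (Υ : ∀ d : ℕ, Matrix (Fin d) (Fin r) ℝ) (F : ℤ → Ω → Fin r → ℝ)
  (ε : ∀ d : ℕ, ℤ → Ω → Fin d → ℝ)

/-- `X` is stationary with mean zero, with variances bounded uniformly in the dimension. -/
structure ObservedAssumption : Prop where
  stationary : ∀ d, r < d → IsWeaklyStationary μ (observed (Υ d) F (ε d))
  mean_zero : ∀ d, r < d → ∀ t i, ∫ ω, observed (Υ d) F (ε d) t ω i ∂μ = 0
  variance_le : ∃ M : ℝ, ∀ d, r < d → ∀ t i,
    Var[fun ω => observed (Υ d) F (ε d) t ω i; μ] ≤ M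

/-- Factors and errors are independent of each other and have linear representations. -/
structure WoldAssumption : Prop where
  measurable_factor : ∀ t, Measurable (F t)
  measurable_error : ∀ d, r < d → ∀ t, Measurable (ε d t)
  indep : ∀ d, r < d → IndepFun (fun ω t => F t ω) (fun ω t => ε d t ω) μ
  factor : ∃ (C : ℕ → Matrix (Fin r) (Fin r) ℝ) (a : ℤ → Ω → Fin r → ℝ),
    IsWhiteNoise μ a ∧ (∃ M : ℝ, FourthMomentsLE μ a M) ∧
    (Summable fun k => ‖C k‖) ∧ IsLinearProcess μ C a F
  factor_cov : (autocov μ F 0).PosDef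
  error : ∃ M : ℝ, ∀ d, r < d →
    ∃ (D : ℕ → Matrix (Fin d) (Fin d) ℝ) (b : ℤ → Ω → Fin d → ℝ),
      IsWhiteNoise μ b ∧ FourthMomentsLE μ b M ∧
      (Summable fun k => ‖D k‖) ∧ ∑' k, ‖D k‖ ≤ M ∧ IsLinearProcess μ D b (ε d)

/-- Further bounds on the idiosyncratic errors at the times `t ≥ 1`. -/
structure ErrorMomentAssumption : Prop where
  cross : ∃ M : ℝ, ∀ d, r < d → ∀ s t : ℤ, 1 ≤ s → 1 ≤ t →
    1 / (d : ℝ) * ∑ i, ∑ j, |∫ ω, ε d s ω i * ε d t ω j ∂μ| ≤ M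
  projected : ∃ M : ℝ, ∀ d, r < d → ∀ t : ℤ, 1 ≤ t →
    Integrable (fun ω => (∑ l, (ε d t ω ᵥ* Υ d) l ^ 2) ^ 2) μ ∧
    1 / (d : ℝ) ^ 2 * ∫ ω, (∑ l, (ε d t ω ᵥ* Υ d) l ^ 2) ^ 2 ∂μ ≤ M
  fourth : ∃ M : ℝ, ∀ d, r < d → ∀ t : ℤ, 1 ≤ t → ∀ i,
    Integrable (fun ω => ε d t ω i ^ 4) μ ∧ ∫ ω, ε d t ω i ^ 4 ∂μ ≤ M

/-- The diagonal matrix of the eigenvalues of `Υ' Υ`, in decreasing order. -/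
def eigMatrix {d : ℕ} (Υ : Matrix (Fin d) (Fin r) ℝ) : Matrix (Fin r) (Fin r) ℝ :=
  Matrix.diagonal fun i => eigDesc (Υᵀ * Υ) i

/-- Conditions on the loadings and on the errors as the dimension `d` tends to infinity:
convergence of the scaled eigenvalues of `Υ' Υ`, distinct eigenvalues, summable autocovariances
of the errors, and bounded loadings. -/
structure CrossSectionAssumption : Prop where
  eig_limit : ∃ p : Fin r → ℝ, (∀ i, 0 < p i) ∧
    (fun d : ℕ => ‖(1 / (d : ℝ)) • eigMatrix (Υ d) - Matrix.diagonal p‖)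
      =O[atTop] fun d : ℕ => 1 / √(d : ℝ)
  eig_distinct : ∀ d, r < d → Function.Injective fun i : Fin r => eigDesc ((Υ d)ᵀ * Υ d) i
  error_autocov :
    limsup (fun d => ∑' h : ℤ, ENNReal.ofReal ‖autocov μ (ε d) h‖) atTop < ⊤
  loadings_bdd : ∃ M : ℝ, ∀ d, r < d → ∀ i j, |Υ d i j| ≤ M

/-- All assumptions on a single factor model `X_t = Υ F_t + ε_t` with `r` factors, for the
dimensions `d > r`. The factors do not depend on the dimension `d`. -/
structure FactorModelAssumptions : Prop where
  observed : ObservedAssumption μ Υ F ε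
  wold : WoldAssumption μ F ε
  errorMoment : ErrorMomentAssumption μ Υ ε
  crossSection : CrossSectionAssumption μ Υ ε

/-- The null hypothesis: `Λ_k = Λ Φ_k` with `Λ` of full column rank and `Φ_1, Φ_2` nonsingular. -/
def NullHypothesis (Λ₁ Λ₂ : ∀ d : ℕ, Matrix (Fin d) (Fin r) ℝ) : Prop :=
  ∀ d, r < d → ∃ (Λ : Matrix (Fin d) (Fin r) ℝ) (Φ₁ Φ₂ : Matrix (Fin r) (Fin r) ℝ),
    Λ.rank = r ∧ IsUnit Φ₁ ∧ IsUnit Φ₂ ∧ Λ₁ d = Λ * Φ₁ ∧ Λ₂ d = Λ * Φ₂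

end Assumptions

/-! ### Estimators -/

section Estimators

variable {Ω : Type*} {d r T : ℕ}

/-- The matrix with the rows `Z_1', …, Z_T'`. -/
def sample {n : ℕ} (Z : ℤ → Ω → Fin n → ℝ) (T : ℕ) (ω : Ω) : Matrix (Fin T) (Fin n) ℝ :=
  Matrix.of fun s i => Z ((s : ℤ) + 1) ω i

/-- The PCA factors `√T Q`, for the matrix `Q` of leading eigenvectors. -/
def pcaFactors (Q : Matrix (Fin T) (Fin r) ℝ) : Matrix (Fin T) (Fin r) ℝ := √(T : ℝ) • Q

/-- The PCA loadings `Λ̂`, given by `Λ̂' = T⁻¹ F̂' X`. -/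
def pcaLoadings (X : Matrix (Fin T) (Fin d) ℝ) (Q : Matrix (Fin T) (Fin r) ℝ) :
    Matrix (Fin d) (Fin r) ℝ :=
  ((1 / (T : ℝ)) • ((pcaFactors Q)ᵀ * X))ᵀ

/-- The projection `L (L' L)⁻¹ L'` onto the column space of `L`. -/
def colProj (L : Matrix (Fin d) (Fin r) ℝ) : Matrix (Fin d) (Fin d) ℝ := L * (Lᵀ * L)⁻¹ * Lᵀ

/-- The matrix `P̂_I = (P̂ + I) / 2`, where `P̂` projects onto the span of the PCA loadings. -/
def shiftedProj (X : Matrix (Fin T) (Fin d) ℝ) (Q : Matrix (Fin T) (Fin r) ℝ) :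
    Matrix (Fin d) (Fin d) ℝ :=
  (1 / 2 : ℝ) • (colProj (pcaLoadings X Q) + 1)

/-- The transformed data: rows `(P₁ X_t)'` in the first half (`t ≤ T / 2`), rows `(P₂ X_t)'`
in the second half. -/
def transformed (P₁ P₂ : Matrix (Fin d) (Fin d) ℝ) (X : Matrix (Fin T) (Fin d) ℝ) :
    Matrix (Fin T) (Fin d) ℝ :=
  Matrix.of fun s => if (s : ℕ) < T / 2 then P₁ *ᵥ X s else P₂ *ᵥ X s

/-- The diagonal matrix of the `r` largest eigenvalues of `(T d)⁻¹ Y Y'`. -/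
def pcaEigenvalues (r : ℕ) (Y : Matrix (Fin T) (Fin d) ℝ) : Matrix (Fin r) (Fin r) ℝ :=
  Matrix.diagonal fun i => eigDesc ((1 / ((T : ℝ) * d)) • (Y * Yᵀ)) i

/-- The `T × 2r` block-diagonal matrix with the blocks `F^b` (first half of the rows of `F`) and
`F^a` (second half). -/
def splitFactors (F : Matrix (Fin T) (Fin r) ℝ) : Matrix (Fin T) (Fin r ⊕ Fin r) ℝ :=
  Matrix.fromCols (Matrix.of fun s j => if (s : ℕ) < T / 2 then F s j else 0)
    (Matrix.of fun s j => if (s : ℕ) < T / 2 then 0 else F s j)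

/-- The `2r × 2r` matrix with the blocks `L' Pᵢ' Pⱼ L`. -/
def projectedGram (P₁ P₂ : Matrix (Fin d) (Fin d) ℝ) (L : Matrix (Fin d) (Fin r) ℝ) :
    Matrix (Fin r ⊕ Fin r) (Fin r ⊕ Fin r) ℝ :=
  Matrix.fromBlocks (Lᵀ * P₁ᵀ * P₁ * L) (Lᵀ * P₁ᵀ * P₂ * L)
    (Lᵀ * P₂ᵀ * P₁ * L) (Lᵀ * P₂ᵀ * P₂ * L)

/-- The `2r × r` rotation matrix with the blocks `H₁` and `H₂`:
`H̃ = (d T)⁻¹ Λ_P F̃' F̂ V̂⁻¹`. -/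
def rotation (P₁ P₂ : Matrix (Fin d) (Fin d) ℝ) (L : Matrix (Fin d) (Fin r) ℝ)
    (F Fhat : Matrix (Fin T) (Fin r) ℝ) (V : Matrix (Fin r) (Fin r) ℝ) :
    Matrix (Fin r ⊕ Fin r) (Fin r) ℝ :=
  (1 / ((d : ℝ) * T)) • (projectedGram P₁ P₂ L * (splitFactors F)ᵀ * Fhat * V⁻¹)

/-- The transformed data matrix of the second series, from the data matrices `X₁, X₂` of the two
series and the leading eigenvectors `Q₁, Q₂` of `X₁ X₁'` and `X₂ X₂'`. -/
def transformedData (X₁ X₂ : Matrix (Fin T) (Fin d) ℝ) (Q₁ Q₂ : Matrix (Fin T) (Fin r) ℝ) :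
    Matrix (Fin T) (Fin d) ℝ :=
  transformed (shiftedProj X₁ Q₁) (shiftedProj X₂ Q₂) X₂

/-- The estimation error `F̂ - F̃ H̃`, from the data matrices `X₁, X₂`, the loadings `L` and the
factors `F` of the second series, the leading eigenvectors `Q₁, Q₂` of `X₁ X₁'` and `X₂ X₂'`, and
the leading eigenvectors `Q` of `Y Y'` for the transformed data matrix `Y`. -/
def factorError (X₁ X₂ : Matrix (Fin T) (Fin d) ℝ) (L : Matrix (Fin d) (Fin r) ℝ)
    (F Q₁ Q₂ Q : Matrix (Fin T) (Fin r) ℝ) : Matrix (Fin T) (Fin r) ℝ :=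
  pcaFactors Q - splitFactors F *
    rotation (shiftedProj X₁ Q₁) (shiftedProj X₂ Q₂) L F (pcaFactors Q)
      (pcaEigenvalues r (transformedData X₁ X₂ Q₁ Q₂))

end Estimators

/-! ### Stochastic order -/

/-- `δ_{dT} = min (√d) (√T)`. -/
def delta (d T : ℕ) : ℝ := min (√(d : ℝ)) (√(T : ℝ))

/-- `Z_{dT} = O_P(ρ_{dT})` as `d, T → ∞` jointly. (`μ` is applied as an outer measure, so `Z` need
not be measurable.) -/
def IsBigOP {Ω : Type*} [MeasurableSpace Ω] (μ : Measure Ω) (Z : ℕ → ℕ → Ω → ℝ)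
    (ρ : ℕ → ℕ → ℝ) : Prop :=
  ∀ η : ℝ, 0 < η → ∃ K : ℝ, ∀ᶠ q : ℕ × ℕ in atTop,
    μ {ω | K * ρ q.1 q.2 < |Z q.1 q.2 ω|} ≤ ENNReal.ofReal η

end

end TwoSubject

namespace TwoSubject

set_option linter.unusedSectionVars false

/-! ### The spectral norm -/

section SpectralNorm

variable {m n k : Type*} [Fintype m] [Fintype n] [Fintype k] [DecidableEq m] [DecidableEq n]
  [DecidableEq k]

/-! Put f = F/√T, l = Λ/√d, e = ε/√(Td) and κ = 1/δ, and let D_i select the rows of one half of the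
sample. With high probability the scaled model satisfies `RegularModel`: f (already on the first
half) and l have singular values bounded above and below, el and f'D_i e are O(κ), and the doubly
averaged f'D_i e l is O(κ²). The noise alone only satisfies ‖e‖² = O(κ), because the concentration
of ε'ε/T is measured in the Frobenius norm. On this event the rest is deterministic perturbation
theory.

Up to the factor √(Td), the transformed data are s + n with s = ∑ D_i f l' P_i and n = ∑ D_i e P_i.
For q = F̂/√T the eigenvector equation gives E := q - ss'qV⁻¹ = (sn' + ns' + nn')qV⁻¹
(`pca_expansion`), and ss'qV⁻¹ is exactly F̃H̃/√T (`factorError_eq`). Each of the three products is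
O(κ), hence so is E. The claimed rate needs the sharper E'f = O(κ²). Where only one factor κ is
visible, the second comes from substituting q' = V⁻¹q'ss' + E': the s' part produces an average
f'D_j e, and the E' part is small already (`RegularModel.norm_error_transpose_mul_le`).

The matrices P_i depend on the errors, so moments of f'D_j e P_j P_i l are out of reach. But P_i l =
l + O(κ), so this product differs from f'D_j e l by products of two O(κ) terms. For P₂ this is the
consistency of the estimated loading space (`RegularModel.norm_projection_le`); for P₁ the null
hypothesis transfers it, since l₂ = l₁Ψ with Ψ bounded. The eigenvalues in V stay away from zero
because P_i = (P̂_i + 1)/2 shrinks no vector by more than a factor of two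
(`RegularModel.le_eigDesc`).

Regularity holds with high probability by Markov's inequality. The mixed terms use the independence
of factors and errors and the summable autocovariances; the sample covariances use the linear
representations, by truncation to finite moving averages and Fatou's lemma. -/

theorem norm_toLp_sq (x : n → ℝ) : ‖WithLp.toLp 2 x‖ ^ 2 = x ⬝ᵥ x := by
  rw [EuclideanSpace.norm_sq_eq]
  simp [dotProduct, sq]

theorem dotProduct_self_nonneg' (x : n → ℝ) : 0 ≤ x ⬝ᵥ x := by
  rw [← norm_toLp_sq]; positivity

theorem mulVec_dotProduct_self_le (A : Matrix m n ℝ) (x : n → ℝ) :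
    (A *ᵥ x) ⬝ᵥ (A *ᵥ x) ≤ ‖A‖ ^ 2 * (x ⬝ᵥ x) := by
  have h := Matrix.l2_opNorm_mulVec A (WithLp.toLp 2 x)
  have h' : ‖WithLp.toLp 2 (A *ᵥ x)‖ ≤ ‖A‖ * ‖WithLp.toLp 2 x‖ := h
  rw [← norm_toLp_sq, ← norm_toLp_sq, ← mul_pow]
  exact pow_le_pow_left₀ (norm_nonneg _) h' 2

theorem norm_le_of_mulVec_dotProduct_self_le (A : Matrix m n ℝ) {c : ℝ} (hc : 0 ≤ c)
    (h : ∀ x : n → ℝ, (A *ᵥ x) ⬝ᵥ (A *ᵥ x) ≤ c ^ 2 * (x ⬝ᵥ x)) : ‖A‖ ≤ c := by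
  rw [Matrix.l2_opNorm_def]
  refine ContinuousLinearMap.opNorm_le_bound _ hc fun x => ?_
  have h' : ‖WithLp.toLp 2 (A *ᵥ x.ofLp)‖ ^ 2 ≤ (c * ‖x‖) ^ 2 := by
    rw [norm_toLp_sq, mul_pow]
    have := h x.ofLp
    rwa [← norm_toLp_sq x.ofLp] at this
  exact le_of_sq_le_sq h' (by positivity)

theorem norm_transpose (A : Matrix m n ℝ) : ‖Aᵀ‖ = ‖A‖ := by
  rw [← Matrix.conjTranspose_eq_transpose_of_trivial, Matrix.l2_opNorm_conjTranspose]

theorem norm_transpose_mul_self (A : Matrix m n ℝ) : ‖Aᵀ * A‖ = ‖A‖ ^ 2 := by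
  rw [← Matrix.conjTranspose_eq_transpose_of_trivial, Matrix.l2_opNorm_conjTranspose_mul_self, sq]

theorem norm_mul_transpose_self (A : Matrix m n ℝ) : ‖A * Aᵀ‖ = ‖A‖ ^ 2 := by
  rw [← norm_transpose A, ← norm_transpose_mul_self, Matrix.transpose_transpose]

theorem norm_mul_le_of_le {A : Matrix m n ℝ} {B : Matrix n k ℝ} {a b : ℝ} (hA : ‖A‖ ≤ a)
    (hB : ‖B‖ ≤ b) : ‖A * B‖ ≤ a * b :=
  (Matrix.l2_opNorm_mul A B).trans
    (mul_le_mul hA hB (norm_nonneg _) ((norm_nonneg _).trans hA))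

theorem norm_one_le : ‖(1 : Matrix n n ℝ)‖ ≤ 1 :=
  norm_le_of_mulVec_dotProduct_self_le _ zero_le_one fun x => by simp

theorem norm_le_one_of_transpose_mul_self {A : Matrix m n ℝ} (h : Aᵀ * A = 1) : ‖A‖ ≤ 1 := by
  have := norm_transpose_mul_self A
  rw [h] at this
  have h1 : ‖(1 : Matrix n n ℝ)‖ ≤ 1 := norm_one_le
  nlinarith [norm_nonneg A]

theorem mulVec_dotProduct (A : Matrix m n ℝ) (x : n → ℝ) (y : m → ℝ) :
    (A *ᵥ x) ⬝ᵥ y = x ⬝ᵥ (Aᵀ *ᵥ y) := by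
  rw [Matrix.mulVec_transpose, dotProduct_comm, Matrix.dotProduct_mulVec, dotProduct_comm]

/-- Cauchy-Schwarz. -/
theorem dotProduct_sq_le (x y : n → ℝ) : (x ⬝ᵥ y) ^ 2 ≤ (x ⬝ᵥ x) * (y ⬝ᵥ y) := by
  have := Finset.sum_mul_sq_le_sq_mul_sq Finset.univ x y
  simpa [dotProduct, sq] using this

/-- A symmetric idempotent matrix is a contraction. -/
theorem idempotent_mulVec_dotProduct {P : Matrix n n ℝ} (hs : Pᵀ = P) (hi : P * P = P)
    (x : n → ℝ) : (P *ᵥ x) ⬝ᵥ x = (P *ᵥ x) ⬝ᵥ (P *ᵥ x) := by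
  rw [mulVec_dotProduct, mulVec_dotProduct, hs, Matrix.mulVec_mulVec, hi]

/-- Cauchy-Schwarz in |Px|² = ⟨Px, x⟩ gives |Px|⁴ ≤ |Px|²|x|². -/
theorem norm_idempotent_le {P : Matrix n n ℝ} (hs : Pᵀ = P) (hi : P * P = P) : ‖P‖ ≤ 1 := by
  refine norm_le_of_mulVec_dotProduct_self_le _ zero_le_one fun x => ?_
  have h1 := idempotent_mulVec_dotProduct hs hi x
  have h2 := dotProduct_sq_le (P *ᵥ x) x
  rw [h1] at h2
  have h3 := dotProduct_self_nonneg' (P *ᵥ x)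
  have h4 := dotProduct_self_nonneg' x
  by_contra hcon
  push Not at hcon
  nlinarith

end SpectralNorm

/-! ### The Frobenius norm against the spectral norm. -/

section Frobenius

variable {m n : ℕ}

theorem frobSq_nonneg (A : Matrix (Fin m) (Fin n) ℝ) : 0 ≤ frobSq A := by
  unfold frobSq; positivity

theorem norm_sq_le_frobSq (A : Matrix (Fin m) (Fin n) ℝ) : ‖A‖ ^ 2 ≤ frobSq A := by
  have h0 := frobSq_nonneg A
  have h : ‖A‖ ≤ √(frobSq A) := by
    refine norm_le_of_mulVec_dotProduct_self_le _ (Real.sqrt_nonneg _) fun x => ?_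
    rw [Real.sq_sqrt h0, frobSq, Finset.sum_mul]
    refine Finset.sum_le_sum fun i _ => ?_
    have := dotProduct_sq_le (A i) x
    simpa [Matrix.mulVec, dotProduct, sq] using this
  calc ‖A‖ ^ 2 ≤ √(frobSq A) ^ 2 := pow_le_pow_left₀ (norm_nonneg _) h 2
    _ = _ := Real.sq_sqrt h0

/-- Each column is the image of a unit vector. The factor is the number of columns, which stays
equal to r in the applications. -/
theorem frobSq_le_norm_sq (A : Matrix (Fin m) (Fin n) ℝ) : frobSq A ≤ n * ‖A‖ ^ 2 := by
  unfold frobSq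
  rw [Finset.sum_comm]
  have : ∀ j ∈ Finset.univ, ∑ i, A i j ^ 2 ≤ ‖A‖ ^ 2 := fun j _ => by
    have := mulVec_dotProduct_self_le A (Pi.single j 1)
    simpa [dotProduct, sq, Pi.single_apply] using this
  simpa using Finset.sum_le_sum this

theorem frobSq_transpose (A : Matrix (Fin m) (Fin n) ℝ) : frobSq Aᵀ = frobSq A := by
  unfold frobSq
  rw [Finset.sum_comm]; rfl

theorem frobSq_smul (c : ℝ) (A : Matrix (Fin m) (Fin n) ℝ) :
    frobSq (c • A) = c ^ 2 * frobSq A := by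
  simp [frobSq, Finset.mul_sum, mul_pow]

end Frobenius

/-! ### Eigenvalues -/

section Eigenvalues

variable {n r : ℕ}

theorem eigDesc_antitone {A : Matrix (Fin n) (Fin n) ℝ} (hA : A.IsHermitian) {i j : ℕ}
    (hij : i ≤ j) (hj : j < n) : eigDesc A j ≤ eigDesc A i := by
  have hi : i < n := by omega
  simp only [eigDesc, hA, hi, hj, and_self, dite_true]
  exact hA.eigenvalues₀_antitone (by simpa using hij)

/-- The easy direction of the Courant-Fischer theorem: a lower bound for the quadratic form on the
range of an injective matrix with `r` columns bounds the `r` largest eigenvalues. -/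
theorem le_eigDesc {A : Matrix (Fin n) (Fin n) ℝ} (hA : A.IsHermitian)
    (B : Matrix (Fin n) (Fin r) ℝ) (hB : ∀ u, B *ᵥ u = 0 → u = 0) {v : ℝ}
    (h : ∀ u, v * ((B *ᵥ u) ⬝ᵥ (B *ᵥ u)) ≤ (B *ᵥ u) ⬝ᵥ (A *ᵥ (B *ᵥ u))) {i : ℕ} (hi : i < r) :
    v ≤ eigDesc A i := by
  have hrn : r ≤ n := by
    have : Function.Injective B.mulVecLin := by
      rw [← LinearMap.ker_eq_bot, LinearMap.ker_eq_bot']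
      exact hB
    simpa using LinearMap.finrank_le_finrank_of_injective this
  obtain ⟨V, hV⟩ := exists_isLeadingEigenvectors A hA (le_refl n)
  -- Dimension count: i < r linear conditions on ℝ^r leave a nonzero u such that Bu is orthogonal to
  -- the first i eigenvectors. On their orthogonal complement the quadratic form is at most the
  -- eigenvalue number i.
  obtain ⟨u, hu, hu0⟩ : ∃ u : Fin r → ℝ,
      (∀ j : Fin n, (j : ℕ) < i → (Vᵀ *ᵥ (B *ᵥ u)) j = 0) ∧ u ≠ 0 := by
    let f : (Fin r → ℝ) →ₗ[ℝ] (Fin i → ℝ) :=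
      (LinearMap.funLeft ℝ ℝ fun j : Fin i => (⟨j, by omega⟩ : Fin n)) ∘ₗ (Vᵀ * B).mulVecLin
    have hk : LinearMap.ker f ≠ ⊥ := LinearMap.ker_ne_bot_of_finrank_lt (by simpa using hi)
    obtain ⟨u, hu, hu0⟩ := Submodule.exists_mem_ne_zero_of_ne_bot hk
    refine ⟨u, fun j hj => ?_, hu0⟩
    have := congrFun (LinearMap.mem_ker.1 hu) ⟨j, hj⟩
    rw [Matrix.mulVec_mulVec]
    exact this
  set x := B *ᵥ u
  set c := Vᵀ *ᵥ x
  have hV1 : V * Vᵀ = 1 := mul_eq_one_comm.1 hV.orthonormal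
  have hx : x = V *ᵥ c := by simp [c, Matrix.mulVec_mulVec, hV1]
  have hxx : x ⬝ᵥ x = ∑ j, c j ^ 2 := by
    clear_value c
    rw [hx, mulVec_dotProduct, Matrix.mulVec_mulVec, hV.orthonormal]
    simp [dotProduct, sq]
  have hAx : x ⬝ᵥ (A *ᵥ x) = ∑ j : Fin n, eigDesc A j * c j ^ 2 := by
    clear_value c
    rw [hx, Matrix.mulVec_mulVec, hV.eigen, mulVec_dotProduct, Matrix.mulVec_mulVec,
      ← Matrix.mul_assoc, hV.orthonormal, Matrix.one_mul]
    simp only [dotProduct, Matrix.mulVec_diagonal]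
    exact Finset.sum_congr rfl fun j _ => by ring
  have hpos : 0 < x ⬝ᵥ x := by
    refine lt_of_le_of_ne (dotProduct_self_nonneg' x) fun h0 => hu0 (hB u ?_)
    exact dotProduct_self_eq_zero.1 h0.symm
  have hle : x ⬝ᵥ (A *ᵥ x) ≤ eigDesc A i * (x ⬝ᵥ x) := by
    rw [hAx, hxx, Finset.mul_sum]
    refine Finset.sum_le_sum fun j _ => ?_
    by_cases hj : (j : ℕ) < i
    · simp [hu j hj]
    · exact mul_le_mul_of_nonneg_right (eigDesc_antitone hA (not_lt.1 hj) j.2) (sq_nonneg _)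
  exact le_of_mul_le_mul_right ((h u).trans hle) hpos

/-- Test the scaled matrix on the span of the first i + 1 eigenvectors of A. The reverse inequality
comes from the same statement for c⁻¹. -/
theorem mul_eigDesc_le {A : Matrix (Fin n) (Fin n) ℝ} (hA : A.IsHermitian) {c : ℝ} (hc : 0 ≤ c)
    {i : ℕ} (hi : i < n) : c * eigDesc A i ≤ eigDesc (c • A) i := by
  obtain ⟨V, hV⟩ := exists_isLeadingEigenvectors (r := i + 1) A hA hi
  have hcA : (c • A).IsHermitian := by
    unfold Matrix.IsHermitian
    rw [Matrix.conjTranspose_smul, hA.eq]; simp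
  refine le_eigDesc hcA V (fun u hu => ?_) (fun u => ?_) (Nat.lt_succ_self i)
  · have : Vᵀ *ᵥ (V *ᵥ u) = u := by simp [Matrix.mulVec_mulVec, hV.orthonormal]
    rw [← this, hu, Matrix.mulVec_zero]
  · have h1 : (V *ᵥ u) ⬝ᵥ (V *ᵥ u) = ∑ j, u j ^ 2 := by
      rw [mulVec_dotProduct, Matrix.mulVec_mulVec, hV.orthonormal]
      simp [dotProduct, sq]
    have h2 : (V *ᵥ u) ⬝ᵥ ((c • A) *ᵥ (V *ᵥ u)) =
        c * ∑ j : Fin (i + 1), eigDesc A j * u j ^ 2 := by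
      rw [Matrix.smul_mulVec, dotProduct_smul, smul_eq_mul, Matrix.mulVec_mulVec, hV.eigen,
        mulVec_dotProduct, Matrix.mulVec_mulVec, ← Matrix.mul_assoc, hV.orthonormal,
        Matrix.one_mul]
      congr 1
      simp only [dotProduct, Matrix.mulVec_diagonal]
      exact Finset.sum_congr rfl fun j _ => by ring
    rw [h1, h2, mul_assoc, Finset.mul_sum]
    refine mul_le_mul_of_nonneg_left (Finset.sum_le_sum fun j _ => ?_) hc
    exact mul_le_mul_of_nonneg_right (eigDesc_antitone hA (by omega) hi) (sq_nonneg _)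

theorem eigDesc_smul {A : Matrix (Fin n) (Fin n) ℝ} (hA : A.IsHermitian) {c : ℝ} (hc : 0 < c)
    {i : ℕ} (hi : i < n) : eigDesc (c • A) i = c * eigDesc A i := by
  refine le_antisymm ?_ (mul_eigDesc_le hA hc.le hi)
  have hcA : (c • A).IsHermitian := by
    unfold Matrix.IsHermitian
    rw [Matrix.conjTranspose_smul, hA.eq]; simp
  have h := mul_eigDesc_le hcA (inv_nonneg.2 hc.le) hi
  rw [smul_smul, inv_mul_cancel₀ hc.ne', one_smul] at h
  rwa [inv_mul_le_iff₀ hc] at h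

end Eigenvalues

/-! ### Deterministic perturbation bounds -/

section Deterministic

variable {T d r : ℕ}

/-- A resolution of the identity into two orthogonal projections. -/
structure IsSplit (D : Bool → Matrix (Fin T) (Fin T) ℝ) : Prop where
  symm : ∀ i, (D i)ᵀ = D i
  idem : ∀ i, D i * D i = D i
  orth : ∀ i, D i * D (!i) = 0
  sum : D true + D false = 1

theorem IsSplit.norm_le {D : Bool → Matrix (Fin T) (Fin T) ℝ} (hD : IsSplit D) (i : Bool) :
    ‖D i‖ ≤ 1 := norm_idempotent_le (hD.symm i) (hD.idem i)

theorem IsSplit.mul_mul {k : ℕ} {D : Bool → Matrix (Fin T) (Fin T) ℝ} (hD : IsSplit D)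
    (i j : Bool) (A : Matrix (Fin T) (Fin k) ℝ) :
    D i * (D j * A) = if i = j then D i * A else 0 := by
  rw [← Matrix.mul_assoc]
  split_ifs with h
  · rw [← h, hD.idem]
  · obtain rfl : j = !i := by cases i <;> cases j <;> simp_all
    rw [hD.orth, Matrix.zero_mul]

/-- Bounds for the scaled factors `f`, loadings `l` and errors `e` of a factor model, at the
rate `κ`. -/
structure RegularModel (K c κ : ℝ) (D : Bool → Matrix (Fin T) (Fin T) ℝ)
    (f : Matrix (Fin T) (Fin r) ℝ) (l : Matrix (Fin d) (Fin r) ℝ)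
    (e : Matrix (Fin T) (Fin d) ℝ) : Prop where
  f_le : ‖f‖ ≤ K
  f_ge : ∀ u, c ^ 2 * (u ⬝ᵥ u) ≤ ((D true * f) *ᵥ u) ⬝ᵥ ((D true * f) *ᵥ u)
  l_le : ‖l‖ ≤ K
  l_ge : ∀ u, c ^ 2 * (u ⬝ᵥ u) ≤ (l *ᵥ u) ⬝ᵥ (l *ᵥ u)
  e_le : ‖e‖ ≤ K
  e_sq_le : ‖e‖ ^ 2 ≤ K * κ
  el_le : ‖e * l‖ ≤ K * κ
  fe_le : ∀ i, ‖fᵀ * D i * e‖ ≤ K * κ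
  fel_le : ∀ i, ‖fᵀ * D i * e * l‖ ≤ K * κ ^ 2

theorem RegularModel.mono {K K' c κ : ℝ} {D : Bool → Matrix (Fin T) (Fin T) ℝ}
    {f : Matrix (Fin T) (Fin r) ℝ} {l : Matrix (Fin d) (Fin r) ℝ} {e : Matrix (Fin T) (Fin d) ℝ}
    (h : RegularModel K c κ D f l e) (hκ : 0 ≤ κ) (hK : K ≤ K') :
    RegularModel K' c κ D f l e where
  f_le := h.f_le.trans hK
  f_ge := h.f_ge
  l_le := h.l_le.trans hK
  l_ge := h.l_ge
  e_le := h.e_le.trans hK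
  e_sq_le := h.e_sq_le.trans (by gcongr)
  el_le := h.el_le.trans (by gcongr)
  fe_le i := (h.fe_le i).trans (by gcongr)
  fel_le i := (h.fel_le i).trans (by gcongr)

theorem dotProduct_add_self_le (x y : Fin d → ℝ) :
    (x ⬝ᵥ x) ≤ 2 * ((x + y) ⬝ᵥ (x + y)) + 2 * (y ⬝ᵥ y) := by
  simp only [dotProduct, Finset.mul_sum, ← Finset.sum_add_distrib, Pi.add_apply]
  refine Finset.sum_le_sum fun i _ => ?_
  nlinarith [sq_nonneg (x i + 2 * y i)]

/-- The leading eigenvalues of the transformed data are bounded away from zero. -/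
theorem RegularModel.le_eigDesc {K c κ : ℝ} {D : Bool → Matrix (Fin T) (Fin T) ℝ}
    {f : Matrix (Fin T) (Fin r) ℝ} {l : Matrix (Fin d) (Fin r) ℝ} {e : Matrix (Fin T) (Fin d) ℝ}
    (h : RegularModel K c κ D f l e) (hD : IsSplit D) (hc : 0 < c) (hK : 0 < K) (hκ : 0 ≤ κ)
    (hκ' : 2 * K * κ ≤ c ^ 3) {P : Bool → Matrix (Fin d) (Fin d) ℝ} (hP : ∀ i, (P i)ᵀ = P i)
    (hPge : ∀ i z, 1 / 4 * (z ⬝ᵥ z) ≤ (P i *ᵥ z) ⬝ᵥ (P i *ᵥ z))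
    {y : Matrix (Fin T) (Fin d) ℝ} (hy : y = ∑ i, D i * (f * lᵀ + e) * P i) {i : ℕ} (hi : i < r) :
    c ^ 4 / 16 ≤ eigDesc (y * yᵀ) i := by
  have hyh : (y * yᵀ).IsHermitian := by
    simpa using Matrix.isHermitian_mul_conjTranspose_self y
  refine TwoSubject.le_eigDesc hyh (D true * f) (fun u hu => ?_) (fun u => ?_) hi
  · have h1 := h.f_ge u
    rw [hu] at h1
    have h2 := dotProduct_self_nonneg' u
    have h3 : u ⬝ᵥ u = 0 := by
      have : 0 < c ^ 2 := by positivity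
      simp only [dotProduct_zero] at h1
      nlinarith
    exact dotProduct_self_eq_zero.1 h3
  · set w := (D true * f) *ᵥ u with hw
    -- The test vector w is supported on the first half, so the block with the other projection
    -- disappears.
    have hyw : yᵀ *ᵥ w = P true *ᵥ (l *ᵥ (fᵀ *ᵥ w) + (fᵀ * D true * e)ᵀ *ᵥ u) := by
      rw [hw, hy]
      simp only [Fintype.sum_bool, Matrix.mulVec_mulVec, ← Matrix.add_mulVec]
      congr 1
      simp only [Matrix.transpose_add, Matrix.transpose_mul, Matrix.transpose_transpose,
        hP, hD.symm, Matrix.add_mul, Matrix.mul_add, Matrix.mul_assoc, hD.mul_mul]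
      simp
    have hq : w ⬝ᵥ ((y * yᵀ) *ᵥ w) = (yᵀ *ᵥ w) ⬝ᵥ (yᵀ *ᵥ w) := by
      rw [mulVec_dotProduct yᵀ, Matrix.transpose_transpose, Matrix.mulVec_mulVec w]
    rw [hq, hyw]
    set p := fᵀ *ᵥ w with hp
    have h1 := h.f_ge u
    rw [← hw] at h1
    have hup : u ⬝ᵥ p = w ⬝ᵥ w := by
      rw [hp, ← mulVec_dotProduct]
      conv_rhs => lhs; rw [hw]
      rw [← Matrix.mulVec_mulVec, mulVec_dotProduct (D true), hD.symm]
      congr 1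
      rw [hw, Matrix.mulVec_mulVec, hD.mul_mul]
      simp
    have h2 := dotProduct_sq_le u p
    rw [hup] at h2
    have h3 := h.l_ge p
    have h4 := mulVec_dotProduct_self_le (fᵀ * D true * e)ᵀ u
    rw [norm_transpose] at h4
    have h5 : ‖fᵀ * D true * e‖ ^ 2 ≤ (K * κ) ^ 2 :=
      pow_le_pow_left₀ (norm_nonneg _) (h.fe_le true) 2
    have h6 := hPge true (l *ᵥ p + (fᵀ * D true * e)ᵀ *ᵥ u)
    have h7 := dotProduct_add_self_le (l *ᵥ p) ((fᵀ * D true * e)ᵀ *ᵥ u)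
    have hu0 := dotProduct_self_nonneg' u
    have hw0 := dotProduct_self_nonneg' w
    have hp0 := dotProduct_self_nonneg' p
    -- Since |w|² = ⟨u, p⟩ ≤ |u||p| and c|u| ≤ |w|, also c|w| ≤ |p|.
    have hpw : c ^ 2 * (w ⬝ᵥ w) ≤ p ⬝ᵥ p := by
      rcases hw0.eq_or_lt with h0 | h0
      · rw [← h0]; simpa using hp0
      · have : c ^ 2 * (w ⬝ᵥ w) * (w ⬝ᵥ w) ≤ (p ⬝ᵥ p) * (w ⬝ᵥ w) := by
          calc c ^ 2 * (w ⬝ᵥ w) * (w ⬝ᵥ w) = c ^ 2 * (w ⬝ᵥ w) ^ 2 := by ring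
            _ ≤ c ^ 2 * ((u ⬝ᵥ u) * (p ⬝ᵥ p)) := by gcongr
            _ = (c ^ 2 * (u ⬝ᵥ u)) * (p ⬝ᵥ p) := by ring
            _ ≤ (w ⬝ᵥ w) * (p ⬝ᵥ p) := by gcongr
            _ = _ := by ring
        exact le_of_mul_le_mul_right this h0
    have hlp : c ^ 4 * (w ⬝ᵥ w) ≤ (l *ᵥ p) ⬝ᵥ (l *ᵥ p) := by
      refine le_trans ?_ h3
      calc c ^ 4 * (w ⬝ᵥ w) = c ^ 2 * (c ^ 2 * (w ⬝ᵥ w)) := by ring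
        _ ≤ _ := by gcongr
    have hKκ : (K * κ) ^ 2 ≤ c ^ 6 / 4 := by
      have : K * κ ≤ c ^ 3 / 2 := by linarith
      calc (K * κ) ^ 2 ≤ (c ^ 3 / 2) ^ 2 := pow_le_pow_left₀ (by positivity) this 2
        _ = _ := by ring
    have hz : ((fᵀ * D true * e)ᵀ *ᵥ u) ⬝ᵥ ((fᵀ * D true * e)ᵀ *ᵥ u) ≤ c ^ 4 / 4 * (w ⬝ᵥ w) := by
      calc _ ≤ _ := h4
        _ ≤ c ^ 6 / 4 * (u ⬝ᵥ u) := by gcongr; exact h5.trans hKκ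
        _ = c ^ 4 / 4 * (c ^ 2 * (u ⬝ᵥ u)) := by ring
        _ ≤ _ := by gcongr
    -- The loadings contribute c⁴/2 after splitting off the noise, the noise costs at most c⁴/4, and
    -- the projection costs the factor 1/4: together c⁴/16.
    linarith

/-- The expansion of the principal components around their population counterpart. -/
theorem pca_expansion {y s n : Matrix (Fin T) (Fin d) ℝ} {q : Matrix (Fin T) (Fin r) ℝ}
    {v : Fin r → ℝ} (hv : ∀ i, 0 < v i) (hy : y = s + n)
    (hq : y * yᵀ * q = q * Matrix.diagonal v) :
    q - s * sᵀ * q * (Matrix.diagonal v)⁻¹ =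
      (s * nᵀ + n * sᵀ + n * nᵀ) * q * (Matrix.diagonal v)⁻¹ := by
  have hu : IsUnit (Matrix.diagonal v).det := by
    rw [Matrix.det_diagonal]
    exact (Finset.prod_pos fun i _ => hv i).ne'.isUnit
  have h1 : q = y * yᵀ * q * (Matrix.diagonal v)⁻¹ := by
    rw [hq, Matrix.mul_assoc, Matrix.mul_nonsing_inv _ hu, Matrix.mul_one]
  nth_rewrite 1 [h1]
  rw [hy, ← Matrix.sub_mul, ← Matrix.sub_mul]
  congr 2
  simp only [Matrix.transpose_add, Matrix.add_mul, Matrix.mul_add]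
  abel

theorem norm_inv_diagonal_le {v : Fin r → ℝ} {K : ℝ} (hK : 0 < K) (hv : ∀ i, K⁻¹ ≤ v i) :
    ‖(Matrix.diagonal v)⁻¹‖ ≤ K := by
  have h : (Matrix.diagonal v)⁻¹ = Matrix.diagonal fun i => (v i)⁻¹ := by
    refine Matrix.inv_eq_right_inv ?_
    rw [Matrix.diagonal_mul_diagonal, ← Matrix.diagonal_one]
    congr 1; ext i
    exact mul_inv_cancel₀ ((inv_pos.2 hK).trans_le (hv i)).ne'
  rw [h, Matrix.l2_opNorm_diagonal, pi_norm_le_iff_of_nonneg hK.le]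
  intro i
  have : 0 < v i := (inv_pos.2 hK).trans_le (hv i)
  rw [Real.norm_of_nonneg (inv_nonneg.2 this.le)]
  exact inv_le_of_inv_le₀ hK (hv i)

theorem transpose_inv_diagonal (v : Fin r → ℝ) :
    ((Matrix.diagonal v)⁻¹)ᵀ = (Matrix.diagonal v)⁻¹ := by
  rw [Matrix.transpose_nonsing_inv, Matrix.diagonal_transpose]

/-- The column space of the loadings estimated by principal components is close to the column
space of the true loadings. -/
theorem RegularModel.norm_projection_le {K c κ : ℝ} {D : Bool → Matrix (Fin T) (Fin T) ℝ}
    {f : Matrix (Fin T) (Fin r) ℝ} {l : Matrix (Fin d) (Fin r) ℝ} {e : Matrix (Fin T) (Fin d) ℝ}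
    (h : RegularModel K c κ D f l e) (hD : IsSplit D) (hK : 1 ≤ K) (hκ : 0 ≤ κ)
    (hκ' : 6 * K ^ 3 * κ ≤ 1) {q : Matrix (Fin T) (Fin r) ℝ} (hq : qᵀ * q = 1) {v : Fin r → ℝ}
    (hv : ∀ i, K⁻¹ ≤ v i)
    (hqv : (f * lᵀ + e) * (f * lᵀ + e)ᵀ * q = q * Matrix.diagonal v)
    {P : Matrix (Fin d) (Fin d) ℝ} (hPs : Pᵀ = P) (hPi : P * P = P)
    (hPx : P * ((f * lᵀ + e)ᵀ * q) = (f * lᵀ + e)ᵀ * q) :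
    ‖(1 - P) * l‖ ≤ 10 * K ^ 9 * κ := by
  have hK0 : 0 < K := by linarith
  have hexp := pca_expansion (fun i => (inv_pos.2 hK0).trans_le (hv i)) rfl hqv
  set W := (Matrix.diagonal v)⁻¹ with hW
  have hWn : ‖W‖ ≤ K := norm_inv_diagonal_le hK0 hv
  set E := q - f * lᵀ * (f * lᵀ)ᵀ * q * W with hE
  have hqn : ‖q‖ ≤ 1 := norm_le_one_of_transpose_mul_self hq
  have hsn : ‖f * lᵀ * eᵀ‖ ≤ K * (K * κ) := by
    rw [Matrix.mul_assoc, ← Matrix.transpose_mul]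
    exact norm_mul_le_of_le h.f_le ((norm_transpose _).trans_le h.el_le)
  have hns : ‖e * (f * lᵀ)ᵀ‖ ≤ K * (K * κ) := by
    rw [← norm_transpose]
    simpa using hsn
  have hnn : ‖e * eᵀ‖ ≤ K * κ := (norm_mul_transpose_self e).trans_le h.e_sq_le
  have hEn : ‖E‖ ≤ 3 * K ^ 3 * κ := by
    rw [hexp]
    have h1 : ‖f * lᵀ * eᵀ + e * (f * lᵀ)ᵀ + e * eᵀ‖ ≤ K * (K * κ) + K * (K * κ) + K * κ :=
      norm_add₃_le.trans (add_le_add (add_le_add hsn hns) hnn)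
    refine (norm_mul_le_of_le (norm_mul_le_of_le h1 hqn) hWn).trans ?_
    have : K * κ * K ≤ K * (K * κ) * K := by
      have h2 : K * κ ≤ K * (K * κ) := le_mul_of_one_le_left (by positivity) hK
      gcongr
    nlinarith
  -- The rotation of principal components: q = fH + E with H bounded and E = O(κ).
  set H := lᵀ * l * (fᵀ * q) * W with hH
  have hqH : q = f * H + E := by
    rw [hE, hH]; simp only [Matrix.transpose_mul, Matrix.transpose_transpose, Matrix.mul_assoc]
    abel
  have hln : ‖lᵀ‖ ≤ K := (norm_transpose l).trans_le h.l_le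
  have hfn : ‖fᵀ‖ ≤ K := (norm_transpose f).trans_le h.f_le
  have hHn : ‖H‖ ≤ K ^ 4 := by
    refine (norm_mul_le_of_le (norm_mul_le_of_le (norm_mul_le_of_le hln h.l_le)
      (norm_mul_le_of_le hfn hqn)) hWn).trans_eq ?_
    ring
  have hef : ‖eᵀ * f‖ ≤ 2 * K * κ := by
    have h1 : eᵀ * f = (fᵀ * D true * e + fᵀ * D false * e)ᵀ := by
      rw [← Matrix.add_mul, ← Matrix.mul_add, hD.sum]
      simp
    rw [h1, norm_transpose]
    refine (norm_add_le _ _).trans ((add_le_add (h.fe_le _) (h.fe_le _)).trans_eq (by ring))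
  have hen : ‖eᵀ‖ ≤ K := (norm_transpose e).trans_le h.e_le
  -- Although e is not O(κ), its product with q is: e'f is an average over time, and E is small.
  have heq : ‖eᵀ * q‖ ≤ 5 * K ^ 5 * κ := by
    have h1 : eᵀ * q = eᵀ * f * H + eᵀ * E := by
      conv_lhs => rw [hqH]
      rw [Matrix.mul_add, Matrix.mul_assoc]
    rw [h1]
    refine (norm_add_le _ _).trans ((add_le_add (norm_mul_le_of_le hef hHn)
      (norm_mul_le_of_le hen hEn)).trans ?_)
    have h2 : K ^ 4 * κ ≤ K ^ 5 * κ := by gcongr; simp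
    nlinarith
  have hPn : ‖(1 : Matrix (Fin d) (Fin d) ℝ) - P‖ ≤ 1 := by
    refine norm_idempotent_le (by simp [hPs]) ?_
    simp [Matrix.mul_sub, Matrix.sub_mul, hPi]
  set A := fᵀ * q with hA
  -- The projection P fixes x'q = lf'q + e'q, so 1 - P turns the loadings, multiplied by A = f'q,
  -- into pure noise. It remains to invert A.
  have hBA : (1 - P) * l * A = - ((1 - P) * (eᵀ * q)) := by
    have h1 : (1 - P) * ((f * lᵀ + e)ᵀ * q) = 0 := by
      rw [Matrix.sub_mul, hPx, Matrix.one_mul, sub_self]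
    rw [eq_neg_iff_add_eq_zero, ← h1, hA]
    simp only [Matrix.transpose_add, Matrix.transpose_mul, Matrix.transpose_transpose,
      Matrix.add_mul, Matrix.mul_add, Matrix.mul_assoc]
  set g := Eᵀ * q with hg
  have hgn : ‖g‖ ≤ 1 / 2 := by
    have := norm_mul_le_of_le ((norm_transpose E).trans_le hEn) hqn
    rw [← hg] at this
    linarith
  -- Orthonormality of q makes H' an approximate left inverse of A. The defect g has norm at most
  -- 1/2, so 1 - g has an inverse R of norm at most 2 and A⁻¹ = RH'.
  have hHA : Hᵀ * A = 1 - g := by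
    rw [eq_sub_iff_add_eq, ← hq]
    conv_rhs => rw [show qᵀ = Hᵀ * fᵀ + Eᵀ by
      conv_lhs => rw [hqH]
      simp]
    rw [Matrix.add_mul, Matrix.mul_assoc]
  obtain ⟨U, hU⟩ := isUnit_one_sub_of_norm_lt_one (x := g) (by linarith)
  set R : Matrix (Fin r) (Fin r) ℝ := ↑U⁻¹ with hR
  have hR1 : R * (1 - g) = 1 := by rw [← hU]; exact U.inv_mul
  have hRn : ‖R‖ ≤ 2 := by
    have h1 : R = 1 + R * g := by rw [← hR1, Matrix.mul_sub]; simp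
    have h2 : ‖R‖ ≤ 1 + ‖R‖ * (1 / 2) := by
      conv_lhs => rw [h1]
      exact (norm_add_le _ _).trans (add_le_add norm_one_le (norm_mul_le_of_le le_rfl hgn))
    linarith
  have hinv : A * (R * Hᵀ) = 1 := by
    rw [mul_eq_one_comm, Matrix.mul_assoc, hHA, hR1]
  have hB : (1 - P) * l = - ((1 - P) * (eᵀ * q)) * (R * Hᵀ) := by
    rw [← hBA, Matrix.mul_assoc _ A, hinv, Matrix.mul_one]
  rw [hB]
  refine (norm_mul_le_of_le ((norm_neg _).trans_le (norm_mul_le_of_le hPn heq))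
    (norm_mul_le_of_le hRn ((norm_transpose H).trans_le hHn))).trans_eq ?_
  ring

/-- Bounds for the estimation error of the principal components of transformed data. -/
theorem RegularModel.norm_error_transpose_mul_le {K c κ : ℝ}
    {D : Bool → Matrix (Fin T) (Fin T) ℝ}
    {f : Matrix (Fin T) (Fin r) ℝ} {l : Matrix (Fin d) (Fin r) ℝ} {e : Matrix (Fin T) (Fin d) ℝ}
    (h : RegularModel K c κ D f l e) (hD : IsSplit D) (hK : 1 ≤ K) (hκ : 0 ≤ κ)
    {P : Bool → Matrix (Fin d) (Fin d) ℝ} (hPs : ∀ i, (P i)ᵀ = P i) (hPn : ∀ i, ‖P i‖ ≤ 1)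
    (hPl : ∀ i, ‖l - P i * l‖ ≤ K * κ)
    {q : Matrix (Fin T) (Fin r) ℝ} (hq : qᵀ * q = 1) {v : Fin r → ℝ} (hv : ∀ i, K⁻¹ ≤ v i)
    {s n : Matrix (Fin T) (Fin d) ℝ} (hs : s = ∑ i, D i * f * lᵀ * P i)
    (hn : n = ∑ i, D i * e * P i)
    (hqv : (s + n) * (s + n)ᵀ * q = q * Matrix.diagonal v) :
    ‖(q - s * sᵀ * q * (Matrix.diagonal v)⁻¹)ᵀ * f‖ ≤ 500 * K ^ 9 * κ ^ 2 := by
  have hK0 : 0 < K := by linarith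
  have hexp := pca_expansion (fun i => (inv_pos.2 hK0).trans_le (hv i)) rfl hqv
  have hWn : ‖(Matrix.diagonal v)⁻¹‖ ≤ K := norm_inv_diagonal_le hK0 hv
  have hWt := transpose_inv_diagonal v
  set W := (Matrix.diagonal v)⁻¹ with hW
  set E := q - s * sᵀ * q * W with hE
  have hqn : ‖q‖ ≤ 1 := norm_le_one_of_transpose_mul_self hq
  have hqtn : ‖qᵀ‖ ≤ 1 := (norm_transpose q).trans_le hqn
  have hltn : ‖lᵀ‖ ≤ K := (norm_transpose l).trans_le h.l_le
  have hftn : ‖fᵀ‖ ≤ K := (norm_transpose f).trans_le h.f_le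
  have hDn := hD.norm_le
  have hDt := hD.symm
  have hDm := @IsSplit.mul_mul T
  -- the products of errors and loadings
  have hePPl : ∀ i j, ‖e * (P j * (P i * l))‖ ≤ 3 * K ^ 2 * κ := fun i j => by
    have h1 : e * (P j * (P i * l)) = e * l - e * (l - P j * l) - e * P j * (l - P i * l) := by
      simp only [Matrix.mul_sub, Matrix.mul_assoc]; abel
    rw [h1]
    refine (norm_sub_le _ _).trans ((add_le_add ((norm_sub_le _ _).trans (add_le_add h.el_le
      (norm_mul_le_of_le h.e_le (hPl j)))) (norm_mul_le_of_le
      (norm_mul_le_of_le h.e_le (hPn j)) (hPl i))).trans ?_)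
    have : K * κ ≤ K * (K * κ) := le_mul_of_one_le_left (by positivity) hK
    nlinarith
  -- Replacing both projections by the identity costs O(κ) each, against a factor f'D_j e which is
  -- O(κ). No moment of a product involving the random projections is needed.
  have hfePPl : ∀ i j, ‖fᵀ * D j * e * (P j * (P i * l))‖ ≤ 3 * K ^ 2 * κ ^ 2 := fun i j => by
    have h1 : fᵀ * D j * e * (P j * (P i * l)) = fᵀ * D j * e * l - fᵀ * D j * e * (l - P j * l)
        - fᵀ * D j * e * P j * (l - P i * l) := by
      simp only [Matrix.mul_sub, Matrix.mul_assoc]; abel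
    rw [h1]
    refine (norm_sub_le _ _).trans ((add_le_add ((norm_sub_le _ _).trans (add_le_add (h.fel_le j)
      (norm_mul_le_of_le (h.fe_le j) (hPl j)))) (norm_mul_le_of_le
      (norm_mul_le_of_le (h.fe_le j) (hPn j)) (hPl i))).trans ?_)
    have : K * κ ^ 2 ≤ K * (K * κ ^ 2) := le_mul_of_one_le_left (by positivity) hK
    nlinarith
  have hsum : ∀ {a b : ℕ} (A : Bool → Matrix (Fin a) (Fin b) ℝ) (C : ℝ), (∀ i, ‖A i‖ ≤ C) →
      ‖∑ i, A i‖ ≤ 2 * C := fun A C hA => by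
    rw [Fintype.sum_bool, two_mul]
    exact (norm_add_le _ _).trans (add_le_add (hA _) (hA _))
  have hPln : ∀ i, ‖P i * l‖ ≤ 1 * K := fun i => norm_mul_le_of_le (hPn i) h.l_le
  have hsn : ‖s‖ ≤ 2 * K ^ 2 := by
    rw [hs]
    refine hsum _ _ fun i => (norm_mul_le_of_le (norm_mul_le_of_le (norm_mul_le_of_le (hDn i)
      h.f_le) hltn) (hPn i)).trans_eq (by ring)
  have hnn : ‖n‖ ≤ 2 * ‖e‖ := by
    rw [hn]
    refine hsum _ _ fun i => (norm_mul_le_of_le (norm_mul_le_of_le (hDn i)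
      le_rfl) (hPn i)).trans_eq (by ring)
  -- Only of order κ, as ‖e‖² is; the third term below needs additional cancellation.
  have hnn2 : ‖n * nᵀ‖ ≤ 4 * K * κ := by
    rw [norm_mul_transpose_self]
    have := h.e_sq_le
    nlinarith [norm_nonneg n, norm_nonneg e]
  -- the products of signal and noise
  have hnPl : ∀ i, ‖n * (P i * l)‖ ≤ 6 * K ^ 2 * κ := fun i => by
    rw [hn, Matrix.sum_mul]
    refine (hsum _ (3 * K ^ 2 * κ) fun j => ?_).trans_eq (by ring)
    rw [Matrix.mul_assoc, Matrix.mul_assoc]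
    exact (norm_mul_le_of_le (hDn j) (hePPl i j)).trans_eq (by ring)
  have hnst : n * sᵀ = ∑ i, n * (P i * l) * (fᵀ * D i) := by
    rw [hs, Matrix.transpose_sum, Matrix.mul_sum]
    refine Finset.sum_congr rfl fun i _ => ?_
    simp only [Matrix.transpose_mul, Matrix.transpose_transpose, hPs, hDt, Matrix.mul_assoc]
  have hnsn : ‖n * sᵀ‖ ≤ 12 * K ^ 3 * κ := by
    rw [hnst]
    refine (hsum _ (6 * K ^ 2 * κ * (K * 1)) fun i => ?_).trans_eq (by ring)
    exact norm_mul_le_of_le (hnPl i) (norm_mul_le_of_le hftn (hDn i))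
  have hsnn : ‖s * nᵀ‖ ≤ 12 * K ^ 3 * κ := by
    rw [← norm_transpose]; simpa using hnsn
  have hEn : ‖E‖ ≤ 28 * K ^ 4 * κ := by
    rw [hexp]
    refine (norm_mul_le_of_le (norm_mul_le_of_le (norm_add₃_le.trans
      (add_le_add (add_le_add hsnn hnsn) hnn2)) hqn) hWn).trans ?_
    have : K ^ 2 * κ ≤ K ^ 4 * κ := by gcongr; simp
    nlinarith
  have hEtn : ‖Eᵀ‖ ≤ 28 * K ^ 4 * κ := (norm_transpose E).trans_le hEn
  -- The expansion is fed back into itself: it trades q' for s' plus a term that is already O(κ).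
  have hqE : qᵀ = W * (qᵀ * s) * sᵀ + Eᵀ := by
    conv_lhs => rw [show q = s * sᵀ * q * W + E by rw [hE]; abel]
    simp only [Matrix.transpose_add, Matrix.transpose_mul, Matrix.transpose_transpose, hWt,
      Matrix.mul_assoc]
  have hWqs : ‖W * (qᵀ * s)‖ ≤ 2 * K ^ 3 :=
    (norm_mul_le_of_le hWn (norm_mul_le_of_le hqtn hsn)).trans_eq (by ring)
  -- first term
  have hstn : sᵀ * n = ∑ j, P j * l * (fᵀ * D j * e * P j) := by
    rw [hs, hn]
    simp only [Fintype.sum_bool, Matrix.transpose_add, Matrix.transpose_mul,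
      Matrix.transpose_transpose, Matrix.add_mul, Matrix.mul_add, Matrix.mul_assoc, hPs, hDt,
      hDm hD]
    simp
  have hT1 : ‖qᵀ * (n * sᵀ) * f‖ ≤ 360 * K ^ 8 * κ ^ 2 := by
    -- The direct bound is O(κ). After the substitution, s'nP_i l contains f'D_j e P_j P_i l =
    -- O(κ²), and E' multiplies nP_i l with both factors O(κ).
    have h1 : ∀ i, ‖qᵀ * (n * (P i * l))‖ ≤ 180 * K ^ 6 * κ ^ 2 := fun i => by
      have h2 : ‖sᵀ * n * (P i * l)‖ ≤ 6 * K ^ 3 * κ ^ 2 := by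
        rw [hstn, Matrix.sum_mul]
        refine (hsum _ (1 * K * (3 * K ^ 2 * κ ^ 2)) fun j => ?_).trans_eq (by ring)
        rw [Matrix.mul_assoc, Matrix.mul_assoc _ (P j)]
        exact norm_mul_le_of_le (hPln j) (hfePPl i j)
      have h3 : qᵀ * (n * (P i * l)) =
          W * (qᵀ * s) * (sᵀ * n * (P i * l)) + Eᵀ * (n * (P i * l)) := by
        conv_lhs => rw [hqE]
        simp only [Matrix.add_mul, Matrix.mul_assoc]
      rw [h3]
      refine (norm_add_le _ _).trans ((add_le_add (norm_mul_le_of_le hWqs h2)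
        (norm_mul_le_of_le hEtn (hnPl i))).trans_eq (by ring))
    have h4 : qᵀ * (n * sᵀ) * f = ∑ i, qᵀ * (n * (P i * l)) * (fᵀ * D i * f) := by
      rw [hnst, Matrix.mul_sum, Matrix.sum_mul]
      simp only [Matrix.mul_assoc]
    rw [h4]
    refine (hsum _ (180 * K ^ 6 * κ ^ 2 * (K * 1 * K)) fun i => ?_).trans_eq (by ring)
    exact norm_mul_le_of_le (h1 i) (norm_mul_le_of_le (norm_mul_le_of_le hftn (hDn i)) h.f_le)
  -- second term
  have hT2 : ‖qᵀ * (s * nᵀ) * f‖ ≤ 12 * K ^ 3 * κ ^ 2 := by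
    -- No substitution is needed here: the factor f on the right already supplies the average over
    -- time.
    have h1 : s * nᵀ * f =
        ∑ i, ∑ j, D i * f * (fᵀ * D j * e * (P j * (P i * l)))ᵀ := by
      rw [hs, hn]
      simp only [Matrix.transpose_sum, Matrix.sum_mul, Matrix.mul_sum, Matrix.transpose_mul,
        Matrix.transpose_transpose, Matrix.mul_assoc, hPs, hDt]
      rw [Finset.sum_comm]
    rw [Matrix.mul_assoc, h1]
    refine (norm_mul_le_of_le hqtn (hsum _ (2 * (1 * K * (3 * K ^ 2 * κ ^ 2))) fun i =>
      hsum _ _ fun j => norm_mul_le_of_le (norm_mul_le_of_le (hDn i) h.f_le)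
        ((norm_transpose _).trans_le (hfePPl i j)))).trans_eq (by ring)
  -- third term
  have hT3 : ‖qᵀ * (n * nᵀ) * f‖ ≤ 120 * K ^ 6 * κ ^ 2 := by
    have h1 : ‖sᵀ * n‖ ≤ 2 * K ^ 2 * κ := by
      rw [hstn]
      refine (hsum _ (1 * K * (K * κ * 1)) fun j => ?_).trans_eq (by ring)
      exact norm_mul_le_of_le (hPln j) (norm_mul_le_of_le (h.fe_le j) (hPn j))
    have h2 : ‖nᵀ * f‖ ≤ 2 * K * κ := by
      have h3 : nᵀ * f = ∑ j, P j * (fᵀ * D j * e)ᵀ := by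
        rw [hn, Matrix.transpose_sum, Matrix.sum_mul]
        simp only [Matrix.transpose_mul, Matrix.transpose_transpose, Matrix.mul_assoc, hPs, hDt]
      rw [h3]
      refine (hsum _ (1 * (K * κ)) fun j => ?_).trans_eq (by ring)
      exact norm_mul_le_of_le (hPn j) ((norm_transpose _).trans_le (h.fe_le j))
    -- Both s'n and n'f are averages over time, hence O(κ) each; in the remainder E' and nn' are
    -- O(κ) each.
    have h4 : qᵀ * (n * nᵀ) * f =
        W * (qᵀ * s) * (sᵀ * n * (nᵀ * f)) + Eᵀ * (n * nᵀ) * f := by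
      conv_lhs => rw [hqE]
      simp only [Matrix.add_mul, Matrix.mul_assoc]
    rw [h4]
    refine (norm_add_le _ _).trans ((add_le_add (norm_mul_le_of_le hWqs (norm_mul_le_of_le h1 h2))
      (norm_mul_le_of_le (norm_mul_le_of_le hEtn hnn2) h.f_le)).trans_eq (by ring))
  have hfin : Eᵀ * f = W * (qᵀ * (n * sᵀ) * f + qᵀ * (s * nᵀ) * f + qᵀ * (n * nᵀ) * f) := by
    rw [hexp]
    simp only [Matrix.transpose_add, Matrix.transpose_mul, Matrix.transpose_transpose, hWt,
      Matrix.mul_add, Matrix.add_mul, Matrix.mul_assoc]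
  rw [hfin]
  refine (norm_mul_le_of_le hWn (norm_add₃_le.trans
    (add_le_add (add_le_add hT1 hT2) hT3))).trans ?_
  have h1 : K ^ 4 * κ ^ 2 ≤ K ^ 9 * κ ^ 2 := by gcongr; simp
  have h2 : K ^ 7 * κ ^ 2 ≤ K ^ 9 * κ ^ 2 := by gcongr; simp
  calc _ = 360 * (K ^ 9 * κ ^ 2) + 12 * (K ^ 4 * κ ^ 2) + 120 * (K ^ 7 * κ ^ 2) := by ring
    _ ≤ 360 * (K ^ 9 * κ ^ 2) + 12 * (K ^ 9 * κ ^ 2) + 120 * (K ^ 9 * κ ^ 2) := by gcongr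
    _ ≤ 500 * (K ^ 9 * κ ^ 2) := by
      have : 0 ≤ K ^ 9 * κ ^ 2 := by positivity
      linarith
    _ = _ := by ring

end Deterministic

/-! ### Moments of white noise -/

section WhiteNoise

variable {Ω : Type*} [MeasurableSpace Ω] {μ : Measure Ω}

/-- The second moment of a sum of uncorrelated random variables. -/
theorem integral_sum_sq_le {ι : Type*} (J : Finset ι) {Y : ι → Ω → ℝ} {m : ℝ}
    (hint : ∀ s t, Integrable (fun ω => Y s ω * Y t ω) μ)
    (huncorr : ∀ s t, s ≠ t → ∫ ω, Y s ω * Y t ω ∂μ = 0)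
    (hm : ∀ t, ∫ ω, Y t ω * Y t ω ∂μ ≤ m) :
    Integrable (fun ω => (∑ t ∈ J, Y t ω) ^ 2) μ ∧ ∫ ω, (∑ t ∈ J, Y t ω) ^ 2 ∂μ ≤ J.card * m := by
  classical
  have h : (fun ω => (∑ t ∈ J, Y t ω) ^ 2) = fun ω => ∑ s ∈ J, ∑ t ∈ J, Y s ω * Y t ω := by
    ext ω; rw [sq, Finset.sum_mul_sum]
  rw [h]
  refine ⟨integrable_finsetSum _ fun s _ => integrable_finsetSum _ fun t _ => hint s t, ?_⟩
  rw [integral_finsetSum _ fun s _ => integrable_finsetSum _ fun t _ => hint s t]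
  have h1 : ∀ s ∈ J, ∫ ω, ∑ t ∈ J, Y s ω * Y t ω ∂μ ≤ m := fun s hs => by
    rw [integral_finsetSum _ fun t _ => hint s t,
      Finset.sum_eq_single_of_mem s hs fun t _ hts => huncorr s t hts.symm]
    exact hm s
  exact (Finset.sum_le_sum h1).trans_eq (by simp)

theorem abs_mul_four_le (x y z w : ℝ) : |x * y * z * w| ≤ x ^ 4 + y ^ 4 + z ^ 4 + w ^ 4 := by
  have h1 : |x * y * z * w| ≤ (x * y) ^ 2 + (z * w) ^ 2 := by
    rw [abs_le]; constructor <;> nlinarith [sq_nonneg (x * y + z * w), sq_nonneg (x * y - z * w),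
      sq_nonneg (x * y), sq_nonneg (z * w)]
  nlinarith [sq_nonneg (x ^ 2 - y ^ 2), sq_nonneg (z ^ 2 - w ^ 2), sq_nonneg (x ^ 2),
    sq_nonneg (y ^ 2), sq_nonneg (z ^ 2), sq_nonneg (w ^ 2)]

variable [IsProbabilityMeasure μ] {n : ℕ} {a : ℤ → Ω → Fin n → ℝ}

theorem IsWhiteNoise.measurable_apply (ha : IsWhiteNoise μ a) (t : ℤ) (i : Fin n) :
    Measurable fun ω => a t ω i := (measurable_pi_apply i).comp (ha.measurable t)

theorem IsWhiteNoise.integrable_mul (ha : IsWhiteNoise μ a) (s t : ℤ) (i j : Fin n) :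
    Integrable (fun ω => a s ω i * a t ω j) μ := (ha.memLp s i).integrable_mul (ha.memLp t j)

theorem IsWhiteNoise.integrable_mul_four (ha : IsWhiteNoise μ a) {M : ℝ}
    (hM : FourthMomentsLE μ a M) (s t u v : ℤ) (i j k l : Fin n) :
    Integrable (fun ω => a s ω i * a t ω j * a u ω k * a v ω l) μ := by
  have hm := ha.measurable_apply
  refine Integrable.mono' ((((hM s i).1.add (hM t j).1).add (hM u k).1).add (hM v l).1)
    ((((hm s i).mul (hm t j)).mul (hm u k)).mul (hm v l)).aestronglyMeasurable
    (ae_of_all _ fun ω => abs_mul_four_le _ _ _ _)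

/-- The value at time u is independent of all values at the times in S, so the expectation factors
and the centred factor makes it vanish. Coordinates at the same time are never separated. -/
theorem IsWhiteNoise.integral_mul_comp_eq_zero (ha : IsWhiteNoise μ a) {u : ℤ} {S : Finset ℤ}
    (hu : u ∉ S) {g : (Fin n → ℝ) → ℝ} (hg : Measurable g) (hg0 : ∫ ω, g (a u ω) ∂μ = 0)
    {φ : (S → Fin n → ℝ) → ℝ} (hφ : Measurable φ) :
    ∫ ω, g (a u ω) * φ (fun v => a v ω) ∂μ = 0 := by
  have hind := ha.indep.indepFun_finset {u} S (by simpa using hu) ha.measurable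
  have hg' : Measurable fun x : ({u} : Finset ℤ) → Fin n → ℝ => g (x ⟨u, by simp⟩) :=
    hg.comp (measurable_pi_apply _)
  have h2 := hind.comp hg' hφ
  have h3 := h2.integral_fun_mul_eq_mul_integral
    (hg'.comp (measurable_pi_lambda _ fun v => ha.measurable v)).aestronglyMeasurable
    (hφ.comp (measurable_pi_lambda _ fun v => ha.measurable v)).aestronglyMeasurable
  simp only [Function.comp_apply] at h3
  rw [h3, hg0, zero_mul]

/-- The autocovariances of white noise. -/
theorem IsWhiteNoise.integral_mul (ha : IsWhiteNoise μ a) (s t : ℤ) (i j : Fin n) :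
    ∫ ω, a s ω i * a t ω j ∂μ = if s = t then autocov μ a 0 i j else 0 := by
  split_ifs with h
  · rw [h]; exact ha.cov t 0 i j
  · exact ha.integral_mul_comp_eq_zero (u := s) (S := {t}) (by simpa using h)
      (measurable_pi_apply i) (ha.mean s i)
      (φ := fun x => x ⟨t, by simp⟩ j) (by fun_prop)

/-- One isolated time index suffices; the three other indices may coincide. -/
theorem IsWhiteNoise.integral_mul_four_eq_zero (ha : IsWhiteNoise μ a) {s t u v : ℤ}
    (ht : s ≠ t) (hu : s ≠ u) (hv : s ≠ v) (i j k l : Fin n) :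
    ∫ ω, a s ω i * (a t ω j * a u ω k * a v ω l) ∂μ = 0 :=
  ha.integral_mul_comp_eq_zero (u := s) (S := {t, u, v}) (by simp [ht, hu, hv])
    (measurable_pi_apply i) (ha.mean s i)
    (φ := fun x => x ⟨t, by simp⟩ j * x ⟨u, by simp⟩ k * x ⟨v, by simp⟩ l) (by fun_prop)

theorem IsWhiteNoise.integral_sq_mul_sq_le (ha : IsWhiteNoise μ a) {M : ℝ}
    (hM : FourthMomentsLE μ a M) (s t : ℤ) (i j : Fin n) :
    ∫ ω, a s ω i * a t ω j * a s ω i * a t ω j ∂μ ≤ M := by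
  have h : ∫ ω, a s ω i * a t ω j * a s ω i * a t ω j ∂μ ≤
      ∫ ω, (1 / 2 * a s ω i ^ 4 + 1 / 2 * a t ω j ^ 4) ∂μ := by
    refine integral_mono (ha.integrable_mul_four hM _ _ _ _ _ _ _ _)
      (((hM s i).1.const_mul _).add ((hM t j).1.const_mul _)) fun ω => ?_
    dsimp only
    nlinarith [sq_nonneg (a s ω i ^ 2 - a t ω j ^ 2)]
  rw [integral_add ((hM s i).1.const_mul _) ((hM t j).1.const_mul _), integral_const_mul,
    integral_const_mul] at h
  linarith [(hM s i).2, (hM t j).2]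

/-- The centered lagged sample covariance matrix of the white noise, for the lags `k` and `l`. -/
noncomputable def noiseCov {ι : Type*} (μ : Measure Ω) (a : ℤ → Ω → Fin n → ℝ) (J : Finset ι)
    (τ : ι → ℤ) (k l : ℕ) (ω : Ω) : Matrix (Fin n) (Fin n) ℝ :=
  ∑ t ∈ J, (Matrix.vecMulVec (a (τ t - k) ω) (a (τ t - l) ω) -
    if k = l then autocov μ a 0 else 0)

/-- The centred lagged products at different times are uncorrelated even though they may share noise
variables, so the second moment grows only linearly in the number of times. -/
theorem IsWhiteNoise.integral_noiseCov_sq_le (ha : IsWhiteNoise μ a) {M : ℝ}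
    (hM : FourthMomentsLE μ a M) {ι : Type*} (J : Finset ι) {τ : ι → ℤ}
    (hτ : Function.Injective τ) (k l : ℕ) (p q : Fin n) :
    Integrable (fun ω => noiseCov μ a J τ k l ω p q ^ 2) μ ∧
      ∫ ω, noiseCov μ a J τ k l ω p q ^ 2 ∂μ ≤ J.card * M := by
  set m : ℝ := if k = l then autocov μ a 0 p q else 0 with hm
  have hY : ∀ ω, noiseCov μ a J τ k l ω p q =
      ∑ t ∈ J, (a (τ t - k) ω p * a (τ t - l) ω q - m) := fun ω => by
    rw [noiseCov, Matrix.sum_apply]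
    refine Finset.sum_congr rfl fun t _ => ?_
    rw [Matrix.sub_apply, Matrix.vecMulVec_apply, hm]
    split_ifs <;> simp
  have hi2 : ∀ t, Integrable (fun ω => a (τ t - k) ω p * a (τ t - l) ω q) μ :=
    fun t => ha.integrable_mul _ _ _ _
  have hmean : ∀ t, ∫ ω, a (τ t - k) ω p * a (τ t - l) ω q ∂μ = m := fun t => by
    rw [ha.integral_mul, hm]
    simp
  have hi4 : ∀ s t, Integrable (fun ω => a (τ s - k) ω p * a (τ s - l) ω q *
      a (τ t - k) ω p * a (τ t - l) ω q) μ :=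
    fun s t => ha.integrable_mul_four hM _ _ _ _ _ _ _ _
  have hexp : ∀ s t, (fun ω => (a (τ s - k) ω p * a (τ s - l) ω q - m) *
      (a (τ t - k) ω p * a (τ t - l) ω q - m)) = fun ω =>
      a (τ s - k) ω p * a (τ s - l) ω q * a (τ t - k) ω p * a (τ t - l) ω q -
        m * (a (τ s - k) ω p * a (τ s - l) ω q) - m * (a (τ t - k) ω p * a (τ t - l) ω q) +
        m * m := fun s t => by ext ω; ring
  have hint : ∀ s t, ∫ ω, (a (τ s - k) ω p * a (τ s - l) ω q - m) *
      (a (τ t - k) ω p * a (τ t - l) ω q - m) ∂μ = ∫ ω, a (τ s - k) ω p * a (τ s - l) ω q *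
      a (τ t - k) ω p * a (τ t - l) ω q ∂μ - m * m := fun s t => by
    have i1 : Integrable (fun ω => a (τ s - k) ω p * a (τ s - l) ω q * a (τ t - k) ω p *
        a (τ t - l) ω q - m * (a (τ s - k) ω p * a (τ s - l) ω q)) μ :=
      (hi4 s t).sub ((hi2 s).const_mul m)
    have i2 : Integrable (fun ω => a (τ s - k) ω p * a (τ s - l) ω q * a (τ t - k) ω p *
        a (τ t - l) ω q - m * (a (τ s - k) ω p * a (τ s - l) ω q) -
        m * (a (τ t - k) ω p * a (τ t - l) ω q)) μ := i1.sub ((hi2 t).const_mul m)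
    rw [hexp, integral_add i2 (integrable_const _), integral_sub i1 ((hi2 t).const_mul m),
      integral_sub (hi4 s t) ((hi2 s).const_mul m), integral_const_mul, integral_const_mul, hmean,
      hmean]
    simp
  simp only [hY]
  refine integral_sum_sq_le J (fun s t => ?_) (fun s t hst => ?_) fun t => ?_
  · rw [hexp]
    exact (((hi4 s t).sub ((hi2 s).const_mul m)).sub ((hi2 t).const_mul m)).add
      (integrable_const _)
  · have hst' : τ s ≠ τ t := hτ.ne hst
    -- For equal lags the two centred products live at two different times and are independent.
    by_cases hkl : k = l
    · subst hkl
      refine ha.integral_mul_comp_eq_zero (u := τ s - k) (S := {τ t - k}) (by simpa using hst')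
        (g := fun x => x p * x q - m) (by fun_prop) ?_
        (φ := fun x => x ⟨τ t - k, by simp⟩ p * x ⟨τ t - k, by simp⟩ q - m) (by fun_prop)
      rw [integral_sub (hi2 s) (integrable_const _), hmean]
      simp
    · have hkl' : (k : ℤ) ≠ l := by exact_mod_cast hkl
      rw [hint, hm, if_neg hkl, mul_zero, sub_zero]
      -- For different lags some time index occurs only once: if τ s - k coincides with τ t - l,
      -- then τ s - l is isolated, since the other coincidence would force k = l; otherwise τ s - k
      -- is.
      by_cases h : τ s - k = τ t - l
      · rw [← ha.integral_mul_four_eq_zero (s := τ s - l) (t := τ s - k) (u := τ t - k)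
          (v := τ t - l) (by omega) (by omega) (by omega) q p p q]
        exact integral_congr_ae (ae_of_all _ fun ω => by dsimp only; ring)
      · rw [← ha.integral_mul_four_eq_zero (s := τ s - k) (t := τ s - l) (u := τ t - k)
          (v := τ t - l) (by omega) (by omega) (by omega) p q p q]
        exact integral_congr_ae (ae_of_all _ fun ω => by dsimp only; ring)
  · rw [hint]
    have := ha.integral_sq_mul_sq_le hM (τ t - k) (τ t - l) p q
    nlinarith [mul_self_nonneg m]

theorem IsWhiteNoise.integral_frobSq_noiseCov_le (ha : IsWhiteNoise μ a) {M : ℝ}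
    (hM : FourthMomentsLE μ a M) {ι : Type*} (J : Finset ι) {τ : ι → ℤ}
    (hτ : Function.Injective τ) (k l : ℕ) :
    Integrable (fun ω => frobSq (noiseCov μ a J τ k l ω)) μ ∧
      ∫ ω, frobSq (noiseCov μ a J τ k l ω) ∂μ ≤ n ^ 2 * (J.card * M) := by
  have h := ha.integral_noiseCov_sq_le hM J hτ k l
  unfold frobSq
  refine ⟨integrable_finsetSum _ fun p _ => integrable_finsetSum _ fun q _ => (h p q).1, ?_⟩
  rw [integral_finsetSum _ fun p _ => integrable_finsetSum _ fun q _ => (h p q).1]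
  have h1 : ∀ p ∈ Finset.univ, ∫ ω, ∑ q, noiseCov μ a J τ k l ω p q ^ 2 ∂μ ≤ n * (J.card * M) :=
    fun p _ => by
      rw [integral_finsetSum _ fun q _ => (h p q).1]
      exact (Finset.sum_le_sum fun q _ => (h p q).2).trans_eq (by simp)
  exact (Finset.sum_le_sum h1).trans_eq (by simp; ring)

end WhiteNoise

/-! ### Weighted sums -/

section WeightedSums

/-- A weighted Cauchy-Schwarz inequality. -/
theorem sum_sq_le_of_sq_le {ι : Type*} (s : Finset ι) {x w b : ι → ℝ} (hw : ∀ i, 0 ≤ w i)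
    (hb : ∀ i, 0 ≤ b i) (h : ∀ i, x i ^ 2 ≤ w i ^ 2 * b i) :
    (∑ i ∈ s, x i) ^ 2 ≤ (∑ i ∈ s, w i) * ∑ i ∈ s, w i * b i := by
  refine Finset.sum_sq_le_sum_mul_sum_of_sq_le_mul s (fun i _ => hw i)
    (fun i _ => mul_nonneg (hw i) (hb i)) fun i _ => (h i).trans_eq (by ring)

variable {m n k : ℕ}

/-- The weighted Cauchy-Schwarz inequality applied to every entry. With summable weights the bound
is uniform in the number of terms, which is what allows the truncation of a linear process to be
removed. -/
theorem frobSq_sum_le {ι : Type*} (s : Finset ι) {A : ι → Matrix (Fin m) (Fin n) ℝ} {w b : ι → ℝ}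
    (hw : ∀ i, 0 ≤ w i) (h : ∀ i, frobSq (A i) ≤ w i ^ 2 * b i) :
    frobSq (∑ i ∈ s, A i) ≤ (∑ i ∈ s, w i) * ∑ i ∈ s, w i * b i := by
  have h0 : ∀ i p q, A i p q ^ 2 ≤ frobSq (A i) := fun i p q =>
    (Finset.single_le_sum (f := fun q => A i p q ^ 2) (fun _ _ => sq_nonneg _)
      (Finset.mem_univ q)).trans (Finset.single_le_sum (f := fun p => ∑ q, A i p q ^ 2)
        (fun _ _ => Finset.sum_nonneg fun _ _ => sq_nonneg _) (Finset.mem_univ p))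
  have h1 : ∀ p q, (∑ i ∈ s, A i p q) ^ 2 ≤
      (∑ i ∈ s, w i) * ∑ i ∈ s, w i * (A i p q ^ 2 / w i ^ 2) := fun p q => by
    refine sum_sq_le_of_sq_le s hw (fun i => by positivity) fun i => ?_
    -- A zero weight forces the entry to vanish, which matches the convention x / 0 = 0.
    rcases (hw i).eq_or_lt with h2 | h2
    · have h3 := (h0 i p q).trans (h i)
      rw [← h2] at h3 ⊢
      simpa using h3
    · rw [mul_div_cancel₀ _ (by positivity)]
  calc frobSq (∑ i ∈ s, A i) = ∑ p, ∑ q, (∑ i ∈ s, A i p q) ^ 2 := by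
        simp [frobSq, Matrix.sum_apply]
    _ ≤ ∑ p, ∑ q, (∑ i ∈ s, w i) * ∑ i ∈ s, w i * (A i p q ^ 2 / w i ^ 2) :=
        Finset.sum_le_sum fun p _ => Finset.sum_le_sum fun q _ => h1 p q
    _ = (∑ i ∈ s, w i) * ∑ i ∈ s, w i * (frobSq (A i) / w i ^ 2) := by
        simp only [← Finset.mul_sum]
        congr 1
        have : ∀ p, ∑ q, ∑ i ∈ s, w i * (A i p q ^ 2 / w i ^ 2) =
            ∑ i ∈ s, ∑ q, w i * (A i p q ^ 2 / w i ^ 2) := fun p => Finset.sum_comm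
        simp only [this]
        rw [Finset.sum_comm]
        refine Finset.sum_congr rfl fun i _ => ?_
        simp only [frobSq, Finset.sum_div, Finset.mul_sum]
    _ ≤ _ := by
        refine mul_le_mul_of_nonneg_left (Finset.sum_le_sum fun i _ => ?_)
          (Finset.sum_nonneg fun i _ => hw i)
        rcases (hw i).eq_or_lt with h2 | h2
        · simp [← h2]
        · refine mul_le_mul_of_nonneg_left ?_ (hw i)
          rw [div_le_iff₀ (by positivity), mul_comm]
          exact h i

theorem frobSq_mul_le (A : Matrix (Fin m) (Fin n) ℝ) (B : Matrix (Fin n) (Fin k) ℝ) :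
    frobSq (A * B) ≤ ‖A‖ ^ 2 * frobSq B := by
  have h : ∀ {a b : ℕ} (C : Matrix (Fin a) (Fin b) ℝ),
      frobSq C = ∑ j, (fun i => C i j) ⬝ᵥ (fun i => C i j) := fun C => by
    rw [frobSq, Finset.sum_comm]
    simp [dotProduct, sq]
  rw [h, h, Finset.mul_sum]
  exact Finset.sum_le_sum fun j _ => mulVec_dotProduct_self_le A fun i => B i j

theorem frobSq_mul_le' (A : Matrix (Fin m) (Fin n) ℝ) (B : Matrix (Fin n) (Fin k) ℝ) :
    frobSq (A * B) ≤ frobSq A * ‖B‖ ^ 2 := by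
  have := frobSq_mul_le Bᵀ Aᵀ
  rwa [← Matrix.transpose_mul, frobSq_transpose, frobSq_transpose, norm_transpose, mul_comm] at this

end WeightedSums

/-! ### Linear processes -/

section LinearProcess

variable {Ω : Type*} [MeasurableSpace Ω] {μ : Measure Ω} [IsProbabilityMeasure μ] {n : ℕ}
  {a Z : ℤ → Ω → Fin n → ℝ} {C : ℕ → Matrix (Fin n) (Fin n) ℝ}

theorem measurable_frobSq {m k : ℕ} {A : Ω → Matrix (Fin m) (Fin k) ℝ}
    (hA : ∀ i j, Measurable fun ω => A ω i j) : Measurable fun ω => frobSq (A ω) :=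
  Finset.measurable_fun_sum _ fun i _ => Finset.measurable_fun_sum _ fun j _ =>
    (hA i j).pow_const 2

/-- The partial sums of a linear process. -/
noncomputable def partialProcess (C : ℕ → Matrix (Fin n) (Fin n) ℝ) (a : ℤ → Ω → Fin n → ℝ)
    (m : ℕ) : ℤ → Ω → Fin n → ℝ :=
  fun t ω => ∑ k ∈ Finset.range m, C k *ᵥ a (t - k) ω

theorem partialProcess_apply (m : ℕ) (t : ℤ) (ω : Ω) (i : Fin n) :
    partialProcess C a m t ω i = ∑ k ∈ Finset.range m, (C k *ᵥ a (t - k) ω) i := by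
  simp [partialProcess, Finset.sum_apply]

theorem IsWhiteNoise.measurable_partialProcess (ha : IsWhiteNoise μ a) (m : ℕ) (t : ℤ)
    (i : Fin n) : Measurable fun ω => partialProcess C a m t ω i := by
  simp only [partialProcess_apply]
  refine Finset.measurable_fun_sum _ fun k _ => ?_
  simp only [Matrix.mulVec, dotProduct]
  exact Finset.measurable_fun_sum _ fun j _ => (ha.measurable_apply _ j).const_mul _

theorem IsLinearProcess.tendsto_partialProcess (hZ : IsLinearProcess μ C a Z) (t : ℤ) :
    ∀ᵐ ω ∂μ, ∀ i, Tendsto (fun m => partialProcess C a m t ω i) atTop (nhds (Z t ω i)) := by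
  filter_upwards [hZ t] with ω hω i
  exact (tendsto_pi_nhds.1 hω.tendsto_sum_nat) i

/-- The partial sums of a linear process are dominated in mean square. -/
theorem IsWhiteNoise.exists_dominating (ha : IsWhiteNoise μ a) (hC : Summable fun k => ‖C k‖) :
    ∃ G : ℤ → Ω → ℝ, (∀ t, Integrable (G t) μ) ∧
      ∀ t, ∀ᵐ ω ∂μ, ∀ m i, partialProcess C a m t ω i ^ 2 ≤ G t ω := by
  let b : ℤ → Ω → ℝ := fun t ω => a t ω ⬝ᵥ a t ω
  have hb0 : ∀ t ω, 0 ≤ b t ω := fun t ω => dotProduct_self_nonneg' _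
  have hbm : ∀ t, Measurable (b t) := fun t =>
    Finset.measurable_fun_sum _ fun j _ => (ha.measurable_apply t j).mul (ha.measurable_apply t j)
  have hbi : ∀ t, Integrable (b t) μ := fun t =>
    integrable_finsetSum _ fun j _ => ha.integrable_mul t t j j
  have hbc : ∀ t, ∫⁻ ω, ENNReal.ofReal (b t ω) ∂μ = ENNReal.ofReal (∫ ω, b 0 ω ∂μ) := fun t => by
    rw [← ofReal_integral_eq_lintegral_ofReal (hbi t) (ae_of_all _ (hb0 t))]
    congr 1
    simp only [b, dotProduct]
    rw [integral_finsetSum _ fun j _ => ha.integrable_mul t t j j,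
      integral_finsetSum _ fun j _ => ha.integrable_mul 0 0 j j]
    exact Finset.sum_congr rfl fun j _ => ha.cov _ _ _ _
  let S : ℝ := ∑' k, ‖C k‖
  -- By weighted Cauchy-Schwarz every partial sum is bounded by (∑ ‖C k‖) ∑ ‖C k‖ |a_{t-k}|². As an
  -- extended nonnegative series it has finite expectation, since E|a_t|² does not depend on t.
  let g : ℤ → Ω → ℝ≥0∞ := fun t ω => ∑' k : ℕ, ENNReal.ofReal (‖C k‖ * b (t - k) ω)
  have hgm : ∀ t, Measurable (g t) := fun t =>
    Measurable.tsum fun k => ((hbm _).const_mul _).ennreal_ofReal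
  have hg : ∀ t, ∫⁻ ω, g t ω ∂μ ≠ ∞ := fun t => by
    have h1 : ∫⁻ ω, g t ω ∂μ =
        (∑' k, ENNReal.ofReal ‖C k‖) * ENNReal.ofReal (∫ ω, b 0 ω ∂μ) := by
      simp only [g]
      rw [lintegral_tsum fun k => ((hbm _).const_mul _).ennreal_ofReal.aemeasurable,
        ← ENNReal.tsum_mul_right]
      refine tsum_congr fun k => ?_
      simp only [ENNReal.ofReal_mul (norm_nonneg _)]
      rw [lintegral_const_mul _ (hbm _).ennreal_ofReal, hbc]
    rw [h1]
    refine ENNReal.mul_ne_top ?_ ENNReal.ofReal_ne_top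
    exact hC.tsum_ofReal_ne_top
  refine ⟨fun t ω => S * (g t ω).toReal, fun t =>
    (integrable_toReal_of_lintegral_ne_top (hgm t).aemeasurable (hg t)).const_mul S, fun t => ?_⟩
  filter_upwards [ae_lt_top (hgm t) (hg t)] with ω hω m i
  rw [partialProcess_apply]
  have h1 := sum_sq_le_of_sq_le (Finset.range m) (x := fun k => (C k *ᵥ a (t - k) ω) i)
    (w := fun k => ‖C k‖) (b := fun k : ℕ => b (t - k) ω) (fun k => norm_nonneg _)
    (fun k => hb0 _ _) fun k => by
      refine le_trans ?_ (mulVec_dotProduct_self_le (C k) (a (t - k) ω))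
      have := Finset.single_le_sum (f := fun i => (C k *ᵥ a (t - k) ω) i * (C k *ᵥ a (t - k) ω) i)
        (fun _ _ => mul_self_nonneg _) (Finset.mem_univ i)
      simpa [sq, dotProduct] using this
  refine h1.trans (mul_le_mul (hC.sum_le_tsum _ fun k _ => norm_nonneg _) ?_
    (Finset.sum_nonneg fun k _ => mul_nonneg (norm_nonneg _) (hb0 _ _))
    (tsum_nonneg fun k => norm_nonneg _))
  rw [← ENNReal.ofReal_le_iff_le_toReal hω.ne,
    ENNReal.ofReal_sum_of_nonneg fun k _ => mul_nonneg (norm_nonneg _) (hb0 _ _)]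
  exact ENNReal.sum_le_tsum _

theorem IsLinearProcess.tendsto_integral_mul (hZ : IsLinearProcess μ C a Z)
    (ha : IsWhiteNoise μ a) (hC : Summable fun k => ‖C k‖) (s t : ℤ) (i j : Fin n) :
    Tendsto (fun m => ∫ ω, partialProcess C a m s ω i * partialProcess C a m t ω j ∂μ) atTop
      (nhds (∫ ω, Z s ω i * Z t ω j ∂μ)) := by
  obtain ⟨G, hGi, hG⟩ := ha.exists_dominating hC
  refine tendsto_integral_of_dominated_convergence (fun ω => G s ω + G t ω)
    (fun m => ((ha.measurable_partialProcess m s i).mul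
      (ha.measurable_partialProcess m t j)).aestronglyMeasurable) ((hGi s).add (hGi t))
    (fun m => ?_) ?_
  · filter_upwards [hG s, hG t] with ω h1 h2
    have h3 := h1 m i
    have h4 := h2 m j
    rw [Real.norm_eq_abs, abs_le]
    constructor <;> nlinarith [sq_nonneg (partialProcess C a m s ω i + partialProcess C a m t ω j),
      sq_nonneg (partialProcess C a m s ω i - partialProcess C a m t ω j),
      sq_nonneg (partialProcess C a m s ω i), sq_nonneg (partialProcess C a m t ω j)]
  · filter_upwards [hZ.tendsto_partialProcess s, hZ.tendsto_partialProcess t] with ω h1 h2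
    exact (h1 i).mul (h2 j)

theorem IsLinearProcess.memLp (hZ : IsLinearProcess μ C a Z) (ha : IsWhiteNoise μ a)
    (hC : Summable fun k => ‖C k‖) (hm : ∀ t, Measurable (Z t)) (t : ℤ) (i : Fin n) :
    MemLp (fun ω => Z t ω i) 2 μ := by
  obtain ⟨G, hGi, hG⟩ := ha.exists_dominating hC
  have hmi : Measurable fun ω => Z t ω i := (measurable_pi_apply i).comp (hm t)
  rw [memLp_two_iff_integrable_sq hmi.aestronglyMeasurable]
  refine (hGi t).mono' (hmi.pow_const 2).aestronglyMeasurable ?_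
  filter_upwards [hG t, hZ.tendsto_partialProcess t] with ω h1 h2
  rw [Real.norm_of_nonneg (sq_nonneg _)]
  exact le_of_tendsto ((h2 i).pow 2) (Eventually.of_forall fun m => h1 m i)

/-- Only equal noise times contribute, and the condition depends on s and t only through s - t. This
passes to the limit as stationarity of second moments. -/
theorem IsWhiteNoise.integral_partialProcess_mul (ha : IsWhiteNoise μ a) (m : ℕ) (s t : ℤ)
    (i j : Fin n) :
    ∫ ω, partialProcess C a m s ω i * partialProcess C a m t ω j ∂μ =
      ∑ k ∈ Finset.range m, ∑ l ∈ Finset.range m,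
        if s - k = t - l then (C k * autocov μ a 0 * (C l)ᵀ) i j else 0 := by
  have h0 : ∀ k l : ℕ, (fun ω => (C k *ᵥ a (s - k) ω) i * (C l *ᵥ a (t - l) ω) j) = fun ω =>
      ∑ p, ∑ q, (C k i p * C l j q) * (a (s - k) ω p * a (t - l) ω q) := fun k l => by
    ext ω
    simp only [Matrix.mulVec, dotProduct, Finset.sum_mul_sum]
    exact Finset.sum_congr rfl fun p _ => Finset.sum_congr rfl fun q _ => by ring
  have hi : ∀ k l : ℕ, ∀ p q, Integrable
      (fun ω => (C k i p * C l j q) * (a (s - k) ω p * a (t - l) ω q)) μ :=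
    fun k l p q => (ha.integrable_mul _ _ _ _).const_mul _
  have hi' : ∀ k l : ℕ, Integrable
      (fun ω => (C k *ᵥ a (s - k) ω) i * (C l *ᵥ a (t - l) ω) j) μ := fun k l => by
    rw [h0]
    exact integrable_finsetSum _ fun p _ => integrable_finsetSum _ fun q _ => hi k l p q
  simp only [partialProcess_apply, Finset.sum_mul_sum]
  rw [integral_finsetSum _ fun k _ => integrable_finsetSum _ fun l _ => hi' k l]
  refine Finset.sum_congr rfl fun k _ => ?_
  rw [integral_finsetSum _ fun l _ => hi' k l]
  refine Finset.sum_congr rfl fun l _ => ?_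
  rw [h0, integral_finsetSum _ fun p _ => integrable_finsetSum _ fun q _ => hi k l p q]
  simp only [integral_finsetSum _ fun q _ => hi k l _ q, integral_const_mul, ha.integral_mul]
  split_ifs
  · simp only [Matrix.mul_apply, Matrix.transpose_apply, Finset.sum_mul]
    rw [Finset.sum_comm]
    exact Finset.sum_congr rfl fun p _ => Finset.sum_congr rfl fun q _ => by ring
  · simp

/-- The second moments of a linear process are stationary. -/
theorem IsLinearProcess.integral_mul (hZ : IsLinearProcess μ C a Z)
    (ha : IsWhiteNoise μ a) (hC : Summable fun k => ‖C k‖) (s t : ℤ) (i j : Fin n) :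
    ∫ ω, Z s ω i * Z t ω j ∂μ = autocov μ Z (s - t) i j := by
  refine tendsto_nhds_unique (hZ.tendsto_integral_mul ha hC s t i j)
    ((hZ.tendsto_integral_mul ha hC (s - t) 0 i j).congr fun m => ?_)
  rw [ha.integral_partialProcess_mul, ha.integral_partialProcess_mul]
  refine Finset.sum_congr rfl fun k _ => Finset.sum_congr rfl fun l _ => ?_
  have : s - t - (k : ℤ) = 0 - l ↔ s - (k : ℤ) = t - l := by omega
  simp only [this]

/-- The mean square error of the sample covariance matrix of a linear process. -/
theorem IsLinearProcess.lintegral_frobSq_le (hZ : IsLinearProcess μ C a Z)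
    (ha : IsWhiteNoise μ a) {M S : ℝ} (hM : FourthMomentsLE μ a M) (hM0 : 0 ≤ M)
    (hC : Summable fun k => ‖C k‖) (hS : ∑' k, ‖C k‖ ≤ S) {ι : Type*} (J : Finset ι) {τ : ι → ℤ}
    (hτ : Function.Injective τ) :
    ∫⁻ ω, ENNReal.ofReal (frobSq (∑ t ∈ J,
      (Matrix.vecMulVec (Z (τ t) ω) (Z (τ t) ω) - autocov μ Z 0))) ∂μ ≤
      ENNReal.ofReal (S ^ 4 * (n ^ 2 * (J.card * M))) := by
  let Γ : ℕ → Matrix (Fin n) (Fin n) ℝ := fun m => ∑ k ∈ Finset.range m,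
    C k * autocov μ a 0 * (C k)ᵀ
  let N : ℕ → Ω → Matrix (Fin n) (Fin n) ℝ := fun m ω => ∑ t ∈ J, (Matrix.vecMulVec
    (partialProcess C a m (τ t) ω) (partialProcess C a m (τ t) ω) - Γ m)
  have hΓ : ∀ i j, Tendsto (fun m => Γ m i j) atTop (nhds (autocov μ Z 0 i j)) := fun i j => by
    have h := hZ.tendsto_integral_mul ha hC 0 0 i j
    refine h.congr fun m => ?_
    rw [ha.integral_partialProcess_mul]
    simp only [Γ, Matrix.sum_apply]
    refine Finset.sum_congr rfl fun k hk => ?_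
    rw [Finset.sum_eq_single_of_mem k hk fun l _ hl => if_neg (by omega), if_pos rfl]
  -- The truncated error is a double sum over lags of noise covariances between two coefficient
  -- matrices, so the weights ‖C k‖‖C l‖ sum to at most S².
  have hN : ∀ m ω, N m ω = ∑ p ∈ Finset.range m ×ˢ Finset.range m,
      C p.1 * noiseCov μ a J τ p.1 p.2 ω * (C p.2)ᵀ := fun m ω => by
    have h1 : ∀ t, Matrix.vecMulVec (partialProcess C a m (τ t) ω)
        (partialProcess C a m (τ t) ω) = ∑ k ∈ Finset.range m, ∑ l ∈ Finset.range m,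
        C k * Matrix.vecMulVec (a (τ t - k) ω) (a (τ t - l) ω) * (C l)ᵀ := fun t => by
      ext i j
      simp only [Matrix.vecMulVec_apply, partialProcess_apply, Finset.sum_mul_sum,
        Matrix.sum_apply, Matrix.mul_vecMulVec, Matrix.vecMulVec_mul, Matrix.vecMul_transpose]
    have h2 : Γ m = ∑ k ∈ Finset.range m, ∑ l ∈ Finset.range m,
        C k * (if k = l then autocov μ a 0 else 0) * (C l)ᵀ := by
      refine Finset.sum_congr rfl fun k hk => ?_
      rw [Finset.sum_eq_single_of_mem k hk fun l _ hl => by simp [hl.symm], if_pos rfl]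
    simp only [N, Finset.sum_product, noiseCov]
    rw [h2]
    simp only [h1, ← Finset.sum_sub_distrib, ← Matrix.sub_mul, ← Matrix.mul_sub]
    rw [Finset.sum_comm]
    refine Finset.sum_congr rfl fun k _ => ?_
    rw [Finset.sum_comm]
    simp only [Matrix.mul_sum, Matrix.sum_mul]
  have hNm : ∀ m i j, Measurable fun ω => N m ω i j := fun m i j => by
    simp only [N, Matrix.sum_apply, Matrix.sub_apply, Matrix.vecMulVec_apply]
    exact Finset.measurable_fun_sum _ fun t _ => ((ha.measurable_partialProcess m _ i).mul
      (ha.measurable_partialProcess m _ j)).sub_const _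
  have hbound : ∀ m, ∫⁻ ω, ENNReal.ofReal (frobSq (N m ω)) ∂μ ≤
      ENNReal.ofReal (S ^ 4 * (n ^ 2 * (J.card * M))) := fun m => by
    set s := Finset.range m ×ˢ Finset.range m
    have h1 : ∀ ω, frobSq (N m ω) ≤ (∑ p ∈ s, ‖C p.1‖ * ‖C p.2‖) *
        ∑ p ∈ s, ‖C p.1‖ * ‖C p.2‖ * frobSq (noiseCov μ a J τ p.1 p.2 ω) := fun ω => by
      rw [hN]
      refine frobSq_sum_le s (w := fun p => ‖C p.1‖ * ‖C p.2‖) (fun p => by positivity) fun p => ?_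
      refine (frobSq_mul_le' _ _).trans ?_
      rw [norm_transpose]
      have := frobSq_mul_le (C p.1) (noiseCov μ a J τ p.1 p.2 ω)
      calc _ ≤ ‖C p.1‖ ^ 2 * frobSq (noiseCov μ a J τ p.1 p.2 ω) * ‖C p.2‖ ^ 2 := by gcongr
        _ = _ := by ring
    have hint : Integrable (fun ω => (∑ p ∈ s, ‖C p.1‖ * ‖C p.2‖) *
        ∑ p ∈ s, ‖C p.1‖ * ‖C p.2‖ * frobSq (noiseCov μ a J τ p.1 p.2 ω)) μ :=
      (integrable_finsetSum _ fun p _ =>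
        (ha.integral_frobSq_noiseCov_le hM J hτ p.1 p.2).1.const_mul _).const_mul _
    refine (lintegral_mono fun ω => ENNReal.ofReal_le_ofReal (h1 ω)).trans ?_
    rw [← ofReal_integral_eq_lintegral_ofReal hint (ae_of_all _ fun ω =>
      (frobSq_nonneg _).trans (h1 ω))]
    refine ENNReal.ofReal_le_ofReal ?_
    rw [integral_const_mul, integral_finsetSum _ fun p _ =>
      (ha.integral_frobSq_noiseCov_le hM J hτ p.1 p.2).1.const_mul _]
    simp only [integral_const_mul]
    have hw : ∑ p ∈ s, ‖C p.1‖ * ‖C p.2‖ ≤ S ^ 2 := by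
      rw [Finset.sum_product]
      dsimp only
      rw [← Finset.sum_mul_sum, ← sq]
      exact pow_le_pow_left₀ (Finset.sum_nonneg fun _ _ => norm_nonneg _)
        ((hC.sum_le_tsum _ fun k _ => norm_nonneg _).trans hS) 2
    have hw0 : 0 ≤ ∑ p ∈ s, ‖C p.1‖ * ‖C p.2‖ := Finset.sum_nonneg fun p _ => by positivity
    set B : ℝ := n ^ 2 * (J.card * M)
    have hB : 0 ≤ B := by positivity
    calc _ ≤ (∑ p ∈ s, ‖C p.1‖ * ‖C p.2‖) * ∑ p ∈ s, ‖C p.1‖ * ‖C p.2‖ * B := by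
          refine mul_le_mul_of_nonneg_left (Finset.sum_le_sum fun p _ => ?_) hw0
          exact mul_le_mul_of_nonneg_left (ha.integral_frobSq_noiseCov_le hM J hτ p.1 p.2).2
            (by positivity)
      _ = (∑ p ∈ s, ‖C p.1‖ * ‖C p.2‖) ^ 2 * B := by rw [← Finset.sum_mul]; ring
      _ ≤ (S ^ 2) ^ 2 * B := by gcongr
      _ = _ := by ring
  have hlim : ∀ᵐ ω ∂μ, Tendsto (fun m => ENNReal.ofReal (frobSq (N m ω))) atTop
      (nhds (ENNReal.ofReal (frobSq (∑ t ∈ J,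
        (Matrix.vecMulVec (Z (τ t) ω) (Z (τ t) ω) - autocov μ Z 0))))) := by
    have h1 : ∀ᵐ ω ∂μ, ∀ t : ℤ, ∀ i, Tendsto (fun m => partialProcess C a m t ω i) atTop
        (nhds (Z t ω i)) := ae_all_iff.2 hZ.tendsto_partialProcess
    filter_upwards [h1] with ω hω
    refine ENNReal.tendsto_ofReal ?_
    unfold frobSq
    refine tendsto_finsetSum _ fun i _ => tendsto_finsetSum _ fun j _ => Tendsto.pow ?_ 2
    simp only [N, Matrix.sum_apply, Matrix.sub_apply, Matrix.vecMulVec_apply]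
    exact tendsto_finsetSum _ fun t _ => ((hω _ i).mul (hω _ j)).sub (hΓ i j)
  -- Fatou's lemma: the bound does not depend on the truncation level, and fourth moments of the
  -- limit process are never needed.
  calc _ = ∫⁻ ω, liminf (fun m => ENNReal.ofReal (frobSq (N m ω))) atTop ∂μ :=
        lintegral_congr_ae (hlim.mono fun ω hω => hω.liminf_eq.symm)
    _ ≤ liminf (fun m => ∫⁻ ω, ENNReal.ofReal (frobSq (N m ω)) ∂μ) atTop :=
        lintegral_liminf_le fun m => (measurable_frobSq (hNm m)).ennreal_ofReal
    _ ≤ liminf (fun _ => ENNReal.ofReal (S ^ 4 * (n ^ 2 * (J.card * M)))) atTop :=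
        liminf_le_liminf (Eventually.of_forall hbound)
    _ = _ := liminf_const _

end LinearProcess

/-! ### Quadratic forms -/

section QuadraticForms

variable {n : ℕ}

theorem exists_pos_le (p : Fin n → ℝ) (hp : ∀ i, 0 < p i) : ∃ v : ℝ, 0 < v ∧ ∀ i, v ≤ p i := by
  rcases isEmpty_or_nonempty (Fin n) with h | h
  · exact ⟨1, one_pos, fun i => h.elim i⟩
  · obtain ⟨i, hi⟩ := Finite.exists_min p
    exact ⟨p i, hp i, hi⟩

theorem dotProduct_mulVec_eq_sum {A V : Matrix (Fin n) (Fin n) ℝ}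
    (hV : IsLeadingEigenvectors A V) (u : Fin n → ℝ) :
    u ⬝ᵥ u = ∑ j, (Vᵀ *ᵥ u) j ^ 2 ∧
      u ⬝ᵥ (A *ᵥ u) = ∑ j : Fin n, eigDesc A j * (Vᵀ *ᵥ u) j ^ 2 := by
  have hV1 : V * Vᵀ = 1 := mul_eq_one_comm.1 hV.orthonormal
  obtain ⟨c, hc⟩ : ∃ c, c = Vᵀ *ᵥ u := ⟨_, rfl⟩
  have hu : u = V *ᵥ c := by rw [hc, Matrix.mulVec_mulVec, hV1, Matrix.one_mulVec]
  rw [← hc, hu]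
  constructor
  · rw [mulVec_dotProduct, Matrix.mulVec_mulVec, hV.orthonormal]
    simp [dotProduct, sq]
  · rw [Matrix.mulVec_mulVec, hV.eigen, mulVec_dotProduct, Matrix.mulVec_mulVec,
      ← Matrix.mul_assoc, hV.orthonormal, Matrix.one_mul]
    simp only [dotProduct, Matrix.mulVec_diagonal]
    exact Finset.sum_congr rfl fun j _ => by ring

theorem mul_dotProduct_le_of_le_eigDesc {A : Matrix (Fin n) (Fin n) ℝ} (hA : A.IsHermitian)
    {v : ℝ} (hv : ∀ i : Fin n, v ≤ eigDesc A i) (u : Fin n → ℝ) :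
    v * (u ⬝ᵥ u) ≤ u ⬝ᵥ (A *ᵥ u) := by
  obtain ⟨V, hV⟩ := exists_isLeadingEigenvectors A hA (le_refl n)
  rw [(dotProduct_mulVec_eq_sum hV u).1, (dotProduct_mulVec_eq_sum hV u).2, Finset.mul_sum]
  exact Finset.sum_le_sum fun j _ => mul_le_mul_of_nonneg_right (hv j) (sq_nonneg _)

theorem dotProduct_le_mul_of_eigDesc_le {A : Matrix (Fin n) (Fin n) ℝ} (hA : A.IsHermitian)
    {v : ℝ} (hv : ∀ i : Fin n, eigDesc A i ≤ v) (u : Fin n → ℝ) :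
    u ⬝ᵥ (A *ᵥ u) ≤ v * (u ⬝ᵥ u) := by
  obtain ⟨V, hV⟩ := exists_isLeadingEigenvectors A hA (le_refl n)
  rw [(dotProduct_mulVec_eq_sum hV u).1, (dotProduct_mulVec_eq_sum hV u).2, Finset.mul_sum]
  exact Finset.sum_le_sum fun j _ => mul_le_mul_of_nonneg_right (hv j) (sq_nonneg _)

theorem exists_pos_mul_dotProduct_le {A : Matrix (Fin n) (Fin n) ℝ} (hA : A.PosDef) :
    ∃ v : ℝ, 0 < v ∧ ∀ u, v * (u ⬝ᵥ u) ≤ u ⬝ᵥ (A *ᵥ u) := by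
  obtain ⟨V, hV⟩ := exists_isLeadingEigenvectors A hA.isHermitian (le_refl n)
  have hpos : ∀ i : Fin n, 0 < eigDesc A i := fun i => by
    have h1 := dotProduct_mulVec_eq_sum hV (V *ᵥ Pi.single i 1)
    rw [Matrix.mulVec_mulVec (Pi.single i 1) Vᵀ, hV.orthonormal, Matrix.one_mulVec] at h1
    have h2 : V *ᵥ Pi.single i 1 ≠ 0 := fun h0 => by
      have := h1.1
      rw [h0] at this
      simp [Pi.single_apply] at this
    have h3 := hA.dotProduct_mulVec_pos h2
    rw [star_trivial, h1.2] at h3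
    simpa [Pi.single_apply] using h3
  obtain ⟨v, hv, hle⟩ := exists_pos_le _ hpos
  exact ⟨v, hv, mul_dotProduct_le_of_le_eigDesc hA.isHermitian hle⟩

theorem abs_dotProduct_mulVec_le (A : Matrix (Fin n) (Fin n) ℝ) (u : Fin n → ℝ) :
    |u ⬝ᵥ (A *ᵥ u)| ≤ ‖A‖ * (u ⬝ᵥ u) := by
  have h0 := dotProduct_self_nonneg' u
  refine abs_le_of_sq_le_sq ?_ (by positivity)
  calc (u ⬝ᵥ (A *ᵥ u)) ^ 2 ≤ (u ⬝ᵥ u) * ((A *ᵥ u) ⬝ᵥ (A *ᵥ u)) := dotProduct_sq_le _ _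
    _ ≤ (u ⬝ᵥ u) * (‖A‖ ^ 2 * (u ⬝ᵥ u)) := by gcongr; exact mulVec_dotProduct_self_le A u
    _ = _ := by ring

end QuadraticForms

/-! ### Moment bounds for the factor model -/

section Moments

variable {Ω : Type*} [MeasurableSpace Ω] {μ : Measure Ω}

/-- Markov's inequality. -/
theorem measure_not_le_le {X : Ω → ℝ} (hX : Measurable X) {B K : ℝ} (hK : 0 < K)
    (h : ∫⁻ ω, ENNReal.ofReal (X ω) ∂μ ≤ ENNReal.ofReal B) :
    μ {ω | ¬ X ω ≤ K} ≤ ENNReal.ofReal (B / K) := by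
  have h1 : μ {ω | ¬ X ω ≤ K} ≤ μ {ω | ENNReal.ofReal K ≤ ENNReal.ofReal (X ω)} :=
    measure_mono fun ω hω => ENNReal.ofReal_le_ofReal (not_le.1 hω).le
  refine h1.trans ((meas_ge_le_lintegral_div hX.ennreal_ofReal.aemeasurable
    (by simpa using hK) ENNReal.ofReal_ne_top).trans ?_)
  rw [ENNReal.ofReal_div_of_pos hK]
  gcongr

theorem measure_not_and_le {p q : Ω → Prop} {x y : ℝ} (hx : 0 ≤ x) (hy : 0 ≤ y)
    (hp : μ {ω | ¬ p ω} ≤ ENNReal.ofReal x) (hq : μ {ω | ¬ q ω} ≤ ENNReal.ofReal y) :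
    μ {ω | ¬ (p ω ∧ q ω)} ≤ ENNReal.ofReal (x + y) := by
  rw [ENNReal.ofReal_add hx hy]
  refine (measure_mono fun ω hω => ?_).trans ((measure_union_le _ _).trans (add_le_add hp hq))
  rcases not_and_or.1 hω with h | h
  exacts [Or.inl h, Or.inr h]

theorem lintegral_frobSq_le {m k : ℕ} {A : Ω → Matrix (Fin m) (Fin k) ℝ}
    {B : Fin m → Fin k → ℝ} (hi : ∀ i j, Integrable (fun ω => A ω i j ^ 2) μ)
    (hB : ∀ i j, ∫ ω, A ω i j ^ 2 ∂μ ≤ B i j) :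
    ∫⁻ ω, ENNReal.ofReal (frobSq (A ω)) ∂μ ≤ ENNReal.ofReal (∑ i, ∑ j, B i j) := by
  unfold frobSq
  rw [← ofReal_integral_eq_lintegral_ofReal (integrable_finsetSum _ fun i _ =>
    integrable_finsetSum _ fun j _ => hi i j) (ae_of_all _ fun ω => by positivity)]
  refine ENNReal.ofReal_le_ofReal ?_
  rw [integral_finsetSum _ fun i _ => integrable_finsetSum _ fun j _ => hi i j]
  refine Finset.sum_le_sum fun i _ => ?_
  rw [integral_finsetSum _ fun j _ => hi i j]
  exact Finset.sum_le_sum fun j _ => hB i j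

/-- The second moment of a sum of products of two independent families. -/
theorem integral_sum_mul_sq_le {ι : Type*} (J : Finset ι) {X W : ι → Ω → ℝ} {A B : ℝ}
    {w : ι → ι → ℝ} (hX : ∀ s, MemLp (X s) 2 μ) (hW : ∀ s, MemLp (W s) 2 μ)
    (hind : ∀ s t, IndepFun (fun ω => X s ω * X t ω) (fun ω => W s ω * W t ω) μ)
    (hA0 : 0 ≤ A) (hA : ∀ s t, |∫ ω, X s ω * X t ω ∂μ| ≤ A)
    (hw : ∀ s t, |∫ ω, W s ω * W t ω ∂μ| ≤ w s t) (hB : ∀ s, ∑ t ∈ J, w s t ≤ B) :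
    Integrable (fun ω => (∑ s ∈ J, X s ω * W s ω) ^ 2) μ ∧
      ∫ ω, (∑ s ∈ J, X s ω * W s ω) ^ 2 ∂μ ≤ J.card * (A * B) := by
  have h : (fun ω => (∑ t ∈ J, X t ω * W t ω) ^ 2) =
      fun ω => ∑ s ∈ J, ∑ t ∈ J, (X s ω * X t ω) * (W s ω * W t ω) := by
    ext ω
    rw [sq, Finset.sum_mul_sum]
    exact Finset.sum_congr rfl fun s _ => Finset.sum_congr rfl fun t _ => by ring
  have hXi : ∀ s t, Integrable (fun ω => X s ω * X t ω) μ := fun s t =>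
    (hX s).integrable_mul (hX t)
  have hWi : ∀ s t, Integrable (fun ω => W s ω * W t ω) μ := fun s t =>
    (hW s).integrable_mul (hW t)
  have hi : ∀ s t, Integrable (fun ω => (X s ω * X t ω) * (W s ω * W t ω)) μ := fun s t =>
    (hind s t).integrable_mul (hXi s t) (hWi s t)
  rw [h]
  refine ⟨integrable_finsetSum _ fun s _ => integrable_finsetSum _ fun t _ => hi s t, ?_⟩
  rw [integral_finsetSum _ fun s _ => integrable_finsetSum _ fun t _ => hi s t]
  have h1 : ∀ s ∈ J, ∫ ω, ∑ t ∈ J, (X s ω * X t ω) * (W s ω * W t ω) ∂μ ≤ A * B := fun s _ => by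
    rw [integral_finsetSum _ fun t _ => hi s t]
    refine le_trans ?_ (mul_le_mul_of_nonneg_left (hB s) hA0)
    rw [Finset.mul_sum]
    refine Finset.sum_le_sum fun t _ => ?_
    rw [(hind s t).integral_fun_mul_eq_mul_integral (hXi s t).aestronglyMeasurable
      (hWi s t).aestronglyMeasurable]
    refine (le_abs_self _).trans ?_
    rw [abs_mul]
    exact mul_le_mul (hA s t) (hw s t) (abs_nonneg _) hA0
  exact (Finset.sum_le_sum h1).trans_eq (by simp)

theorem abs_integral_mul_le {X Y : Ω → ℝ} (hX : MemLp X 2 μ) (hY : MemLp Y 2 μ) {A : ℝ}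
    (hA : ∫ ω, X ω * X ω ∂μ ≤ A) (hA' : ∫ ω, Y ω * Y ω ∂μ ≤ A) :
    |∫ ω, X ω * Y ω ∂μ| ≤ A := by
  have h1 : ∫ ω, |X ω * Y ω| ∂μ ≤ ∫ ω, (1 / 2 * (X ω * X ω) + 1 / 2 * (Y ω * Y ω)) ∂μ := by
    refine integral_mono (hX.integrable_mul hY).abs
      (((hX.integrable_mul hX).const_mul _).add ((hY.integrable_mul hY).const_mul _)) fun ω => ?_
    show |X ω * Y ω| ≤ 1 / 2 * (X ω * X ω) + 1 / 2 * (Y ω * Y ω)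
    rw [abs_le]
    constructor <;> nlinarith [sq_nonneg (X ω + Y ω), sq_nonneg (X ω - Y ω)]
  have i1 : Integrable (fun ω => 1 / 2 * (X ω * X ω)) μ := (hX.integrable_mul hX).const_mul _
  have i2 : Integrable (fun ω => 1 / 2 * (Y ω * Y ω)) μ := (hY.integrable_mul hY).const_mul _
  rw [integral_add i1 i2, integral_const_mul, integral_const_mul] at h1
  exact (abs_integral_le_integral_abs).trans (by linarith)

end Moments

/-! ### The two halves of the sample -/

section Halves

/-- The first half (`true`) and the second half (`false`) of the observation times. -/
def halfSet (T : ℕ) (i : Bool) : Finset (Fin T) :=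
  Finset.univ.filter fun s => decide ((s : ℕ) < T / 2) = i

/-- The diagonal matrix that selects one half of the rows. -/
noncomputable def halves (T : ℕ) (i : Bool) : Matrix (Fin T) (Fin T) ℝ :=
  Matrix.diagonal fun s => if s ∈ halfSet T i then 1 else 0

theorem isSplit_halves (T : ℕ) : IsSplit (halves T) where
  symm i := Matrix.diagonal_transpose _
  idem i := by
    rw [halves, Matrix.diagonal_mul_diagonal]
    congr 1; ext s; split_ifs <;> simp
  orth i := by
    rw [halves, halves, Matrix.diagonal_mul_diagonal, ← Matrix.diagonal_zero]
    congr 1; ext s; cases i <;> by_cases h : (s : ℕ) < T / 2 <;> simp [halfSet, h]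
  sum := by
    rw [halves, halves, Matrix.diagonal_add, ← Matrix.diagonal_one]
    congr 1; ext s; by_cases h : (s : ℕ) < T / 2 <;> simp [halfSet, h]

theorem card_halfSet_true (T : ℕ) : (halfSet T true).card = T / 2 := by
  simp only [halfSet, decide_eq_true_eq]
  rw [Fin.card_filter_val_lt]; omega

theorem card_halfSet_le (T : ℕ) (i : Bool) : (halfSet T i).card ≤ T :=
  (Finset.card_filter_le _ _).trans_eq (by simp)

theorem transpose_mul_halves_mul {T m k : ℕ} (A : Matrix (Fin T) (Fin m) ℝ)
    (B : Matrix (Fin T) (Fin k) ℝ) (i : Bool) (p : Fin m) (q : Fin k) :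
    (Aᵀ * halves T i * B) p q = ∑ s ∈ halfSet T i, A s p * B s q := by
  rw [Matrix.mul_apply]
  simp only [halves, Matrix.mul_diagonal, Matrix.transpose_apply]
  have h : ∀ s, A s p * (if s ∈ halfSet T i then 1 else 0) * B s q =
      if s ∈ halfSet T i then A s p * B s q else 0 := fun s => by split_ifs <;> simp
  simp only [h]
  rw [Finset.sum_ite_mem, Finset.univ_inter]

theorem injective_time (T : ℕ) : Function.Injective fun s : Fin T => ((s : ℕ) : ℤ) + 1 :=
  fun s t h => Fin.ext (by simpa using h)

end Halves

/-! ### Moments of the samples -/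

section Samples

variable {Ω : Type*} [MeasurableSpace Ω] {μ : Measure Ω} [IsProbabilityMeasure μ] {r : ℕ}
  {Υ : ∀ d : ℕ, Matrix (Fin d) (Fin r) ℝ} {F : ℤ → Ω → Fin r → ℝ} {ε : ∀ d : ℕ, ℤ → Ω → Fin d → ℝ}

theorem WoldAssumption.measurable_factor_apply (h : WoldAssumption μ F ε) (t : ℤ) (j : Fin r) :
    Measurable fun ω => F t ω j := (measurable_pi_apply j).comp (h.measurable_factor t)

theorem WoldAssumption.measurable_error_apply (h : WoldAssumption μ F ε) {d : ℕ} (hd : r < d)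
    (t : ℤ) (j : Fin d) : Measurable fun ω => ε d t ω j :=
  (measurable_pi_apply j).comp (h.measurable_error d hd t)

theorem WoldAssumption.memLp_factor (h : WoldAssumption μ F ε) (t : ℤ) (j : Fin r) :
    MemLp (fun ω => F t ω j) 2 μ := by
  obtain ⟨C, a, ha, -, hC, hF⟩ := h.factor
  exact hF.memLp ha hC h.measurable_factor t j

theorem WoldAssumption.memLp_error (h : WoldAssumption μ F ε) {d : ℕ} (hd : r < d) (t : ℤ)
    (j : Fin d) : MemLp (fun ω => ε d t ω j) 2 μ := by
  obtain ⟨M, hM⟩ := h.error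
  obtain ⟨D, b, hb, -, hD, -, hε⟩ := hM d hd
  exact hε.memLp hb hD (h.measurable_error d hd) t j

theorem WoldAssumption.integral_factor_mul (h : WoldAssumption μ F ε) (s t : ℤ) (i j : Fin r) :
    ∫ ω, F s ω i * F t ω j ∂μ = autocov μ F (s - t) i j := by
  obtain ⟨C, a, ha, -, hC, hF⟩ := h.factor
  exact hF.integral_mul ha hC s t i j

theorem WoldAssumption.integral_error_mul (h : WoldAssumption μ F ε) {d : ℕ} (hd : r < d)
    (s t : ℤ) (i j : Fin d) :
    ∫ ω, ε d s ω i * ε d t ω j ∂μ = autocov μ (ε d) (s - t) i j := by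
  obtain ⟨M, hM⟩ := h.error
  obtain ⟨D, b, hb, -, hD, -, hε⟩ := hM d hd
  exact hε.integral_mul hb hD s t i j

theorem WoldAssumption.autocov_diag_nonneg (h : WoldAssumption μ F ε) (j : Fin r) :
    0 ≤ autocov μ F 0 j j := by
  have h1 := h.integral_factor_mul 0 0 j j
  rw [sub_self] at h1
  rw [← h1]
  exact integral_nonneg fun ω => mul_self_nonneg _

theorem WoldAssumption.abs_integral_factor_mul_le (h : WoldAssumption μ F ε) (s t : ℤ)
    (j : Fin r) : |∫ ω, F s ω j * F t ω j ∂μ| ≤ autocov μ F 0 j j := by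
  refine abs_integral_mul_le (h.memLp_factor s j) (h.memLp_factor t j) ?_ ?_ <;>
  rw [h.integral_factor_mul, sub_self]

/-- Linear combinations of the errors. -/
theorem WoldAssumption.abs_integral_error_mul_le (h : WoldAssumption μ F ε) {d : ℕ} (hd : r < d)
    (g : Fin d → ℝ) (s t : ℤ) :
    |∫ ω, (ε d s ω ⬝ᵥ g) * (ε d t ω ⬝ᵥ g) ∂μ| ≤ ‖autocov μ (ε d) (s - t)‖ * (g ⬝ᵥ g) := by
  have h1 : ∫ ω, (ε d s ω ⬝ᵥ g) * (ε d t ω ⬝ᵥ g) ∂μ = g ⬝ᵥ (autocov μ (ε d) (s - t) *ᵥ g) := by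
    have h2 : (fun ω => (ε d s ω ⬝ᵥ g) * (ε d t ω ⬝ᵥ g)) =
        fun ω => ∑ i, ∑ j, (g i * g j) * (ε d s ω i * ε d t ω j) := by
      ext ω
      simp only [dotProduct, Finset.sum_mul_sum]
      exact Finset.sum_congr rfl fun i _ => Finset.sum_congr rfl fun j _ => by ring
    have hi : ∀ i j, Integrable (fun ω => (g i * g j) * (ε d s ω i * ε d t ω j)) μ := fun i j =>
      ((h.memLp_error hd s i).integrable_mul (h.memLp_error hd t j)).const_mul _
    rw [h2, integral_finsetSum _ fun i _ => integrable_finsetSum _ fun j _ => hi i j]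
    simp only [integral_finsetSum _ fun j _ => hi _ j, integral_const_mul,
      h.integral_error_mul hd, dotProduct, Matrix.mulVec, Finset.mul_sum]
    exact Finset.sum_congr rfl fun i _ => Finset.sum_congr rfl fun j _ => by ring
  rw [h1]
  exact abs_dotProduct_mulVec_le _ g

theorem WoldAssumption.memLp_error_dotProduct (h : WoldAssumption μ F ε) {d : ℕ} (hd : r < d)
    (g : Fin d → ℝ) (t : ℤ) : MemLp (fun ω => ε d t ω ⬝ᵥ g) 2 μ := by
  simp only [dotProduct]
  exact memLp_finsetSum _ fun i _ => by
    simpa [mul_comm] using (h.memLp_error hd t i).const_mul (g i)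

theorem measurable_sample {m : ℕ} {Z : ℤ → Ω → Fin m → ℝ} (hZ : ∀ t j, Measurable fun ω => Z t ω j)
    (T : ℕ) (s : Fin T) (j : Fin m) : Measurable fun ω => sample Z T ω s j := hZ _ j

theorem lintegral_frobSq_factors_le (h : WoldAssumption μ F ε) (T : ℕ) :
    ∫⁻ ω, ENNReal.ofReal (frobSq (sample F T ω)) ∂μ ≤
      ENNReal.ofReal (T * (autocov μ F 0).trace) := by
  refine (lintegral_frobSq_le (B := fun _ j => autocov μ F 0 j j)
    (fun s j => (h.memLp_factor _ j).integrable_sq) fun s j => ?_).trans_eq ?_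
  · have := h.integral_factor_mul (s + 1) (s + 1) j j
    rw [sub_self] at this
    rw [← this]
    exact le_of_eq (integral_congr_ae (ae_of_all _ fun ω => by simp [sq]))
  · simp [Matrix.trace]

theorem lintegral_frobSq_errors_le (h : WoldAssumption μ F ε) (h' : ErrorMomentAssumption μ Υ ε) :
    ∃ C : ℝ, ∀ d, r < d → ∀ T, ∫⁻ ω, ENNReal.ofReal (frobSq (sample (ε d) T ω)) ∂μ ≤
      ENNReal.ofReal (T * d * C) := by
  obtain ⟨M, hM⟩ := h'.fourth
  refine ⟨1 + M, fun d hd T => ?_⟩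
  refine (lintegral_frobSq_le (B := fun _ _ => 1 + M)
    (fun s j => (h.memLp_error hd _ j).integrable_sq) fun s j => ?_).trans_eq ?_
  · obtain ⟨h1, h2⟩ := hM d hd (s + 1) (by omega) j
    have h3 : ∫ ω, sample (ε d) T ω s j ^ 2 ∂μ ≤ ∫ ω, (1 + ε d (s + 1) ω j ^ 4) ∂μ := by
      refine integral_mono (h.memLp_error hd _ j).integrable_sq ((integrable_const _).add h1)
        fun ω => ?_
      simp only [sample, Matrix.of_apply]
      nlinarith [sq_nonneg (ε d (s + 1) ω j ^ 2 - 1), sq_nonneg (ε d (s + 1) ω j ^ 2)]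
    rw [integral_add (integrable_const _) h1] at h3
    simp only [integral_const, probReal_univ, smul_eq_mul, mul_one] at h3
    exact h3.trans (by linarith)
  · congr 1
    simp
    ring

/-- The assumption bounds the fourth moment of ε'Υ by a multiple of d²; this yields second moments
of order d instead of the trivial d². -/
theorem lintegral_frobSq_errors_mul_loadings_le (h : WoldAssumption μ F ε)
    (h' : ErrorMomentAssumption μ Υ ε) :
    ∃ C : ℝ, ∀ d, r < d → ∀ T, ∫⁻ ω, ENNReal.ofReal (frobSq (sample (ε d) T ω * Υ d)) ∂μ ≤
      ENNReal.ofReal (T * d * C) := by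
  obtain ⟨M, hM⟩ := h'.projected
  refine ⟨r * (1 + M), fun d hd T => ?_⟩
  have hd0 : (0 : ℝ) < d := by exact_mod_cast (Nat.zero_le r).trans_lt hd
  have hi : ∀ (s : Fin T) l, Integrable (fun ω => (sample (ε d) T ω * Υ d) s l ^ 2) μ :=
    fun s l => (h.memLp_error_dotProduct hd (fun i => Υ d i l) (s + 1)).integrable_sq
  refine (lintegral_frobSq_le (B := fun _ _ => d * (1 + M)) hi fun s l => ?_).trans_eq ?_
  · obtain ⟨h1, h2⟩ := hM d hd (s + 1) (by omega)
    have i1 : Integrable (fun ω => 1 / (d : ℝ) *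
      (∑ l, (ε d (s + 1) ω ᵥ* Υ d) l ^ 2) ^ 2) μ := h1.const_mul _
    have h3 : ∫ ω, (sample (ε d) T ω * Υ d) s l ^ 2 ∂μ ≤
        ∫ ω, ((d : ℝ) + 1 / d * (∑ l, (ε d (s + 1) ω ᵥ* Υ d) l ^ 2) ^ 2) ∂μ := by
      refine integral_mono (hi s l) ((integrable_const _).add i1) fun ω => ?_
      have h4 : (sample (ε d) T ω * Υ d) s l ^ 2 ≤ ∑ l, (ε d (s + 1) ω ᵥ* Υ d) l ^ 2 :=
        Finset.single_le_sum (f := fun l => (ε d (s + 1) ω ᵥ* Υ d) l ^ 2)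
          (fun _ _ => sq_nonneg _) (Finset.mem_univ l)
      refine h4.trans ?_
      generalize ∑ l, (ε d (s + 1) ω ᵥ* Υ d) l ^ 2 = x
      -- The weights d and 1/d balance the inequality, so that both summands are of order d when x²
      -- is of order d².
      have h5 : 2 * x ≤ d + 1 / d * x ^ 2 := by
        have : (d : ℝ) + 1 / d * x ^ 2 - 2 * x = 1 / d * (x - d) ^ 2 := by field_simp; ring
        have h6 : 0 ≤ 1 / (d : ℝ) * (x - d) ^ 2 := by positivity
        linarith
      have h7 : 0 ≤ 1 / (d : ℝ) * x ^ 2 := by positivity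
      show x ≤ (d : ℝ) + 1 / d * x ^ 2
      linarith
    rw [integral_add (integrable_const _) i1, integral_const_mul] at h3
    simp only [integral_const, probReal_univ, smul_eq_mul, one_mul] at h3
    have h8 : 1 / (d : ℝ) * ∫ ω, (∑ l, (ε d (s + 1) ω ᵥ* Υ d) l ^ 2) ^ 2 ∂μ =
        d * (1 / (d : ℝ) ^ 2 * ∫ ω, (∑ l, (ε d (s + 1) ω ᵥ* Υ d) l ^ 2) ^ 2 ∂μ) := by
      field_simp
    rw [h8] at h3
    nlinarith
  · congr 1
    simp
    ring

/-- Independence splits the moments into those of the factors, which are bounded, and those of the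
errors, whose sum over lags is bounded. The result is of order T instead of T². It is applied with G
= 1 and G = Υ, both with squared Frobenius norm of order d. -/
theorem lintegral_frobSq_factors_errors_le (h : WoldAssumption μ F ε) {d : ℕ} (hd : r < d)
    {B : ℝ} (hB0 : 0 ≤ B)
    (hB : ∑' k : ℤ, ENNReal.ofReal ‖autocov μ (ε d) k‖ ≤ ENNReal.ofReal B) {k : ℕ}
    (G : Matrix (Fin d) (Fin k) ℝ) (T : ℕ) (i : Bool) :
    ∫⁻ ω, ENNReal.ofReal (frobSq ((sample F T ω)ᵀ * halves T i * (sample (ε d) T ω * G))) ∂μ ≤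
      ENNReal.ofReal (T * ((autocov μ F 0).trace * (B * frobSq G))) := by
  -- For fixed s the lags s - t are distinct, so the finite sum is part of the autocovariance
  -- series.
  have hBs : ∀ J : Finset (Fin T), ∀ s : Fin T,
      ∑ t ∈ J, ‖autocov μ (ε d) ((s + 1 : ℤ) - (t + 1))‖ ≤ B := fun J s => by
    have hinj : Function.Injective fun t : Fin T => (s + 1 : ℤ) - (t + 1) := fun t u htu =>
      Fin.ext (by simpa using htu)
    rw [← ENNReal.ofReal_le_ofReal_iff hB0, ENNReal.ofReal_sum_of_nonneg fun _ _ => norm_nonneg _]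
    refine le_trans ?_ hB
    rw [← Finset.sum_image (f := fun k => ENNReal.ofReal ‖autocov μ (ε d) k‖)
      (g := fun t : Fin T => (s + 1 : ℤ) - (t + 1)) (s := J) hinj.injOn]
    exact ENNReal.sum_le_tsum _
  have hentry : ∀ j p, Integrable (fun ω => ((sample F T ω)ᵀ * halves T i *
      (sample (ε d) T ω * G)) j p ^ 2) μ ∧ ∫ ω, ((sample F T ω)ᵀ * halves T i *
      (sample (ε d) T ω * G)) j p ^ 2 ∂μ ≤
      T * (autocov μ F 0 j j * (B * ∑ q, G q p ^ 2)) := fun j p => by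
    simp only [transpose_mul_halves_mul]
    have hgg : (fun q => G q p) ⬝ᵥ (fun q => G q p) = ∑ q, G q p ^ 2 := by simp [dotProduct, sq]
    have hg0 : 0 ≤ ∑ q, G q p ^ 2 := by positivity
    have h1 := integral_sum_mul_sq_le (μ := μ) (halfSet T i)
      (X := fun (s : Fin T) ω => F (s + 1) ω j)
      (W := fun (s : Fin T) ω => ε d (s + 1) ω ⬝ᵥ fun q => G q p)
      (A := autocov μ F 0 j j) (B := B * ∑ q, G q p ^ 2)
      (w := fun s t => ‖autocov μ (ε d) ((s + 1 : ℤ) - (t + 1))‖ * ∑ q, G q p ^ 2)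
      (fun s => h.memLp_factor _ j) (fun s => h.memLp_error_dotProduct hd _ _)
      (fun s t => ?_) (h.autocov_diag_nonneg j) (fun s t => h.abs_integral_factor_mul_le _ _ j)
      (fun s t => by rw [← hgg]; exact h.abs_integral_error_mul_le hd _ _ _)
      fun s => by
        rw [← Finset.sum_mul]
        exact mul_le_mul_of_nonneg_right (hBs _ s) hg0
    · refine ⟨h1.1, h1.2.trans ?_⟩
      have hA := h.autocov_diag_nonneg j
      gcongr
      exact_mod_cast card_halfSet_le T i
    · refine (h.indep d hd).comp
        (φ := fun x : ℤ → Fin r → ℝ => x (s + 1) j * x (t + 1) j)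
        (ψ := fun y : ℤ → Fin d → ℝ => (y (s + 1) ⬝ᵥ fun q => G q p) *
          (y (t + 1) ⬝ᵥ fun q => G q p)) (by fun_prop) ?_
      simp only [dotProduct]
      fun_prop
  refine (lintegral_frobSq_le (fun j p => (hentry j p).1) fun j p => (hentry j p).2).trans_eq ?_
  congr 1
  simp only [← Finset.mul_sum, ← Finset.sum_mul]
  rw [Finset.sum_comm]
  simp [frobSq, Matrix.trace]

/-- There are d² entries of variance O(T). After division by Td the deviation is O(1/√T) uniformly
in d, which is the source of ‖e‖² = O(κ). -/
theorem lintegral_frobSq_errors_cov_le (h : WoldAssumption μ F ε) :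
    ∃ C : ℝ, ∀ d, r < d → ∀ T : ℕ, ∫⁻ ω, ENNReal.ofReal (frobSq
      ((sample (ε d) T ω)ᵀ * sample (ε d) T ω - (T : ℝ) • autocov μ (ε d) 0)) ∂μ ≤
      ENNReal.ofReal (T * d ^ 2 * C) := by
  obtain ⟨M, hM⟩ := h.error
  refine ⟨M ^ 4 * |M|, fun d hd T => ?_⟩
  obtain ⟨D, b, hb, hb4, hD, hDM, hε⟩ := hM d hd
  have h1 := hε.lintegral_frobSq_le hb (M := |M|)
    (fun t i => ⟨(hb4 t i).1, (hb4 t i).2.trans (le_abs_self M)⟩) (abs_nonneg M) hD hDM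
    (Finset.univ : Finset (Fin T)) (injective_time T)
  refine le_trans (le_of_eq ?_) (h1.trans_eq ?_)
  · refine lintegral_congr fun ω => ?_
    congr 2
    rw [Finset.sum_sub_distrib]
    congr 1
    · ext i j
      simp [Matrix.mul_apply, Matrix.sum_apply, Matrix.vecMulVec_apply, sample]
    · simp [Nat.cast_smul_eq_nsmul]
  · congr 1
    simp
    ring

/-- The first half alone is treated because the test vectors for the eigenvalues are supported
there. -/
theorem lintegral_frobSq_factors_cov_le (h : WoldAssumption μ F ε) :
    ∃ C : ℝ, ∀ T : ℕ, ∫⁻ ω, ENNReal.ofReal (frobSq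
      ((sample F T ω)ᵀ * halves T true * sample F T ω -
        ((T / 2 : ℕ) : ℝ) • autocov μ F 0)) ∂μ ≤ ENNReal.ofReal (T * C) := by
  obtain ⟨D, b, hb, ⟨M, hb4⟩, hD, hF⟩ := h.factor
  refine ⟨(∑' k, ‖D k‖) ^ 4 * (r ^ 2 * |M|), fun T => ?_⟩
  have h1 := hF.lintegral_frobSq_le hb (M := |M|)
    (fun t i => ⟨(hb4 t i).1, (hb4 t i).2.trans (le_abs_self M)⟩) (abs_nonneg M) hD le_rfl
    (halfSet T true) (injective_time T)
  refine le_trans (le_of_eq ?_) (h1.trans (ENNReal.ofReal_le_ofReal ?_))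
  · refine lintegral_congr fun ω => ?_
    congr 2
    rw [Finset.sum_sub_distrib]
    congr 1
    · ext i j
      simp [transpose_mul_halves_mul, Matrix.sum_apply, Matrix.vecMulVec_apply, sample]
    · simp [Nat.cast_smul_eq_nsmul, card_halfSet_true]
  · have hc : ((halfSet T true).card : ℝ) ≤ T := by exact_mod_cast card_halfSet_le T true
    calc _ ≤ (∑' k, ‖D k‖) ^ 4 * (r ^ 2 * (T * |M|)) := by gcongr
      _ = _ := by ring

end Samples

/-! ### Regularity of the scaled model with high probability -/

section Scaling

theorem norm_le_of_frobSq_le {m n : ℕ} {A : Matrix (Fin m) (Fin n) ℝ} {b : ℝ} (hb : 0 ≤ b)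
    (h : frobSq A ≤ b ^ 2) : ‖A‖ ≤ b :=
  le_of_sq_le_sq ((norm_sq_le_frobSq A).trans h) hb

theorem delta_inv_bounds {d T : ℕ} (hd : 0 < d) (hT : 0 < T) :
    0 < (delta d T)⁻¹ ∧ (delta d T)⁻¹ ≤ 1 ∧ 1 / (d : ℝ) ≤ (delta d T)⁻¹ ^ 2 ∧
      1 / (T : ℝ) ≤ (delta d T)⁻¹ ^ 2 := by
  have hd' : (1 : ℝ) ≤ d := by exact_mod_cast hd
  have hT' : (1 : ℝ) ≤ T := by exact_mod_cast hT
  have h1 : 1 ≤ delta d T := le_min (Real.one_le_sqrt.2 hd') (Real.one_le_sqrt.2 hT')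
  have h0 : 0 < delta d T := by linarith
  have hsq : ∀ x : ℝ, 0 ≤ x → delta d T ≤ √x → delta d T ^ 2 ≤ x := fun x hx h => by
    rw [← Real.sq_sqrt hx]
    exact pow_le_pow_left₀ h0.le h 2
  refine ⟨inv_pos.2 h0, inv_le_one_of_one_le₀ h1, ?_, ?_⟩
  · rw [inv_pow, ← one_div]
    exact one_div_le_one_div_of_le (by positivity) (hsq _ (by positivity) (min_le_left _ _))
  · rw [inv_pow, ← one_div]
    exact one_div_le_one_div_of_le (by positivity) (hsq _ (by positivity) (min_le_right _ _))

variable {d T r : ℕ}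

/-- The scaled factors, loadings and errors form a regular model. -/
theorem regularModel_of_bounds (hd : 0 < d) (hT : 0 < T) {F : Matrix (Fin T) (Fin r) ℝ}
    {L : Matrix (Fin d) (Fin r) ℝ} {E : Matrix (Fin T) (Fin d) ℝ} {Γ : Matrix (Fin d) (Fin d) ℝ}
    {K c : ℝ} (hK : 1 ≤ K)
    (hF : frobSq F ≤ K * T) (hE : frobSq E ≤ K * (T * d)) (hEL : frobSq (E * L) ≤ K * (T * d))
    (hFE : ∀ i, frobSq (Fᵀ * halves T i * E) ≤ K * (T * d))
    (hFEL : ∀ i, frobSq (Fᵀ * halves T i * (E * L)) ≤ K * (T * d))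
    (hcov : frobSq (Eᵀ * E - (T : ℝ) • Γ) ≤ K * (T * d ^ 2)) (hΓ : ‖Γ‖ ≤ K)
    (hL : ‖L‖ ^ 2 ≤ K * d) (hL' : ∀ u, c ^ 2 * d * (u ⬝ᵥ u) ≤ (L *ᵥ u) ⬝ᵥ (L *ᵥ u))
    (hF' : ∀ u, c ^ 2 * T * (u ⬝ᵥ u) ≤ ((halves T true * F) *ᵥ u) ⬝ᵥ ((halves T true * F) *ᵥ u)) :
    RegularModel (2 * K) c (delta d T)⁻¹ (halves T) ((√(T : ℝ))⁻¹ • F) ((√(d : ℝ))⁻¹ • L)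
      ((√(T : ℝ) * √(d : ℝ))⁻¹ • E) := by
  obtain ⟨hκ, hκ1, hdκ, hTκ⟩ := delta_inv_bounds hd hT
  set κ := (delta d T)⁻¹
  have hd0 : (0 : ℝ) < d := by exact_mod_cast hd
  have hT0 : (0 : ℝ) < T := by exact_mod_cast hT
  have hTs : (√(T : ℝ))⁻¹ ^ 2 = 1 / T := by rw [inv_pow, Real.sq_sqrt hT0.le, one_div]
  have hds : (√(d : ℝ))⁻¹ ^ 2 = 1 / d := by rw [inv_pow, Real.sq_sqrt hd0.le, one_div]
  have hTds : (√(T : ℝ) * √(d : ℝ))⁻¹ ^ 2 = 1 / T * (1 / d) := by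
    rw [mul_inv, mul_pow, hTs, hds]
  have hKK : K ≤ (2 * K) ^ 2 := by nlinarith
  have hKn : (0 : ℝ) ≤ 2 * K := by linarith
  refine ⟨?_, fun u => ?_, ?_, fun u => ?_, ?_, ?_, ?_, fun i => ?_, fun i => ?_⟩
  · refine norm_le_of_frobSq_le hKn ?_
    rw [frobSq_smul, hTs]
    calc 1 / (T : ℝ) * frobSq F ≤ 1 / (T : ℝ) * (K * T) := by gcongr
      _ = K := by field_simp
      _ ≤ _ := hKK
  · rw [Matrix.mul_smul, Matrix.smul_mulVec, dotProduct_smul, smul_dotProduct, smul_smul, ← sq,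
      hTs, smul_eq_mul]
    calc c ^ 2 * (u ⬝ᵥ u) = 1 / (T : ℝ) * (c ^ 2 * T * (u ⬝ᵥ u)) := by field_simp
      _ ≤ _ := by gcongr; exact hF' u
  · refine le_of_sq_le_sq ?_ hKn
    rw [norm_smul, mul_pow, Real.norm_eq_abs, sq_abs, hds]
    calc 1 / (d : ℝ) * ‖L‖ ^ 2 ≤ 1 / (d : ℝ) * (K * d) := by gcongr
      _ = K := by field_simp
      _ ≤ _ := hKK
  · rw [Matrix.smul_mulVec, dotProduct_smul, smul_dotProduct, smul_smul, ← sq, hds, smul_eq_mul]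
    calc c ^ 2 * (u ⬝ᵥ u) = 1 / (d : ℝ) * (c ^ 2 * d * (u ⬝ᵥ u)) := by field_simp
      _ ≤ _ := by gcongr; exact hL' u
  · refine norm_le_of_frobSq_le hKn ?_
    rw [frobSq_smul, hTds]
    calc 1 / (T : ℝ) * (1 / d) * frobSq E ≤ 1 / (T : ℝ) * (1 / d) * (K * (T * d)) := by gcongr
      _ = K := by field_simp
      _ ≤ _ := hKK
  · rw [norm_smul, mul_pow, Real.norm_eq_abs, sq_abs, hTds, ← norm_transpose_mul_self]
    -- The deviation contributes O(1/√T) and the mean TΓ contributes O(1/d) after scaling; both are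
    -- at most of order κ.
    have h1 : ‖Eᵀ * E - (T : ℝ) • Γ‖ ≤ K * κ * (T * d) := by
      refine norm_le_of_frobSq_le (by positivity) (hcov.trans ?_)
      calc K * (T * (d : ℝ) ^ 2) = K * (1 / T) * (T * d) ^ 2 := by field_simp
        _ ≤ K ^ 2 * κ ^ 2 * (T * d) ^ 2 := by
          gcongr
          nlinarith
        _ = _ := by ring
    have h2 : ‖(T : ℝ) • Γ‖ ≤ K * κ * (T * d) := by
      rw [norm_smul, Real.norm_of_nonneg hT0.le]
      have h3 : 1 ≤ κ * d := by
        have h4 : 1 / (d : ℝ) ≤ κ := hdκ.trans (by nlinarith)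
        rwa [div_le_iff₀ hd0] at h4
      calc (T : ℝ) * ‖Γ‖ ≤ T * K * 1 := by rw [mul_one]; gcongr
        _ ≤ T * K * (κ * d) := by gcongr
        _ = _ := by ring
    have h5 : ‖Eᵀ * E‖ ≤ 2 * K * κ * (T * d) := by
      have := norm_add_le (Eᵀ * E - (T : ℝ) • Γ) ((T : ℝ) • Γ)
      rw [sub_add_cancel] at this
      linarith
    calc _ ≤ 1 / (T : ℝ) * (1 / d) * (2 * K * κ * (T * d)) := by gcongr
      _ = 2 * K * κ := by field_simp
  · refine norm_le_of_frobSq_le (by positivity) ?_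
    rw [Matrix.smul_mul, Matrix.mul_smul, smul_smul, frobSq_smul, mul_pow, hTds, hds]
    calc 1 / (T : ℝ) * (1 / d) * (1 / d) * frobSq (E * L)
        ≤ 1 / (T : ℝ) * (1 / d) * (1 / d) * (K * (T * d)) := by gcongr
      _ = K * (1 / d) := by field_simp
      _ ≤ (2 * K) ^ 2 * κ ^ 2 := by gcongr
      _ = _ := by ring
  · refine norm_le_of_frobSq_le (by positivity) ?_
    rw [Matrix.transpose_smul, Matrix.smul_mul, Matrix.smul_mul, Matrix.mul_smul, smul_smul,
      frobSq_smul, mul_pow, hTds, hTs]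
    calc 1 / (T : ℝ) * (1 / T * (1 / d)) * frobSq (Fᵀ * halves T i * E)
        ≤ 1 / (T : ℝ) * (1 / T * (1 / d)) * (K * (T * d)) := by gcongr; exact hFE i
      _ = K * (1 / T) := by field_simp
      _ ≤ (2 * K) ^ 2 * κ ^ 2 := by gcongr
      _ = _ := by ring
  · refine norm_le_of_frobSq_le (by positivity) ?_
    have h1 : ((√(T : ℝ))⁻¹ • F)ᵀ * halves T i * ((√(T : ℝ) * √(d : ℝ))⁻¹ • E) *
        ((√(d : ℝ))⁻¹ • L) = ((√(T : ℝ))⁻¹ * (√(T : ℝ) * √(d : ℝ))⁻¹ * (√(d : ℝ))⁻¹) •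
          (Fᵀ * halves T i * (E * L)) := by
      simp only [Matrix.transpose_smul, Matrix.smul_mul, Matrix.mul_smul, smul_smul,
        Matrix.mul_assoc]
      congr 1
      ring
    rw [h1, frobSq_smul, mul_pow, mul_pow, hTds, hTs, hds]
    calc 1 / (T : ℝ) * (1 / T * (1 / d)) * (1 / d) * frobSq (Fᵀ * halves T i * (E * L))
        ≤ 1 / (T : ℝ) * (1 / T * (1 / d)) * (1 / d) * (K * (T * d)) := by gcongr; exact hFEL i
      _ = K * ((1 / T) * (1 / d)) := by field_simp
      _ ≤ (2 * K) ^ 2 * (κ ^ 2 * κ ^ 2) := by gcongr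
      _ = _ := by ring

end Scaling

/-! ### From moment bounds to the regularity event. -/

section HighProbability

variable {Ω : Type*} [MeasurableSpace Ω] {μ : Measure Ω} [IsProbabilityMeasure μ] {r : ℕ}
  {Υ : ∀ d : ℕ, Matrix (Fin d) (Fin r) ℝ} {F : ℤ → Ω → Fin r → ℝ} {ε : ∀ d : ℕ, ℤ → Ω → Fin d → ℝ}

theorem isHermitian_transpose_mul_self' {m n : ℕ} (A : Matrix (Fin m) (Fin n) ℝ) :
    (Aᵀ * A).IsHermitian := by
  simpa using Matrix.isHermitian_conjTranspose_mul_self A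

/-- The singular values of the loadings are of the order `√d`. -/
theorem CrossSectionAssumption.exists_loadings_bounds (h : CrossSectionAssumption μ Υ ε) :
    ∃ v K : ℝ, 0 < v ∧ 0 ≤ K ∧ ∀ᶠ d : ℕ in atTop, ‖Υ d‖ ^ 2 ≤ K * d ∧
      ∀ u, v * d * (u ⬝ᵥ u) ≤ (Υ d *ᵥ u) ⬝ᵥ (Υ d *ᵥ u) := by
  obtain ⟨p, hp, hO⟩ := h.eig_limit
  obtain ⟨v, hv, hvp⟩ := exists_pos_le p hp
  have hlim : Tendsto (fun d : ℕ => 1 / √(d : ℝ)) atTop (nhds 0) := by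
    simp only [one_div]
    exact tendsto_inv_atTop_zero.comp (Real.tendsto_sqrt_atTop.comp tendsto_natCast_atTop_atTop)
  have hsmall := (hO.trans_tendsto hlim).eventually (Iio_mem_nhds (half_pos hv))
  refine ⟨v / 2, ‖p‖ + v / 2, half_pos hv, by positivity, ?_⟩
  filter_upwards [hsmall, eventually_gt_atTop 0] with d hd hd0
  have hd1 : (0 : ℝ) < d := by exact_mod_cast hd0
  -- Eventually all scaled eigenvalues are within half of the smallest limit v, hence between v/2
  -- and a constant.
  have hent : ∀ i : Fin r, |1 / (d : ℝ) * eigDesc ((Υ d)ᵀ * Υ d) i - p i| ≤ v / 2 := fun i => by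
    have h1 : (1 / (d : ℝ)) • eigMatrix (Υ d) - Matrix.diagonal p =
        Matrix.diagonal fun i : Fin r => 1 / (d : ℝ) * eigDesc ((Υ d)ᵀ * Υ d) i - p i := by
      rw [eigMatrix, ← Matrix.diagonal_smul, Matrix.diagonal_sub]
      rfl
    have h2 : ‖(1 / (d : ℝ)) • eigMatrix (Υ d) - Matrix.diagonal p‖ < v / 2 := hd
    rw [h1, Matrix.l2_opNorm_diagonal] at h2
    exact (norm_le_pi_norm (fun i : Fin r => 1 / (d : ℝ) * eigDesc ((Υ d)ᵀ * Υ d) i - p i) i).trans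
      h2.le
  have hA := isHermitian_transpose_mul_self' (Υ d)
  have hquad : ∀ u, (Υ d *ᵥ u) ⬝ᵥ (Υ d *ᵥ u) = u ⬝ᵥ (((Υ d)ᵀ * Υ d) *ᵥ u) := fun u => by
    rw [mulVec_dotProduct, Matrix.mulVec_mulVec]
  constructor
  · have h1 : ‖Υ d‖ ≤ √((‖p‖ + v / 2) * d) := by
      refine norm_le_of_mulVec_dotProduct_self_le _ (Real.sqrt_nonneg _) fun u => ?_
      rw [Real.sq_sqrt (by positivity), hquad]
      refine dotProduct_le_mul_of_eigDesc_le hA (fun i => ?_) u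
      have h2 := (abs_le.1 (hent i)).2
      have h3 : p i ≤ ‖p‖ := (le_abs_self _).trans (norm_le_pi_norm p i)
      have h4 : 1 / (d : ℝ) * eigDesc ((Υ d)ᵀ * Υ d) i ≤ ‖p‖ + v / 2 := by linarith
      rw [one_div, inv_mul_le_iff₀ hd1] at h4
      linarith
    calc ‖Υ d‖ ^ 2 ≤ √((‖p‖ + v / 2) * d) ^ 2 := pow_le_pow_left₀ (norm_nonneg _) h1 2
      _ = _ := Real.sq_sqrt (by positivity)
  · intro u
    rw [hquad]
    refine mul_dotProduct_le_of_le_eigDesc hA (fun i => ?_) u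
    have h2 := (abs_le.1 (hent i)).1
    have h4 : v / 2 ≤ 1 / (d : ℝ) * eigDesc ((Υ d)ᵀ * Υ d) i := by linarith [hvp i]
    rw [one_div, le_inv_mul_iff₀ hd1] at h4
    linarith

theorem CrossSectionAssumption.exists_autocov_bound (h : CrossSectionAssumption μ Υ ε) :
    ∃ B : ℝ, 0 ≤ B ∧ ∀ᶠ d : ℕ in atTop,
      ∑' k : ℤ, ENNReal.ofReal ‖autocov μ (ε d) k‖ ≤ ENNReal.ofReal B ∧
        ‖autocov μ (ε d) 0‖ ≤ B := by
  obtain ⟨b, hb1, hb2⟩ := exists_between h.error_autocov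
  refine ⟨b.toReal, ENNReal.toReal_nonneg, ?_⟩
  filter_upwards [eventually_lt_of_limsup_lt hb1] with d hd
  have h1 : ∑' k : ℤ, ENNReal.ofReal ‖autocov μ (ε d) k‖ ≤ ENNReal.ofReal b.toReal := by
    rw [ENNReal.ofReal_toReal hb2.ne]
    exact hd.le
  exact ⟨h1, (ENNReal.ofReal_le_ofReal_iff ENNReal.toReal_nonneg).1
    ((ENNReal.le_tsum (0 : ℤ)).trans h1)⟩

/-- Markov's inequality with the order of magnitude N in T and d factored out, so that a single
constant K serves all events. -/
theorem measure_not_le_mul_le {X : Ω → ℝ} (hX : Measurable X) {N B C K x : ℝ} (hN : 0 < N)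
    (hK : 0 < K) (h : ∫⁻ ω, ENNReal.ofReal (X ω) ∂μ ≤ ENNReal.ofReal (N * B)) (hBC : B ≤ C)
    (hx : C / K ≤ x) : μ {ω | ¬ X ω ≤ K * N} ≤ ENNReal.ofReal x := by
  refine (measure_not_le_le hX (mul_pos hK hN) h).trans (ENNReal.ofReal_le_ofReal ?_)
  rw [mul_comm K N, mul_div_mul_left _ _ hN.ne']
  exact (div_le_div_of_nonneg_right hBC hK.le).trans hx

theorem measurable_matrix_mul {m n k : ℕ} {A : Ω → Matrix (Fin m) (Fin n) ℝ}
    {B : Ω → Matrix (Fin n) (Fin k) ℝ} (hA : ∀ i j, Measurable fun ω => A ω i j)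
    (hB : ∀ i j, Measurable fun ω => B ω i j) (i : Fin m) (j : Fin k) :
    Measurable fun ω => (A ω * B ω) i j := by
  simp only [Matrix.mul_apply]
  exact Finset.measurable_fun_sum _ fun l _ => (hA i l).mul (hB l j)

/-- A lower bound for the smallest eigenvalue of a perturbed matrix. -/
theorem le_dotProduct_of_frobSq_sub_le {m T : ℕ} {D : Matrix (Fin T) (Fin T) ℝ} (hDs : Dᵀ = D)
    (hDi : D * D = D) {A : Matrix (Fin T) (Fin m) ℝ} {Γ : Matrix (Fin m) (Fin m) ℝ} {b v : ℝ}
    (hb : 0 ≤ b) (hA : frobSq (Aᵀ * D * A - Γ) ≤ b ^ 2)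
    (hΓ : ∀ u, v * (u ⬝ᵥ u) ≤ u ⬝ᵥ (Γ *ᵥ u)) (u : Fin m → ℝ) :
    (v - b) * (u ⬝ᵥ u) ≤ ((D * A) *ᵥ u) ⬝ᵥ ((D * A) *ᵥ u) := by
  have h1 : ((D * A) *ᵥ u) ⬝ᵥ ((D * A) *ᵥ u) =
      u ⬝ᵥ ((Aᵀ * D * A - Γ) *ᵥ u) + u ⬝ᵥ (Γ *ᵥ u) := by
    rw [← dotProduct_add, ← Matrix.add_mulVec, sub_add_cancel, mulVec_dotProduct,
      Matrix.mulVec_mulVec, Matrix.transpose_mul, hDs, Matrix.mul_assoc, ← Matrix.mul_assoc D,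
      hDi, Matrix.mul_assoc]
  have h2 := abs_dotProduct_mulVec_le (Aᵀ * D * A - Γ) u
  have h3 : ‖Aᵀ * D * A - Γ‖ ≤ b := norm_le_of_frobSq_le hb hA
  have h4 := (abs_le.1 h2).1
  have h5 := mul_le_mul_of_nonneg_right h3 (dotProduct_self_nonneg' u)
  rw [h1]
  linarith [hΓ u]

/-- The factors of the first half of the sample have singular values of the order `√T`. -/
theorem half_factors_lower_bound {T m : ℕ} (hT : 2 ≤ T) {A : Matrix (Fin T) (Fin m) ℝ}
    {Γ : Matrix (Fin m) (Fin m) ℝ} {γ K : ℝ} (hγ : 0 < γ)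
    (hΓ : ∀ u, γ * (u ⬝ᵥ u) ≤ u ⬝ᵥ (Γ *ᵥ u)) (hK : 64 * K ≤ T * γ ^ 2)
    (hA : frobSq (Aᵀ * halves T true * A - ((T / 2 : ℕ) : ℝ) • Γ) ≤ K * T) (u : Fin m → ℝ) :
    γ / 8 * T * (u ⬝ᵥ u) ≤ ((halves T true * A) *ᵥ u) ⬝ᵥ ((halves T true * A) *ᵥ u) := by
  have hsp := isSplit_halves T
  have hT0 : (0 : ℝ) ≤ T := Nat.cast_nonneg T
  have hb2 : K * T ≤ (γ * T / 8) ^ 2 := by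
    have := mul_le_mul_of_nonneg_right hK hT0
    linarith [this]
  -- The floor of T/2 is at least T/4 once T ≥ 2. Half of the resulting bound γT/4 is given up to
  -- the deviation.
  have hT4 : (T : ℝ) / 4 ≤ ((T / 2 : ℕ) : ℝ) := by
    have : T ≤ 4 * (T / 2) := by omega
    have : (T : ℝ) ≤ 4 * ((T / 2 : ℕ) : ℝ) := by exact_mod_cast this
    linarith
  have hΓ' : ∀ u, γ * T / 4 * (u ⬝ᵥ u) ≤ u ⬝ᵥ ((((T / 2 : ℕ) : ℝ) • Γ) *ᵥ u) := fun u => by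
    rw [Matrix.smul_mulVec, dotProduct_smul, smul_eq_mul]
    have hu := dotProduct_self_nonneg' u
    calc γ * T / 4 * (u ⬝ᵥ u) = (T : ℝ) / 4 * (γ * (u ⬝ᵥ u)) := by ring
      _ ≤ ((T / 2 : ℕ) : ℝ) * (u ⬝ᵥ (Γ *ᵥ u)) := mul_le_mul hT4 (hΓ u) (by positivity)
          (Nat.cast_nonneg _)
  refine le_trans (le_of_eq ?_) (le_dotProduct_of_frobSq_sub_le (hsp.symm true) (hsp.idem true)
    (b := γ * T / 8) (v := γ * T / 4) (by positivity) (hA.trans hb2) hΓ' u)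
  ring

/-- The scaled model is regular with probability close to one. -/
theorem FactorModelAssumptions.exists_regularModel (h : FactorModelAssumptions μ Υ F ε) :
    ∃ c : ℝ, 0 < c ∧ ∀ η : ℝ, 0 < η → ∃ K : ℝ, ∀ᶠ q : ℕ × ℕ in atTop,
      μ {ω | ¬ RegularModel K c (delta q.1 q.2)⁻¹ (halves q.2)
        ((√(q.2 : ℝ))⁻¹ • sample F q.2 ω) ((√(q.1 : ℝ))⁻¹ • Υ q.1)
        ((√(q.2 : ℝ) * √(q.1 : ℝ))⁻¹ • sample (ε q.1) q.2 ω)} ≤ ENNReal.ofReal η := by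
  obtain ⟨v, KL, hv, hKL, hload⟩ := h.crossSection.exists_loadings_bounds
  obtain ⟨B, hB0, hB⟩ := h.crossSection.exists_autocov_bound
  obtain ⟨γ, hγ, hγF⟩ := exists_pos_mul_dotProduct_le h.wold.factor_cov
  obtain ⟨C₁, hC₁⟩ := lintegral_frobSq_errors_le h.wold h.errorMoment
  obtain ⟨C₂, hC₂⟩ := lintegral_frobSq_errors_mul_loadings_le h.wold h.errorMoment
  obtain ⟨C₃, hC₃⟩ := lintegral_frobSq_errors_cov_le h.wold
  obtain ⟨C₄, hC₄⟩ := lintegral_frobSq_factors_cov_le h.wold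
  set tr := (autocov μ F 0).trace with htr
  have htr0 : 0 ≤ tr := Finset.sum_nonneg fun j _ => h.wold.autocov_diag_nonneg j
  set c := √(min v (γ / 8)) with hc
  have hcpos : 0 < min v (γ / 8) := lt_min hv (by positivity)
  have hc2 : c ^ 2 = min v (γ / 8) := Real.sq_sqrt hcpos.le
  refine ⟨c, Real.sqrt_pos.2 hcpos, fun η hη => ?_⟩
  obtain ⟨C, hC0, k1, k2, k3, k4, k5, k6, k7⟩ : ∃ C : ℝ, 0 ≤ C ∧ tr ≤ C ∧ C₁ ≤ C ∧ C₂ ≤ C ∧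
      tr * B ≤ C ∧ tr * (B * (r * KL)) ≤ C ∧ C₃ ≤ C ∧ C₄ ≤ C := by
    have n1 : 0 ≤ tr * B := by positivity
    have n2 : 0 ≤ tr * (B * (r * KL)) := by positivity
    refine ⟨tr + |C₁| + |C₂| + tr * B + tr * (B * (r * KL)) + |C₃| + |C₄|, by positivity,
      ?_, ?_, ?_, ?_, ?_, ?_, ?_⟩ <;>
    linarith [abs_nonneg C₁, abs_nonneg C₂, abs_nonneg C₃, abs_nonneg C₄, le_abs_self C₁,
      le_abs_self C₂, le_abs_self C₃, le_abs_self C₄]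
  -- Nine exceptional events, each allotted probability η/9. The lower bound c was fixed before η;
  -- only K₀ grows.
  obtain ⟨K₀, hK₀, hBK, hKLK, hCK⟩ : ∃ K : ℝ, 1 ≤ K ∧ B ≤ K ∧ KL ≤ K ∧ 9 * C / η ≤ K := by
    have : 0 ≤ 9 * C / η := by positivity
    refine ⟨1 + KL + B + 9 * C / η, ?_, ?_, ?_, ?_⟩ <;> linarith
  have hK₀pos : 0 < K₀ := by linarith
  have hx : C / K₀ ≤ η / 9 := by
    rw [div_le_iff₀ hK₀pos]
    rw [div_le_iff₀ hη] at hCK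
    linarith
  refine ⟨2 * K₀, ?_⟩
  rw [← prod_atTop_atTop_eq]
  filter_upwards [(hload.and (hB.and (eventually_gt_atTop r))).prod_mk ((eventually_ge_atTop 2).and
    (tendsto_natCast_atTop_atTop.eventually_ge_atTop (64 * K₀ / γ ^ 2)))]
  rintro ⟨d, T⟩ ⟨⟨⟨hLn, hLl⟩, ⟨hBd, hΓd⟩, hrd⟩, hT2, hTbig⟩
  dsimp only at *
  have hd : 0 < d := by omega
  have hT : 0 < T := by omega
  have hd0 : (0 : ℝ) < d := by exact_mod_cast hd
  have hT0 : (0 : ℝ) < T := by exact_mod_cast hT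
  have hTd : (0 : ℝ) < T * d := by positivity
  have mF : ∀ i j, Measurable fun ω => sample F T ω i j :=
    measurable_sample h.wold.measurable_factor_apply T
  have mE : ∀ i j, Measurable fun ω => sample (ε d) T ω i j :=
    measurable_sample (h.wold.measurable_error_apply hrd) T
  have mEL : ∀ i j, Measurable fun ω => (sample (ε d) T ω * Υ d) i j :=
    measurable_matrix_mul mE fun _ _ => measurable_const
  have mFt : ∀ b, ∀ i j, Measurable fun ω => ((sample F T ω)ᵀ * halves T b) i j := fun b =>
    measurable_matrix_mul (fun i j => mF j i) fun _ _ => measurable_const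
  -- the nine events
  have e1 : μ {ω | ¬ frobSq (sample F T ω) ≤ K₀ * T} ≤ ENNReal.ofReal (η / 9) :=
    measure_not_le_mul_le (measurable_frobSq mF) hT0 hK₀pos
      (lintegral_frobSq_factors_le h.wold T) k1 hx
  have e2 : μ {ω | ¬ frobSq (sample (ε d) T ω) ≤ K₀ * (T * d)} ≤ ENNReal.ofReal (η / 9) :=
    measure_not_le_mul_le (measurable_frobSq mE) hTd hK₀pos (hC₁ d hrd T) k2 hx
  have e3 : μ {ω | ¬ frobSq (sample (ε d) T ω * Υ d) ≤ K₀ * (T * d)} ≤ ENNReal.ofReal (η / 9) :=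
    measure_not_le_mul_le (measurable_frobSq mEL) hTd hK₀pos (hC₂ d hrd T) k3 hx
  have e4 : ∀ b, μ {ω | ¬ frobSq ((sample F T ω)ᵀ * halves T b * sample (ε d) T ω) ≤
      K₀ * (T * d)} ≤ ENNReal.ofReal (η / 9) := fun b => by
    refine measure_not_le_mul_le (measurable_frobSq (measurable_matrix_mul (mFt b) mE)) hTd hK₀pos
      (B := tr * B) ?_ k4 hx
    have h1 := lintegral_frobSq_factors_errors_le h.wold hrd hB0 hBd
      (1 : Matrix (Fin d) (Fin d) ℝ) T b
    simp only [Matrix.mul_one] at h1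
    refine h1.trans_eq ?_
    have h2 : frobSq (1 : Matrix (Fin d) (Fin d) ℝ) = d := by simp [frobSq, Matrix.one_apply]
    rw [h2]
    congr 1
    ring
  have e5 : ∀ b, μ {ω | ¬ frobSq ((sample F T ω)ᵀ * halves T b * (sample (ε d) T ω * Υ d)) ≤
      K₀ * (T * d)} ≤ ENNReal.ofReal (η / 9) := fun b => by
    refine measure_not_le_mul_le (measurable_frobSq (measurable_matrix_mul (mFt b) mEL)) hTd hK₀pos
      (B := tr * (B * (r * KL))) ?_ k5 hx
    refine (lintegral_frobSq_factors_errors_le h.wold hrd hB0 hBd (Υ d) T b).trans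
      (ENNReal.ofReal_le_ofReal ?_)
    have h2 : frobSq (Υ d) ≤ r * (KL * d) := (frobSq_le_norm_sq _).trans (by gcongr)
    calc (T : ℝ) * (tr * (B * frobSq (Υ d))) ≤ T * (tr * (B * (r * (KL * d)))) := by gcongr
      _ = _ := by ring
  have e6 : μ {ω | ¬ frobSq ((sample (ε d) T ω)ᵀ * sample (ε d) T ω -
      (T : ℝ) • autocov μ (ε d) 0) ≤ K₀ * (T * d ^ 2)} ≤ ENNReal.ofReal (η / 9) :=
    measure_not_le_mul_le (measurable_frobSq fun i j => (measurable_matrix_mul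
      (fun i j => mE j i) mE i j).sub_const _) (by positivity) hK₀pos (hC₃ d hrd T) k6 hx
  have e7 : μ {ω | ¬ frobSq ((sample F T ω)ᵀ * halves T true * sample F T ω -
      ((T / 2 : ℕ) : ℝ) • autocov μ F 0) ≤ K₀ * T} ≤ ENNReal.ofReal (η / 9) :=
    measure_not_le_mul_le (measurable_frobSq fun i j => (measurable_matrix_mul
      (mFt true) mF i j).sub_const _) hT0 hK₀pos (hC₄ T) k7 hx
  have hη9 : 0 ≤ η / 9 := by positivity
  have hall := measure_not_and_le hη9 (by positivity) e1 <|
    measure_not_and_le hη9 (by positivity) e2 <| measure_not_and_le hη9 (by positivity) e3 <|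
    measure_not_and_le hη9 (by positivity) (e4 true) <|
    measure_not_and_le hη9 (by positivity) (e4 false) <|
    measure_not_and_le hη9 (by positivity) (e5 true) <|
    measure_not_and_le hη9 (by positivity) (e5 false) <| measure_not_and_le hη9 hη9 e6 e7
  refine le_trans (measure_mono ?_) (hall.trans_eq (by congr 1; ring))
  intro ω hω hall
  apply hω
  obtain ⟨h1, h2, h3, h4, h4', h5, h5', h6, h7⟩ := hall
  refine regularModel_of_bounds hd hT hK₀ h1 h2 h3 (fun b => by cases b; exacts [h4', h4])
    (fun b => by cases b; exacts [h5', h5]) h6 (hΓd.trans hBK)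
    (hLn.trans (by gcongr)) (fun u => ?_) fun u => ?_
  · refine le_trans ?_ (hLl u)
    rw [hc2]
    have := dotProduct_self_nonneg' u
    gcongr
    exact min_le_left _ _
  · refine le_trans ?_ (half_factors_lower_bound hT2 hγ hγF (by
      rwa [div_le_iff₀ (by positivity)] at hTbig) h7 u)
    have hu := dotProduct_self_nonneg' u
    rw [hc2]
    gcongr
    exact min_le_right _ _

end HighProbability

/-! ### The estimators -/

section EstimatorAlgebra

variable {d r T : ℕ}

theorem RegularModel.mono_right {K c c' κ : ℝ} {D : Bool → Matrix (Fin T) (Fin T) ℝ}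
    {f : Matrix (Fin T) (Fin r) ℝ} {l : Matrix (Fin d) (Fin r) ℝ} {e : Matrix (Fin T) (Fin d) ℝ}
    (h : RegularModel K c κ D f l e) (hc : 0 ≤ c') (hcc : c' ≤ c) :
    RegularModel K c' κ D f l e :=
  have hle : ∀ x : ℝ, 0 ≤ x → c' ^ 2 * x ≤ c ^ 2 * x := fun x hx => by gcongr
  { h with
    f_ge := fun u => (hle _ (dotProduct_self_nonneg' u)).trans (h.f_ge u)
    l_ge := fun u => (hle _ (dotProduct_self_nonneg' u)).trans (h.l_ge u) }

theorem colProj_transpose (L : Matrix (Fin d) (Fin r) ℝ) : (colProj L)ᵀ = colProj L := by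
  simp [colProj, Matrix.transpose_nonsing_inv, Matrix.mul_assoc]

theorem colProj_mul_self {L : Matrix (Fin d) (Fin r) ℝ} (h : IsUnit (Lᵀ * L).det) :
    colProj L * L = L := by
  rw [colProj, Matrix.mul_assoc, Matrix.mul_assoc, Matrix.nonsing_inv_mul _ h, Matrix.mul_one]

theorem colProj_idem {L : Matrix (Fin d) (Fin r) ℝ} (h : IsUnit (Lᵀ * L).det) :
    colProj L * colProj L = colProj L := by
  conv_lhs => rhs; rw [colProj]
  rw [← Matrix.mul_assoc, ← Matrix.mul_assoc, colProj_mul_self h, colProj]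

/-- Passing from the data to the scaled model multiplies the Gram matrix by Td, which leaves the
leading eigenvectors unchanged. -/
theorem IsLeadingEigenvectors.of_smul {A : Matrix (Fin T) (Fin T) ℝ}
    {Q : Matrix (Fin T) (Fin r) ℝ} {c : ℝ} (hQ : IsLeadingEigenvectors (c • A) Q)
    (hA : A.IsHermitian) (hc : 0 < c) (hr : r ≤ T) : IsLeadingEigenvectors A Q := by
  refine ⟨hQ.orthonormal, ?_⟩
  have h1 := hQ.eigen
  have h2 : (Matrix.diagonal fun i : Fin r => eigDesc (c • A) i) =
      c • Matrix.diagonal fun i : Fin r => eigDesc A i := by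
    rw [← Matrix.diagonal_smul]
    congr 1; ext i
    exact eigDesc_smul hA hc (i.2.trans_le hr)
  rw [h2, Matrix.smul_mul, Matrix.mul_smul] at h1
  exact smul_right_injective _ hc.ne' h1

theorem isHermitian_mul_transpose_self' {m n : ℕ} (A : Matrix (Fin m) (Fin n) ℝ) :
    (A * Aᵀ).IsHermitian := by
  simpa using Matrix.isHermitian_mul_conjTranspose_self A

/-- Properties of the matrices `P_k = (P̂_k + 1) / 2`. -/
theorem half_projection_bounds {P : Matrix (Fin d) (Fin d) ℝ} (hs : Pᵀ = P) (hi : P * P = P) :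
    ((1 / 2 : ℝ) • (P + 1))ᵀ = (1 / 2 : ℝ) • (P + 1) ∧ ‖(1 / 2 : ℝ) • (P + 1)‖ ≤ 1 ∧
      ∀ z, 1 / 4 * (z ⬝ᵥ z) ≤ (((1 / 2 : ℝ) • (P + 1)) *ᵥ z) ⬝ᵥ (((1 / 2 : ℝ) • (P + 1)) *ᵥ z) := by
  refine ⟨by simp [hs], ?_, fun z => ?_⟩
  · have h1 := (norm_add_le P 1).trans (add_le_add (norm_idempotent_le hs hi) norm_one_le)
    rw [norm_smul, Real.norm_of_nonneg (by norm_num)]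
    linarith
  · have h1 := idempotent_mulVec_dotProduct hs hi z
    have h2 := dotProduct_self_nonneg' (P *ᵥ z)
    have h3 : z ⬝ᵥ (P *ᵥ z) = (P *ᵥ z) ⬝ᵥ z := dotProduct_comm _ _
    rw [Matrix.smul_mulVec, Matrix.add_mulVec, Matrix.one_mulVec, dotProduct_smul,
      smul_dotProduct, dotProduct_add, add_dotProduct, add_dotProduct, h3, h1, smul_eq_mul,
      smul_eq_mul]
    linarith

theorem mem_halfSet {s : Fin T} {i : Bool} :
    s ∈ halfSet T i ↔ decide ((s : ℕ) < T / 2) = i := by simp [halfSet]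

/-- Selecting rows by diagonal matrices turns the case distinction over time into a sum of two
matrix products. Symmetry of P is needed because it acts on rows from the right. -/
theorem transformed_eq_sum {P : Bool → Matrix (Fin d) (Fin d) ℝ} (hP : ∀ i, (P i)ᵀ = P i)
    (X : Matrix (Fin T) (Fin d) ℝ) :
    transformed (P true) (P false) X = ∑ i, halves T i * X * P i := by
  ext s j
  have h : ∀ (i : Bool) (A : Matrix (Fin T) (Fin d) ℝ), (halves T i * A) s j =
      if s ∈ halfSet T i then A s j else 0 := fun i A => by
    rw [halves, Matrix.diagonal_mul]; split_ifs <;> simp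
  have h2 : ∀ i, (X * P i) s j = (P i *ᵥ X s) j := fun i => by
    rw [Matrix.mul_apply, Matrix.mulVec, dotProduct]
    refine Finset.sum_congr rfl fun k _ => ?_
    rw [mul_comm, ← hP i, Matrix.transpose_apply, hP i]
  simp only [Fintype.sum_bool, Matrix.add_apply, Matrix.mul_assoc, h, h2, mem_halfSet, transformed,
    Matrix.of_apply]
  by_cases hs : (s : ℕ) < T / 2 <;> simp [hs]

theorem splitFactors_eq (F : Matrix (Fin T) (Fin r) ℝ) :
    splitFactors F = Matrix.fromCols (halves T true * F) (halves T false * F) := by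
  rw [splitFactors]
  congr 1 <;> ext s j <;> rw [halves, Matrix.diagonal_mul] <;>
  by_cases hs : (s : ℕ) < T / 2 <;> simp [hs, mem_halfSet]

/-- The signal part `F̃ Λ_P F̃'` of the Gram matrix of the transformed data. -/
theorem splitFactors_mul_projectedGram {P : Bool → Matrix (Fin d) (Fin d) ℝ}
    (hP : ∀ i, (P i)ᵀ = P i) (L : Matrix (Fin d) (Fin r) ℝ) (F : Matrix (Fin T) (Fin r) ℝ) :
    splitFactors F * projectedGram (P true) (P false) L * (splitFactors F)ᵀ =
      (∑ i, halves T i * F * Lᵀ * P i) * (∑ i, halves T i * F * Lᵀ * P i)ᵀ := by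
  rw [splitFactors_eq, projectedGram, Matrix.transpose_fromCols, Matrix.fromCols_mul_fromBlocks,
    Matrix.fromCols_mul_fromRows]
  simp only [Fintype.sum_bool, Matrix.transpose_add, Matrix.transpose_mul,
    Matrix.transpose_transpose, hP, (isSplit_halves T).symm, Matrix.add_mul, Matrix.mul_add,
    Matrix.mul_assoc]

/-- The factor error in terms of the scaled signal. -/
theorem factorError_eq {P : Bool → Matrix (Fin d) (Fin d) ℝ} (hP : ∀ i, (P i)ᵀ = P i)
    (hd : 0 < d) (hT : 0 < T) (l : Matrix (Fin d) (Fin r) ℝ) (f Q : Matrix (Fin T) (Fin r) ℝ)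
    (V : Matrix (Fin r) (Fin r) ℝ) {s : Matrix (Fin T) (Fin d) ℝ}
    (hs : s = ∑ i, halves T i * f * lᵀ * P i) :
    pcaFactors Q - splitFactors (√(T : ℝ) • f) * rotation (P true) (P false) (√(d : ℝ) • l)
      (√(T : ℝ) • f) (pcaFactors Q) V = √(T : ℝ) • (Q - s * sᵀ * Q * V⁻¹) := by
  have hd0 : (0 : ℝ) < d := by exact_mod_cast hd
  have hT0 : (0 : ℝ) < T := by exact_mod_cast hT
  have h1 := splitFactors_mul_projectedGram hP (√(d : ℝ) • l) (√(T : ℝ) • f)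
  have h2 : (∑ i, halves T i * (√(T : ℝ) • f) * (√(d : ℝ) • l)ᵀ * P i) =
      (√(T : ℝ) * √(d : ℝ)) • s := by
    rw [hs, Finset.smul_sum]
    refine Finset.sum_congr rfl fun i _ => ?_
    simp only [Matrix.transpose_smul, Matrix.smul_mul, Matrix.mul_smul, smul_smul]
    rw [mul_comm]
  have h3 : (1 / ((d : ℝ) * T)) • (((√(T : ℝ) * √(d : ℝ)) • s) * ((√(T : ℝ) * √(d : ℝ)) • s)ᵀ) =
      s * sᵀ := by
    rw [Matrix.transpose_smul, Matrix.smul_mul, Matrix.mul_smul, smul_smul, smul_smul]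
    have : 1 / ((d : ℝ) * T) * ((√(T : ℝ) * √(d : ℝ)) * (√(T : ℝ) * √(d : ℝ))) = 1 := by
      rw [mul_mul_mul_comm, Real.mul_self_sqrt hT0.le, Real.mul_self_sqrt hd0.le]
      field_simp
    rw [mul_assoc, this, one_smul]
  rw [h2] at h1
  rw [rotation, smul_sub, pcaFactors, Matrix.mul_smul, ← Matrix.mul_assoc, ← Matrix.mul_assoc,
    ← Matrix.mul_assoc, h1, ← Matrix.smul_mul, ← Matrix.smul_mul, h3, Matrix.mul_smul,
    Matrix.smul_mul]

/-- The transformed projections are regular, and almost fix the loadings. -/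
theorem RegularModel.shiftedProj_bounds {K c κ a : ℝ}
    {f : Matrix (Fin T) (Fin r) ℝ} {l : Matrix (Fin d) (Fin r) ℝ} {e : Matrix (Fin T) (Fin d) ℝ}
    (h : RegularModel K c κ (halves T) f l e) (hT : 0 < T) (hr : r ≤ T) (hc : 0 < c) (hK : 1 ≤ K)
    (hκ : 0 ≤ κ) (hκ₁ : 2 * K * κ ≤ c ^ 3) (hκ₂ : 6 * K ^ 3 * κ ≤ 1) (hKc : K⁻¹ ≤ c ^ 4 / 16)
    (ha : 0 < a) {Q : Matrix (Fin T) (Fin r) ℝ} {X : Matrix (Fin T) (Fin d) ℝ}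
    (hX : X = a • (f * lᵀ + e)) (hQ : IsLeadingEigenvectors (X * Xᵀ) Q) :
    (shiftedProj X Q)ᵀ = shiftedProj X Q ∧ ‖shiftedProj X Q‖ ≤ 1 ∧
      (∀ z, 1 / 4 * (z ⬝ᵥ z) ≤ (shiftedProj X Q *ᵥ z) ⬝ᵥ (shiftedProj X Q *ᵥ z)) ∧
      ‖l - shiftedProj X Q * l‖ ≤ 5 * K ^ 9 * κ := by
  have hT0 : (0 : ℝ) < T := by exact_mod_cast hT
  set x := f * lᵀ + e with hx
  have hXX : X * Xᵀ = (a * a) • (x * xᵀ) := by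
    rw [hX, Matrix.transpose_smul, Matrix.smul_mul, Matrix.mul_smul, smul_smul]
  rw [hXX] at hQ
  have hQ' := hQ.of_smul (isHermitian_mul_transpose_self' x) (mul_pos ha ha) hr
  -- The untransformed data are the special case in which both projections are the identity.
  have hv : ∀ i : Fin r, K⁻¹ ≤ eigDesc (x * xᵀ) i := fun i =>
    hKc.trans (h.le_eigDesc (isSplit_halves T) hc (by linarith) hκ hκ₁ (P := fun _ => 1)
      (fun _ => Matrix.transpose_one) (fun _ z => by
        rw [Matrix.one_mulVec]; linarith [dotProduct_self_nonneg' z])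
      (by simp only [Fintype.sum_bool, Matrix.mul_one]
          rw [← Matrix.add_mul, (isSplit_halves T).sum, Matrix.one_mul]) i.2)
  set L := pcaLoadings X Q with hL
  have hLx : L = (1 / (T : ℝ) * (√(T : ℝ) * a)) • (xᵀ * Q) := by
    rw [hL, pcaLoadings, pcaFactors, hX]
    simp only [Matrix.transpose_smul, Matrix.smul_mul, Matrix.mul_smul, smul_smul,
      Matrix.transpose_mul, Matrix.transpose_transpose]
    congr 1
    ring
  have hb : 0 < 1 / (T : ℝ) * (√(T : ℝ) * a) := by
    have := Real.sqrt_pos.2 hT0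
    positivity
  set b := 1 / (T : ℝ) * (√(T : ℝ) * a) with hbdef
  -- The estimated loadings have the Gram matrix b² diag(eigenvalues), so the eigenvalue bound makes
  -- the inverse in `colProj` a genuine one.
  have hunit : IsUnit (Lᵀ * L).det := by
    have h1 : Lᵀ * L = (b * b) • Matrix.diagonal fun i : Fin r => eigDesc (x * xᵀ) i := by
      rw [hLx, Matrix.transpose_smul, Matrix.smul_mul, Matrix.mul_smul, smul_smul,
        Matrix.transpose_mul, Matrix.transpose_transpose, Matrix.mul_assoc, ← Matrix.mul_assoc x,
        hQ'.eigen, ← Matrix.mul_assoc, hQ'.orthonormal, Matrix.one_mul]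
    rw [h1, Matrix.det_smul, Matrix.det_diagonal]
    have : 0 < K⁻¹ := inv_pos.2 (by linarith)
    exact (mul_pos (by positivity) (Finset.prod_pos fun i _ => this.trans_le (hv i))).ne'.isUnit
  have hPs := colProj_transpose L
  have hPi := colProj_idem hunit
  have hPx : colProj L * (xᵀ * Q) = xᵀ * Q := by
    have h1 := colProj_mul_self hunit
    nth_rewrite 2 [hLx] at h1
    nth_rewrite 2 [hLx] at h1
    rw [Matrix.mul_smul] at h1
    exact smul_right_injective _ hb.ne' h1
  obtain ⟨h1, h2, h3⟩ := half_projection_bounds hPs hPi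
  refine ⟨h1, h2, h3, ?_⟩
  have h4 := h.norm_projection_le (isSplit_halves T) hK hκ hκ₂ hQ'.orthonormal hv hQ'.eigen hPs hPi
    hPx
  have h5 : l - shiftedProj X Q * l = (1 / 2 : ℝ) • ((1 - colProj L) * l) := by
    rw [shiftedProj, ← hL, Matrix.smul_mul, Matrix.add_mul, Matrix.sub_mul, Matrix.one_mul]
    module
  rw [h5, norm_smul, Real.norm_of_nonneg (by norm_num)]
  linarith

/-- The deterministic bound for the estimation error. -/
theorem frobSq_factorError_le {K c κ a : ℝ} (hd : 0 < d) (hT : 0 < T) (hr : r ≤ T)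
    {f₁ f₂ : Matrix (Fin T) (Fin r) ℝ} {l₁ l₂ : Matrix (Fin d) (Fin r) ℝ}
    {e₁ e₂ : Matrix (Fin T) (Fin d) ℝ}
    (h₁ : RegularModel K c κ (halves T) f₁ l₁ e₁) (h₂ : RegularModel K c κ (halves T) f₂ l₂ e₂)
    (hc : 0 < c) (hK : 1 ≤ K) (hκ : 0 ≤ κ) (hκ₁ : 2 * K * κ ≤ c ^ 3) (hκ₂ : 6 * K ^ 3 * κ ≤ 1)
    (hKc : K⁻¹ ≤ c ^ 4 / 16) (hKc' : c⁻¹ ≤ K) {Ψ : Matrix (Fin r) (Fin r) ℝ} (hΨ : l₂ = l₁ * Ψ)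
    (ha : a = √(T : ℝ) * √(d : ℝ))
    {X₁ X₂ : Matrix (Fin T) (Fin d) ℝ} (hX₁ : X₁ = a • (f₁ * l₁ᵀ + e₁))
    (hX₂ : X₂ = a • (f₂ * l₂ᵀ + e₂)) {Q₁ Q₂ Q : Matrix (Fin T) (Fin r) ℝ}
    (hQ₁ : IsLeadingEigenvectors (X₁ * X₁ᵀ) Q₁) (hQ₂ : IsLeadingEigenvectors (X₂ * X₂ᵀ) Q₂)
    (hQ : IsLeadingEigenvectors
      (transformedData X₁ X₂ Q₁ Q₂ * (transformedData X₁ X₂ Q₁ Q₂)ᵀ) Q) :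
    1 / (T : ℝ) ^ 2 * frobSq ((factorError X₁ X₂ (√(d : ℝ) • l₂) (√(T : ℝ) • f₂) Q₁ Q₂ Q)ᵀ *
      (√(T : ℝ) • f₂)) ≤ r * (500 * (5 * K ^ 11) ^ 9) ^ 2 * κ ^ 4 := by
  have hd0 : (0 : ℝ) < d := by exact_mod_cast hd
  have hT0 : (0 : ℝ) < T := by exact_mod_cast hT
  have hK0 : 0 < K := by linarith
  have ha0 : 0 < a := by
    rw [ha]; exact mul_pos (Real.sqrt_pos.2 hT0) (Real.sqrt_pos.2 hd0)
  have haa : a * a = T * d := by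
    rw [ha, mul_mul_mul_comm, Real.mul_self_sqrt hT0.le, Real.mul_self_sqrt hd0.le]
  obtain ⟨s₁, n₁, g₁, p₁⟩ := h₁.shiftedProj_bounds hT hr hc hK hκ hκ₁ hκ₂ hKc ha0 hX₁ hQ₁
  obtain ⟨s₂, n₂, g₂, p₂⟩ := h₂.shiftedProj_bounds hT hr hc hK hκ hκ₁ hκ₂ hKc ha0 hX₂ hQ₂
  obtain ⟨P, hP⟩ : ∃ P : Bool → Matrix (Fin d) (Fin d) ℝ,
      P = fun i => if i then shiftedProj X₁ Q₁ else shiftedProj X₂ Q₂ := ⟨_, rfl⟩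
  have hPt : P true = shiftedProj X₁ Q₁ := by simp [hP]
  have hPf : P false = shiftedProj X₂ Q₂ := by simp [hP]
  have hPs : ∀ i, (P i)ᵀ = P i := fun i => by cases i <;> simp only [hPt, hPf, s₁, s₂]
  have hPn : ∀ i, ‖P i‖ ≤ 1 := fun i => by cases i <;> simp only [hPt, hPf, n₁, n₂]
  have hPg : ∀ i z, 1 / 4 * (z ⬝ᵥ z) ≤ (P i *ᵥ z) ⬝ᵥ (P i *ᵥ z) := fun i z => by
    cases i
    · rw [hPf]; exact g₂ z
    · rw [hPt]; exact g₁ z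
  -- The change of basis is bounded uniformly in d: |l₂u| = |l₁Ψu| ≥ c|Ψu|. Hence the approximation
  -- by P₁ carries over from l₁ to l₂ at the cost K².
  have hΨn : ‖Ψ‖ ≤ K ^ 2 := by
    have h1 : ‖Ψ‖ ≤ c⁻¹ * K := by
      refine norm_le_of_mulVec_dotProduct_self_le _ (by positivity) fun u => ?_
      have h2 := h₁.l_ge (Ψ *ᵥ u)
      rw [Matrix.mulVec_mulVec, ← hΨ] at h2
      have h3 := h2.trans (mulVec_dotProduct_self_le l₂ u)
      have h4 : ‖l₂‖ ^ 2 ≤ K ^ 2 := pow_le_pow_left₀ (norm_nonneg _) h₂.l_le 2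
      have h5 := h3.trans (mul_le_mul_of_nonneg_right h4 (dotProduct_self_nonneg' u))
      rw [mul_pow, inv_pow, mul_assoc, le_inv_mul_iff₀ (by positivity)]
      exact h5
    refine h1.trans ?_
    rw [sq]
    gcongr
  have hPl : ∀ i, ‖l₂ - P i * l₂‖ ≤ 5 * K ^ 11 * κ := fun i => by
    cases i
    · rw [hPf]
      refine p₂.trans ?_
      gcongr
      · norm_num
    · rw [hPt]
      have h1 : l₂ - shiftedProj X₁ Q₁ * l₂ = (l₁ - shiftedProj X₁ Q₁ * l₁) * Ψ := by
        rw [hΨ, Matrix.sub_mul, Matrix.mul_assoc]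
      rw [h1]
      exact (norm_mul_le_of_le p₁ hΨn).trans_eq (by ring)
  -- The constant 5K¹¹ = 5K⁹ · K² from the projection bounds takes over the role of K in the final
  -- estimate.
  have hKK : K ≤ 5 * K ^ 11 := by
    have h1 : K ^ 1 ≤ K ^ 11 := pow_le_pow_right₀ hK (by norm_num)
    have : 0 ≤ K ^ 11 := by positivity
    linarith
  -- the transformed data
  set Y := transformedData X₁ X₂ Q₁ Q₂ with hY
  obtain ⟨s, hs⟩ : ∃ s, s = ∑ i, halves T i * f₂ * l₂ᵀ * P i := ⟨_, rfl⟩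
  obtain ⟨n, hn⟩ : ∃ n, n = ∑ i, halves T i * e₂ * P i := ⟨_, rfl⟩
  have hsn : s + n = ∑ i, halves T i * (f₂ * l₂ᵀ + e₂) * P i := by
    rw [hs, hn, ← Finset.sum_add_distrib]
    refine Finset.sum_congr rfl fun i _ => ?_
    rw [Matrix.mul_add, Matrix.add_mul, Matrix.mul_assoc (halves T i)]
  have hYsn : Y = a • (s + n) := by
    rw [hY, transformedData, ← hPt, ← hPf, transformed_eq_sum hPs, hsn, Finset.smul_sum, hX₂]
    refine Finset.sum_congr rfl fun i _ => ?_
    rw [Matrix.mul_smul, Matrix.smul_mul]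
  have hYY : Y * Yᵀ = (a * a) • ((s + n) * (s + n)ᵀ) := by
    rw [hYsn, Matrix.transpose_smul, Matrix.smul_mul, Matrix.mul_smul, smul_smul]
  have hV : pcaEigenvalues r Y =
      Matrix.diagonal fun i : Fin r => eigDesc ((s + n) * (s + n)ᵀ) i := by
    rw [pcaEigenvalues, hYY, smul_smul, haa, one_div, inv_mul_cancel₀ (by positivity), one_smul]
  rw [hYY] at hQ
  have hQ' := hQ.of_smul (isHermitian_mul_transpose_self' (s + n)) (mul_pos ha0 ha0) hr
  have hv : ∀ i : Fin r, (5 * K ^ 11)⁻¹ ≤ eigDesc ((s + n) * (s + n)ᵀ) i := fun i =>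
    (inv_anti₀ hK0 hKK).trans (hKc.trans (h₂.le_eigDesc (isSplit_halves T) hc hK0 hκ hκ₁ hPs hPg
      hsn i.2))
  have hmain := (h₂.mono hκ hKK).norm_error_transpose_mul_le (isSplit_halves T)
    (hK.trans hKK) hκ hPs hPn hPl hQ'.orthonormal hv hs hn hQ'.eigen
  have hE : factorError X₁ X₂ (√(d : ℝ) • l₂) (√(T : ℝ) • f₂) Q₁ Q₂ Q = √(T : ℝ) • (Q - s * sᵀ * Q *
      (Matrix.diagonal fun i : Fin r => eigDesc ((s + n) * (s + n)ᵀ) i)⁻¹) := by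
    rw [factorError, ← hPt, ← hPf, ← hY, hV]
    exact factorError_eq hPs hd hT l₂ f₂ Q _ hs
  rw [hE, Matrix.transpose_smul, Matrix.smul_mul, Matrix.mul_smul, smul_smul,
    Real.mul_self_sqrt hT0.le, frobSq_smul, ← mul_assoc, one_div, inv_mul_cancel₀ (by positivity),
    one_mul]
  refine (frobSq_le_norm_sq _).trans ?_
  calc _ ≤ (r : ℝ) * (500 * (5 * K ^ 11) ^ 9 * κ ^ 2) ^ 2 := by gcongr
    _ = _ := by ring

end EstimatorAlgebra

/-! ### The rate of convergence -/

section Rate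

theorem tendsto_delta_inv :
    Tendsto (fun q : ℕ × ℕ => (delta q.1 q.2)⁻¹) atTop (nhds 0) := by
  have h : Tendsto (fun q : ℕ × ℕ => delta q.1 q.2) atTop atTop := by
    rw [tendsto_atTop]
    intro b
    have h1 := (Real.tendsto_sqrt_atTop.comp tendsto_natCast_atTop_atTop).eventually_ge_atTop b
    rw [← prod_atTop_atTop_eq]
    filter_upwards [h1.prod_mk h1] with q hq
    exact le_min hq.1 hq.2
  exact tendsto_inv_atTop_zero.comp h

theorem sample_observed {Ω : Type*} {d r : ℕ} (T : ℕ) (hd : 0 < d) (hT : 0 < T)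
    (Υ : Matrix (Fin d) (Fin r) ℝ) (F : ℤ → Ω → Fin r → ℝ) (ε : ℤ → Ω → Fin d → ℝ) (ω : Ω) :
    sample (observed Υ F ε) T ω = (√(T : ℝ) * √(d : ℝ)) • (((√(T : ℝ))⁻¹ • sample F T ω) *
      ((√(d : ℝ))⁻¹ • Υ)ᵀ + (√(T : ℝ) * √(d : ℝ))⁻¹ • sample ε T ω) := by
  have hd0 : √(d : ℝ) ≠ 0 := (Real.sqrt_pos.2 (by exact_mod_cast hd)).ne'
  have hT0 : √(T : ℝ) ≠ 0 := (Real.sqrt_pos.2 (by exact_mod_cast hT)).ne'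
  rw [Matrix.transpose_smul, Matrix.smul_mul, Matrix.mul_smul, smul_smul, ← mul_inv, ← smul_add,
    smul_smul, mul_inv_cancel₀ (mul_ne_zero hT0 hd0), one_smul]
  ext s i
  simp [sample, observed, Matrix.mul_apply, Matrix.mulVec, dotProduct, mul_comm]

/-- Under the null hypothesis the loadings of the second model are a transformation of those of
the first model. -/
theorem NullHypothesis.exists_eq_mul {r : ℕ} {Λ₁ Λ₂ : ∀ d : ℕ, Matrix (Fin d) (Fin r) ℝ}
    (h : NullHypothesis Λ₁ Λ₂) {d : ℕ} (hd : r < d) :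
    ∃ Ψ : Matrix (Fin r) (Fin r) ℝ, Λ₂ d = Λ₁ d * Ψ := by
  obtain ⟨Λ, Φ₁, Φ₂, -, h₁, -, e₁, e₂⟩ := h d hd
  refine ⟨Φ₁⁻¹ * Φ₂, ?_⟩
  rw [e₁, e₂, ← Matrix.mul_assoc, Matrix.mul_assoc Λ,
    Matrix.mul_nonsing_inv _ ((Matrix.isUnit_iff_isUnit_det _).1 h₁), Matrix.mul_one]

end Rate

end TwoSubject

/-! ### Combining the two models. -/

theorem mainTheorem6 {Ω : Type*} [MeasurableSpace Ω] (μ : Measure Ω) [IsProbabilityMeasure μ]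
    (r : ℕ) (Λ₁ Λ₂ : ∀ d : ℕ, Matrix (Fin d) (Fin r) ℝ)
    (F₁ F₂ : ℤ → Ω → Fin r → ℝ) (ε₁ ε₂ : ∀ d : ℕ, ℤ → Ω → Fin d → ℝ)
    (h₁ : TwoSubject.FactorModelAssumptions μ Λ₁ F₁ ε₁)
    (h₂ : TwoSubject.FactorModelAssumptions μ Λ₂ F₂ ε₂)
    (hnull : TwoSubject.NullHypothesis Λ₁ Λ₂)
    (X₁ X₂ : ∀ d T : ℕ, Ω → Matrix (Fin T) (Fin d) ℝ)
    (hX₁ : ∀ d T ω, X₁ d T ω = TwoSubject.sample (TwoSubject.observed (Λ₁ d) F₁ (ε₁ d)) T ω)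
    (hX₂ : ∀ d T ω, X₂ d T ω = TwoSubject.sample (TwoSubject.observed (Λ₂ d) F₂ (ε₂ d)) T ω)
    (Q₁ Q₂ Q : ∀ d T : ℕ, Ω → Matrix (Fin T) (Fin r) ℝ)
    (hQ₁ : ∀ d T ω, r < d → r ≤ T →
      TwoSubject.IsLeadingEigenvectors (X₁ d T ω * (X₁ d T ω)ᵀ) (Q₁ d T ω))
    (hQ₂ : ∀ d T ω, r < d → r ≤ T →
      TwoSubject.IsLeadingEigenvectors (X₂ d T ω * (X₂ d T ω)ᵀ) (Q₂ d T ω))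
    (hQ : ∀ d T ω, r < d → r ≤ T →
      TwoSubject.IsLeadingEigenvectors
        (TwoSubject.transformedData (X₁ d T ω) (X₂ d T ω) (Q₁ d T ω) (Q₂ d T ω) *
          (TwoSubject.transformedData (X₁ d T ω) (X₂ d T ω) (Q₁ d T ω) (Q₂ d T ω))ᵀ)
        (Q d T ω)) :
    TwoSubject.IsBigOP μ
      (fun d T ω => 1 / (T : ℝ) ^ 2 * TwoSubject.frobSq
        ((TwoSubject.factorError (X₁ d T ω) (X₂ d T ω) (Λ₂ d) (TwoSubject.sample F₂ T ω)
          (Q₁ d T ω) (Q₂ d T ω) (Q d T ω))ᵀ * TwoSubject.sample F₂ T ω))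
      (fun d T => 1 / TwoSubject.delta d T ^ 4) := by
  obtain ⟨c₁, hc₁, H₁⟩ := h₁.exists_regularModel
  obtain ⟨c₂, hc₂, H₂⟩ := h₂.exists_regularModel
  intro η hη
  obtain ⟨K₁, hK₁⟩ := H₁ (η / 2) (half_pos hη)
  obtain ⟨K₂, hK₂⟩ := H₂ (η / 2) (half_pos hη)
  obtain ⟨c, hc, hcc₁, hcc₂⟩ : ∃ c : ℝ, 0 < c ∧ c ≤ c₁ ∧ c ≤ c₂ :=
    ⟨min c₁ c₂, lt_min hc₁ hc₂, min_le_left _ _, min_le_right _ _⟩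
  obtain ⟨K, hK, hKK₁, hKK₂, hKc, hKc'⟩ : ∃ K : ℝ, 1 ≤ K ∧ K₁ ≤ K ∧ K₂ ≤ K ∧
      (c ^ 4 / 16)⁻¹ ≤ K ∧ c⁻¹ ≤ K := by
    have h1 : 0 < (c ^ 4 / 16)⁻¹ := by positivity
    have h2 : 0 < c⁻¹ := by positivity
    refine ⟨1 + |K₁| + |K₂| + (c ^ 4 / 16)⁻¹ + c⁻¹, ?_, ?_, ?_, ?_, ?_⟩ <;>
    linarith [abs_nonneg K₁, abs_nonneg K₂, le_abs_self K₁, le_abs_self K₂]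
  have hK0 : 0 < K := by linarith
  refine ⟨r * (500 * (5 * K ^ 11) ^ 9) ^ 2, ?_⟩
  have hlim := TwoSubject.tendsto_delta_inv
  have hκ₁ := (hlim.const_mul (2 * K)).eventually (Iic_mem_nhds
    (show 2 * K * 0 < c ^ 3 by rw [mul_zero]; positivity))
  have hκ₂ := (hlim.const_mul (6 * K ^ 3)).eventually (Iic_mem_nhds
    (show 6 * K ^ 3 * 0 < 1 by rw [mul_zero]; exact one_pos))
  have hdT : ∀ᶠ q : ℕ × ℕ in atTop, r < q.1 ∧ r < q.2 := by
    rw [← prod_atTop_atTop_eq]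
    exact (eventually_gt_atTop r).prod_mk (eventually_gt_atTop r)
  filter_upwards [hK₁, hK₂, hκ₁, hκ₂, hdT]
  rintro ⟨d, T⟩ e₁ e₂ hκ₁ hκ₂ ⟨hrd, hrT⟩
  dsimp only at *
  have hd : 0 < d := by omega
  have hT : 0 < T := by omega
  have hκ : 0 ≤ (TwoSubject.delta d T)⁻¹ := (TwoSubject.delta_inv_bounds hd hT).1.le
  have hboth := TwoSubject.measure_not_and_le (half_pos hη).le (half_pos hη).le e₁ e₂
  rw [add_halves] at hboth
  refine le_trans (measure_mono ?_) hboth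
  -- The exceedance event lies inside the failure of regularity, so monotonicity of the outer
  -- measure suffices whatever the measurability of the chosen eigenvectors.
  intro ω hω hreg
  rw [Set.mem_ofPred_eq] at hω
  refine absurd hω (not_lt.2 ?_)
  obtain ⟨Ψ, hΨ⟩ := hnull.exists_eq_mul hrd
  have hds : √(d : ℝ) ≠ 0 := (Real.sqrt_pos.2 (by exact_mod_cast hd)).ne'
  have hTs : √(T : ℝ) ≠ 0 := (Real.sqrt_pos.2 (by exact_mod_cast hT)).ne'
  have hbound := TwoSubject.frobSq_factorError_le hd hT hrT.le
    ((hreg.1.mono hκ hKK₁).mono_right hc.le hcc₁) ((hreg.2.mono hκ hKK₂).mono_right hc.le hcc₂)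
    hc hK hκ hκ₁ hκ₂ (inv_le_of_inv_le₀ (by positivity) hKc) hKc' (Ψ := Ψ)
    (by rw [hΨ, Matrix.smul_mul]) rfl
    ((hX₁ d T ω).trans (TwoSubject.sample_observed T hd hT _ _ _ ω))
    ((hX₂ d T ω).trans (TwoSubject.sample_observed T hd hT _ _ _ ω))
    (hQ₁ d T ω hrd hrT.le) (hQ₂ d T ω hrd hrT.le) (hQ d T ω hrd hrT.le)
  rw [smul_inv_smul₀ hds, smul_inv_smul₀ hTs] at hbound
  rw [abs_of_nonneg (mul_nonneg (by positivity) (TwoSubject.frobSq_nonneg _))]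
  refine hbound.trans_eq ?_
  rw [inv_pow, one_div]
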